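/- Let $q\ge 4$ be an even integer, $q=2p$, let $\lambda=2\cos\frac{\pi}{q}$ and $\frac12\le\alpha\le\frac1\lambda$. On $X_\alpha=[\lambda(\alpha-1),\lambda\alpha]$ let $T_\alpha(0)=0$ and, for $x\ne0$, $$T_\alpha(x)=\left|\tfrac1x\right|-\lambda d(x),\qquad d(x)=\left\lfloor\left|\tfrac{1}{x\lambda}\right|+1-\alpha\right\rfloor .$$ For $n\ge1$ put $\varepsilon_n=\operatorname{sgn}(T_\alpha^{n-1}(x))$ and $d_n=d(T_\alpha^{n-1}(x))$; let $R_{-1}=1$, $R_0=0$, $S_{-1}=0$, $S_0=1$, $R_n=d_n\lambda R_{n-1}+\varepsilon_nR_{n-2}$, $S_n=d_n\lambda S_{n-1}+\varepsilon_nS_{n-2}$, so that $R_n/S_n$ are the $\alpha$-Rosen convergents of $x$, and let $$\Theta_n(x)=S_n^2\left|x-\frac{R_n}{S_n}\right| .$$ (All of this is meaningful for every $n$ except for the countably many $x$ with a finite expansion.) Let $B_n=\sin\frac{n\pi}{q}/\sin\frac{\pi}{q}$ $(n\in\mathbb Z)$, $\ell_n=T_\alpha^n(\lambda(\alpha-1))$,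 $r_n=T_\alpha^n(\lambda\alpha)$, $H_{2n}=\frac{B_n}{B_{n+1}}$ and $H_{2n-1}=\frac{B_{p-n}-B_{p+1-n}}{B_{p-1-n}-B_{p-n}}$. The domain of the planar natural extension of $T_\alpha$ is, for $\alpha<1/\lambda$, $$\Omega_\alpha=\bigcup_{n=1}^{p-1}\Big([\ell_{n-1},r_n)\times[0,H_{2n-1}]\;\cup\;[r_n,\ell_n)\times[0,H_{2n}]\Big)\;\cup\;[\ell_{p-1},r_0)\times[0,H_{2p-1}],$$ and, for $\alpha=1/\lambda$, $$\Omega_{1/\lambda}=\bigcup_{n=1}^{p-1}\left[\frac{B_n-B_{n+1}}{B_n-B_{n-1}},\frac{B_{n+1}-B_{n+2}}{B_{n+1}-B_n}\right)\times\left[0,\frac{B_n}{B_{n+1}}\right].$$ Let $C_{q,\alpha}$ be the normalizing constant for which $\frac{C_{q,\alpha}}{(1+xy)^2}$ is a probability density on $\Omega_\alpha$, that is, $C_{q,\alpha}^{-1}=\iint_{\Omega_\alpha}\frac{dx\,dy}{(1+xy)^2}$, and let $$\mathcal L_\alpha=\min\left\{\frac{\lambda}{\lambda+2},\frac{\lambda(2-\alpha\lambda^2)}{4-\lambda^2}\right\}.$$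 Then for Lebesgue-almost every $x\in X_\alpha$ and all real $c\ge 1/\mathcal L_\alpha$, $$\lim_{N\to\infty}\frac1N\,\#\left\{n:\ 1\le n\le N,\ \Theta_n(x)<\frac1c\right\}=\frac{\lambda\,C_{q,\alpha}}{c}.$$ -/

import Mathlib

open Filter Topology MeasureTheory

noncomputable section

namespace AlphaRosen

/-- `λ = λ_q = 2 cos (π / q)`. -/
def lam (q : ℕ) : ℝ := 2 * Real.cos (Real.pi / q)

/-- The interval `X_α = [λ(α - 1), λα]` on which the continued fraction map acts. -/
def X (q : ℕ) (α : ℝ) : Set ℝ := Set.Icc (lam q * (α - 1)) (lam q * α)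

/-- The digit `d(x) = ⌊|1/(xλ)| + 1 - α⌋` for `x ≠ 0`. (By convention `d(0) = ∞`; the value of
this function at `0` matters only for those countably many `x` whose expansion is finite.) -/
def digit (q : ℕ) (α x : ℝ) : ℤ := ⌊|1 / (x * lam q)| + 1 - α⌋

/-- The α-Rosen map: `T_α(x) = |1/x| - λ d(x)` for `x ≠ 0`, and `T_α(0) = 0`. -/
def T (q : ℕ) (α x : ℝ) : ℝ :=
  if x = 0 then 0 else |1 / x| - lam q * (digit q α x : ℝ)

/-- The sign digits `ε_n(x) = sgn (T_α^{n-1} x)`, for `n ≥ 1`. -/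
def eps (q : ℕ) (α x : ℝ) (n : ℕ) : ℝ := Real.sign ((T q α)^[n - 1] x)

/-- The digits `d_n(x) = d (T_α^{n-1} x)`, for `n ≥ 1`. -/
def dig (q : ℕ) (α x : ℝ) (n : ℕ) : ℝ := (digit q α ((T q α)^[n - 1] x) : ℝ)

/-- Numerators of the α-Rosen convergents: `R_{-1} = 1`, `R_0 = 0`,
`R_n = d_n λ R_{n-1} + ε_n R_{n-2}`. -/
def R (q : ℕ) (α x : ℝ) : ℕ → ℝ
  | 0 => 0
  | 1 => dig q α x 1 * lam q * 0 + eps q α x 1 * 1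
  | n + 2 => dig q α x (n + 2) * lam q * R q α x (n + 1) + eps q α x (n + 2) * R q α x n

/-- Denominators of the α-Rosen convergents: `S_{-1} = 0`, `S_0 = 1`,
`S_n = d_n λ S_{n-1} + ε_n S_{n-2}`. -/
def S (q : ℕ) (α x : ℝ) : ℕ → ℝ
  | 0 => 1
  | 1 => dig q α x 1 * lam q * 1 + eps q α x 1 * 0
  | n + 2 => dig q α x (n + 2) * lam q * S q α x (n + 1) + eps q α x (n + 2) * S q α x n

/-- The approximation coefficients `Θ_n(x) = S_n² |x - R_n / S_n|`. -/
def Theta (q : ℕ) (α x : ℝ) (n : ℕ) : ℝ :=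
  S q α x n ^ 2 * |x - R q α x n / S q α x n|

/-- The orbit `ℓ_n = T_α^n (ℓ_0)` of the left endpoint `ℓ_0 = (α - 1) λ`. -/
def ell (q : ℕ) (α : ℝ) (n : ℕ) : ℝ := (T q α)^[n] ((α - 1) * lam q)

/-- The orbit `r_n = T_α^n (r_0)` of the right endpoint `r_0 = α λ`. -/
def r (q : ℕ) (α : ℝ) (n : ℕ) : ℝ := (T q α)^[n] (α * lam q)

/-- `B_n = sin (nπ/q) / sin (π/q)` for `n ∈ ℤ`, the solution of
`B_0 = 0`, `B_1 = 1`, `B_n = λ B_{n-1} - B_{n-2}` (see the three lemmas below). -/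
def B (q : ℕ) (n : ℤ) : ℝ := Real.sin (n * Real.pi / q) / Real.sin (Real.pi / q)

theorem B_zero (q : ℕ) : B q 0 = 0 := by simp [B]

theorem B_one {q : ℕ} (hq : 2 ≤ q) : B q 1 = 1 := by
  have hq' : (2 : ℝ) ≤ q := by exact_mod_cast hq
  have h : 0 < Real.sin (Real.pi / q) := by
    apply Real.sin_pos_of_pos_of_lt_pi
    · have := Real.pi_pos
      positivity
    · exact div_lt_self Real.pi_pos (by linarith)
  simp [B, h.ne']

theorem B_rec (q : ℕ) (n : ℤ) : B q n = lam q * B q (n - 1) - B q (n - 2) := by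
  have h0 : (n : ℝ) * Real.pi / q = (n - 1) * Real.pi / q + Real.pi / q := by ring
  have h2 : ((n : ℝ) - 2) * Real.pi / q = (n - 1) * Real.pi / q - Real.pi / q := by ring
  simp only [B, lam]
  push_cast
  rw [h0, h2, Real.sin_add, Real.sin_sub]
  ring

/-- The heights with even index (`q = 2p`): `H_{2n} = B_n / B_{n+1}`, `1 ≤ n ≤ p - 1`. -/
def Heven (q : ℕ) (n : ℤ) : ℝ := B q n / B q (n + 1)

/-- The heights with odd index (`q = 2p`):
`H_{2n-1} = (B_{p-n} - B_{p+1-n}) / (B_{p-1-n} - B_{p-n})`, `1 ≤ n ≤ p`. -/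
def Hodd (q : ℕ) (n : ℤ) : ℝ :=
  (B q ((q / 2 : ℕ) - n) - B q ((q / 2 : ℕ) + 1 - n)) /
    (B q ((q / 2 : ℕ) - 1 - n) - B q ((q / 2 : ℕ) - n))

/-- The domain of the planar natural extension for `q = 2p` and `1/2 ≤ α < 1/λ`: the union of
`[ℓ_{n-1}, r_n) × [0, H_{2n-1}]` and `[r_n, ℓ_n) × [0, H_{2n}]` for `1 ≤ n ≤ p - 1`, and of
`[ℓ_{p-1}, r_0) × [0, H_{2p-1}]`. (For `α = 1/2` the intervals `[r_n, ℓ_n)` are empty.) -/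
def OmegaGeneric (q : ℕ) (α : ℝ) : Set (ℝ × ℝ) :=
  (⋃ n ∈ Finset.Icc 1 (q / 2 - 1),
      Set.Ico (ell q α (n - 1)) (r q α n) ×ˢ Set.Icc 0 (Hodd q n) ∪
        Set.Ico (r q α n) (ell q α n) ×ˢ Set.Icc 0 (Heven q n)) ∪
    Set.Ico (ell q α (q / 2 - 1)) (r q α 0) ×ˢ Set.Icc 0 (Hodd q (q / 2 : ℕ))

/-- The domain of the planar natural extension for `q = 2p` and `α = 1/λ`. -/
def OmegaLast (q : ℕ) : Set (ℝ × ℝ) :=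
  ⋃ n ∈ Finset.Icc (1 : ℤ) ((q / 2 : ℕ) - 1),
    Set.Ico ((B q n - B q (n + 1)) / (B q n - B q (n - 1)))
        ((B q (n + 1) - B q (n + 2)) / (B q (n + 1) - B q n)) ×ˢ
      Set.Icc 0 (B q n / B q (n + 1))

open Classical in
/-- The domain `Ω_α` of the planar natural extension of `T_α`, for even `q ≥ 4`
and `1/2 ≤ α ≤ 1/λ`. -/
def Omega (q : ℕ) (α : ℝ) : Set (ℝ × ℝ) :=
  if α = 1 / lam q then OmegaLast q else OmegaGeneric q α

/-- The normalizing constant `C_{q,α}`, which makes `C_{q,α} / (1 + xy)²` a probability density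
on `Ω_α`. -/
def C (q : ℕ) (α : ℝ) : ℝ := (∫ z in Omega q α, 1 / (1 + z.1 * z.2) ^ 2)⁻¹

/-- The Lenstra-type constant `L_α = min {λ/(λ+2), λ(2 - αλ²)/(4 - λ²)}`. -/
def L (q : ℕ) (α : ℝ) : ℝ :=
  min (lam q / (lam q + 2)) (lam q * (2 - α * lam q ^ 2) / (4 - lam q ^ 2))

end AlphaRosen

end

/-!
The natural extension `(t, v) ↦ (T t, 1 / (d t * lam + sgn t * v))` is a bijection, up to null sets,
of a staircase over `X`, and preserves `dt dv / (1 + t v) ^ 2` there. Started at `(x, 0)`, its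
`n`-th iterate `(t, v)` records the tail of the expansion of `x` and the ratio `S_{n-1} / S_n`, and
`Theta_n x = |t| / (1 + t v)`.

The vertical direction is contracted uniformly, so the natural extension forgets where it started:
up to an error that tends to `0` as `k` grows, `Theta_n x` is a function of `T^(n-k) x` alone. The
frequencies are therefore governed by Birkhoff averages along orbits of `T` itself, and the
ergodicity of `T` suffices.

For ergodicity, a `T`-invariant set of transcendental numbers extends to a set invariant under
`x ↦ x + lam`, `x ↦ 1 / x` and `x ↦ -x`. The maps sending a tail to the point with given first
digits have bounded distortion, so if such a set is not null, it occupies a definite proportion of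
arbitrarily small intervals around almost every point; by Lebesgue density its complement is null.

The map `t ↦ t / (1 + t v)` turns `dt / (1 + t v) ^ 2` into Lebesgue measure on each horizontal
section, so the part of a section where `|t| / (1 + t v) < c` has mass `2 c` unless it is cut off by
the left end of the section. For `c ≤ L` this happens only at heights `v > lam - 1`, and there the
masses at `v` and `lam - v` add up to `2 c`. The total is therefore `lam * c`.
-/

namespace AlphaRosen

/-! ### The pointwise ergodic theorem -/

section Birkhoff

variable {Ω : Type*} {T : Ω → Ω} {f : Ω → ℝ}

/-- Running maxima of the Birkhoff sums of `f`, for the maximal ergodic theorem. The index is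
shifted: `birkhoffMax T f n` is the maximum of the sums of length `1, …, n + 1`. -/
noncomputable def birkhoffMax (T : Ω → Ω) (f : Ω → ℝ) : ℕ →o (Ω → ℝ) :=
  partialSups fun n => birkhoffSum T f (n + 1)

theorem birkhoffMax_zero (x : Ω) : birkhoffMax T f 0 x = f x := by
  simp [birkhoffMax]

theorem birkhoffSum_succ_le_birkhoffMax (n : ℕ) (x : Ω) :
    birkhoffSum T f (n + 1) x ≤ birkhoffMax T f n x :=
  le_partialSups (fun n => birkhoffSum T f (n + 1)) n x

theorem birkhoffMax_succ_eq_max (n : ℕ) (x : Ω) :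
    birkhoffMax T f (n + 1) x = max (birkhoffMax T f n x) (birkhoffSum T f (n + 2) x) := by
  simp [birkhoffMax, partialSups_add_one]

theorem birkhoffMax_succ (n : ℕ) (x : Ω) :
    birkhoffMax T f (n + 1) x = f x + max 0 (birkhoffMax T f n (T x)) := by
  induction n with
  | zero =>
    rw [birkhoffMax_succ_eq_max, birkhoffMax_zero, birkhoffMax_zero, birkhoffSum_succ',
      birkhoffSum_one, ← max_add_add_left, add_zero]
  | succ n ih =>
    rw [birkhoffMax_succ_eq_max, ih, birkhoffMax_succ_eq_max, birkhoffSum_succ' T f (n + 2),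
      max_add_add_left, max_assoc]

theorem bddAbove_range_birkhoffSum_comp_iff (x : Ω) :
    BddAbove (Set.range fun n => birkhoffSum T f n (T x)) ↔
      BddAbove (Set.range fun n => birkhoffSum T f n x) := by
  simp only [bddAbove_def, Set.forall_mem_range]
  constructor
  · rintro ⟨b, hb⟩
    refine ⟨max 0 (f x + b), fun n => ?_⟩
    rcases n with _ | n
    · simp
    · rw [birkhoffSum_succ']
      exact le_max_of_le_right (by linarith [hb n])
  · rintro ⟨b, hb⟩
    refine ⟨b - f x, fun n => ?_⟩
    have := hb (n + 1)
    rw [birkhoffSum_succ'] at this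
    linarith

theorem eventually_birkhoffMax_nonneg {x : Ω}
    (hx : ¬ BddAbove (Set.range fun n => birkhoffSum T f n x)) :
    ∀ᶠ n in atTop, 0 ≤ birkhoffMax T f n x := by
  simp only [bddAbove_def, Set.forall_mem_range] at hx
  push Not at hx
  obtain ⟨n, hn⟩ := hx 0
  rcases n with _ | n
  · simp at hn
  · filter_upwards [eventually_ge_atTop n] with m hm
    exact hn.le.trans
      ((birkhoffSum_succ_le_birkhoffMax n x).trans ((birkhoffMax T f).monotone hm x))

variable [MeasurableSpace Ω] {μ : Measure Ω}

theorem integrable_birkhoffSum (hT : MeasurePreserving T μ μ) (hf : Integrable f μ) (n : ℕ) :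
    Integrable (birkhoffSum T f n) μ :=
  integrable_finsetSum _ fun k _ => (hT.iterate k).integrable_comp_of_integrable hf

theorem integrable_birkhoffMax (hT : MeasurePreserving T μ μ) (hf : Integrable f μ) (n : ℕ) :
    Integrable (birkhoffMax T f n) μ := by
  induction n with
  | zero => exact hf.congr (Eventually.of_forall fun x => (birkhoffMax_zero x).symm)
  | succ n ih =>
    exact (ih.sup (integrable_birkhoffSum hT hf (n + 2))).congr
      (Eventually.of_forall fun x => (birkhoffMax_succ_eq_max n x).symm)

theorem nullMeasurableSet_bddAbove_range {g : ℕ → Ω → ℝ} (hg : ∀ n, AEMeasurable (g n) μ) :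
    NullMeasurableSet {x | BddAbove (Set.range fun n => g n x)} μ := by
  refine (measurableSet_bddAbove_range fun n => (hg n).measurable_mk).nullMeasurableSet.congr ?_
  filter_upwards [ae_all_iff.2 fun n => (hg n).ae_eq_mk] with x hx
  exact congrArg (fun u => BddAbove (Set.range u)) (funext fun n => (hx n).symm)

theorem integral_birkhoffMax_sub_comp_nonneg (hT : MeasurePreserving T μ μ) (hf : Integrable f μ)
    (n : ℕ) : 0 ≤ ∫ x, (birkhoffMax T f (n + 1) x - birkhoffMax T f n (T x)) ∂μ := by
  have hint := integrable_birkhoffMax hT hf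
  have hcomp : ∫ x, birkhoffMax T f n (T x) ∂μ = ∫ x, birkhoffMax T f n x ∂μ := by
    conv_rhs => rw [← hT.map_eq]
    refine (integral_map hT.aemeasurable ?_).symm
    rw [hT.map_eq]
    exact (hint n).aestronglyMeasurable
  have hint_comp : Integrable (fun x => birkhoffMax T f n (T x)) μ :=
    hT.integrable_comp_of_integrable (hint n)
  rw [integral_sub (hint _) hint_comp, hcomp, sub_nonneg]
  exact integral_mono (hint n) (hint _) ((birkhoffMax T f).monotone n.le_succ)

theorem integral_nonneg_of_ae_not_bddAbove_birkhoffSum (hT : MeasurePreserving T μ μ)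
    (hf : Integrable f μ)
    (h : ∀ᵐ x ∂μ, ¬ BddAbove (Set.range fun n => birkhoffSum T f n x)) : 0 ≤ ∫ x, f x ∂μ := by
  have hint := integrable_birkhoffMax hT hf
  have hlim : Tendsto (fun n => ∫ x, (birkhoffMax T f (n + 1) x - birkhoffMax T f n (T x)) ∂μ)
      atTop (𝓝 (∫ x, f x ∂μ)) := by
    refine tendsto_integral_of_dominated_convergence (fun x => |f x| + |f (T x)|)
      (fun n => ((hint _).sub (hT.integrable_comp_of_integrable (hint n))).aestronglyMeasurable)
      (hf.abs.add (hT.integrable_comp_of_integrable hf.abs))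
      (fun n => Eventually.of_forall fun x => ?_) ?_
    · have hle : f (T x) ≤ birkhoffMax T f n (T x) := by
        simpa only [birkhoffMax_zero] using (birkhoffMax T f).monotone n.zero_le (T x)
      rw [birkhoffMax_succ, Real.norm_eq_abs, abs_le]
      rcases max_cases 0 (birkhoffMax T f n (T x)) with ⟨hmax, _⟩ | ⟨hmax, _⟩ <;> rw [hmax] <;>
        constructor <;>
          linarith [neg_abs_le (f x), le_abs_self (f x), neg_abs_le (f (T x)), abs_nonneg (f (T x))]
    · filter_upwards [h] with x hx
      refine tendsto_const_nhds.congr' ?_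
      filter_upwards [eventually_birkhoffMax_nonneg
        (mt (bddAbove_range_birkhoffSum_comp_iff x).1 hx)] with n hn
      rw [birkhoffMax_succ, max_eq_right hn, add_sub_cancel_right]
  exact ge_of_tendsto' hlim (integral_birkhoffMax_sub_comp_nonneg hT hf)

theorem ae_bddAbove_birkhoffSum_of_integral_neg (hT : Ergodic T μ) (hf : Integrable f μ)
    (hneg : ∫ x, f x ∂μ < 0) :
    ∀ᵐ x ∂μ, BddAbove (Set.range fun n => birkhoffSum T f n x) := by
  have hmeas : NullMeasurableSet {x | BddAbove (Set.range fun n => birkhoffSum T f n x)} μ :=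
    nullMeasurableSet_bddAbove_range fun n =>
      (integrable_birkhoffSum hT.toMeasurePreserving hf n).aemeasurable
  refine (hT.quasiErgodic.ae_mem_or_ae_notMem₀ hmeas
    (Eventually.of_forall fun x => propext (bddAbove_range_birkhoffSum_comp_iff x))).resolve_right
    fun h => hneg.not_ge ?_
  exact integral_nonneg_of_ae_not_bddAbove_birkhoffSum hT.toMeasurePreserving hf h

variable [IsProbabilityMeasure μ]

theorem ae_eventually_birkhoffAverage_lt (hT : Ergodic T μ) (hf : Integrable f μ) {s : ℝ}
    (hs : ∫ x, f x ∂μ < s) : ∀ᵐ x ∂μ, ∀ᶠ n in atTop, birkhoffAverage ℝ T f n x < s := by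
  obtain ⟨t, hft, hts⟩ := exists_between hs
  have hneg : ∫ x, (f x - t) ∂μ < 0 := by
    rw [integral_sub hf (integrable_const t)]
    simpa using hft
  filter_upwards [ae_bddAbove_birkhoffSum_of_integral_neg hT (hf.sub (integrable_const t)) hneg]
    with x ⟨b, hb⟩
  have hsmall : ∀ᶠ n : ℕ in atTop, b / n < s - t :=
    (tendsto_const_div_atTop_nhds_zero_nat b).eventually_lt_const (sub_pos.2 hts)
  filter_upwards [hsmall, eventually_gt_atTop 0] with n hn hn0
  have hn0' : (0 : ℝ) < n := Nat.cast_pos.2 hn0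
  have hsum : birkhoffSum T f n x - n * t ≤ b := by
    simpa [birkhoffSum, Finset.sum_sub_distrib] using hb ⟨n, rfl⟩
  rw [div_lt_iff₀ hn0'] at hn
  rw [birkhoffAverage, smul_eq_mul, ← div_eq_inv_mul, div_lt_iff₀ hn0']
  linarith

theorem ae_tendsto_birkhoffAverage (hT : Ergodic T μ) (hf : Integrable f μ) :
    ∀ᵐ x ∂μ, Tendsto (birkhoffAverage ℝ T f · x) atTop (𝓝 (∫ x, f x ∂μ)) := by
  have hupper : ∀ {g : Ω → ℝ}, Integrable g μ → ∀ᵐ x ∂μ, ∀ k : ℕ, ∀ᶠ n in atTop,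
      birkhoffAverage ℝ T g n x < ∫ x, g x ∂μ + 1 / (k + 1) := fun hg =>
    ae_all_iff.2 fun k => ae_eventually_birkhoffAverage_lt hT hg
      (lt_add_of_pos_right _ Nat.one_div_pos_of_nat)
  filter_upwards [hupper hf, hupper hf.neg] with x hx hx'
  refine Metric.tendsto_nhds.2 fun ε hε => ?_
  obtain ⟨k, hk⟩ := exists_nat_one_div_lt hε
  filter_upwards [hx k, hx' k] with n hn hn'
  simp only [birkhoffAverage_neg, Pi.neg_apply, integral_neg] at hn'
  rw [Real.dist_eq, abs_lt]
  constructor <;> linarith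

theorem ae_tendsto_card_visits_div (hT : Ergodic T μ) {A : Set Ω} [DecidablePred (· ∈ A)]
    (hA : MeasurableSet A) :
    ∀ᵐ x ∂μ, Tendsto (fun N : ℕ => (((Finset.range N).filter fun n => T^[n] x ∈ A).card : ℝ) / N)
      atTop (𝓝 (μ.real A)) := by
  have hf : Integrable (A.indicator fun _ => (1 : ℝ)) μ := (integrable_const 1).indicator hA
  filter_upwards [ae_tendsto_birkhoffAverage hT hf] with x hx
  rw [integral_indicator_const _ hA, smul_eq_mul, mul_one] at hx
  refine hx.congr fun N => ?_
  simp [birkhoffAverage, birkhoffSum, Set.indicator_apply, div_eq_inv_mul]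

end Birkhoff

/-! ### The numbers `B` and the orbits of `z ↦ 1 / (l - z)` -/

section Lam

variable {q : ℕ}

theorem lam_pos (hq : 3 ≤ q) : 0 < lam q := by
  have hq' : (2 : ℝ) < q := by exact_mod_cast hq
  have hcos : 0 < Real.cos (Real.pi / q) := Real.cos_pos_of_mem_Ioo
    ⟨(neg_lt_zero.2 Real.pi_div_two_pos).trans (by positivity),
      div_lt_div_of_pos_left Real.pi_pos two_pos hq'⟩
  exact mul_pos two_pos hcos

theorem two_le_lam_sq (hq : 4 ≤ q) : 2 ≤ lam q ^ 2 := by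
  have hq' : (4 : ℝ) ≤ q := by exact_mod_cast hq
  have hcos : √2 / 2 ≤ Real.cos (Real.pi / q) := by
    rw [← Real.cos_pi_div_four]
    refine Real.cos_le_cos_of_nonneg_of_le_pi (by positivity) (by linarith [Real.pi_pos]) ?_
    exact div_le_div_of_nonneg_left Real.pi_pos.le four_pos hq'
  have hsqrt : √2 ≤ lam q := by
    unfold lam
    linarith
  calc (2 : ℝ) = √2 ^ 2 := (Real.sq_sqrt zero_le_two).symm
    _ ≤ lam q ^ 2 := by gcongr

theorem one_lt_lam (hq : 4 ≤ q) : 1 < lam q := by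
  nlinarith [lam_pos (by omega : 3 ≤ q), two_le_lam_sq hq]

theorem lam_lt_two (hq : q ≠ 0) : lam q < 2 := by
  have hq' : (1 : ℝ) ≤ q := by exact_mod_cast Nat.one_le_iff_ne_zero.2 hq
  have hcos : Real.cos (Real.pi / q) < Real.cos 0 :=
    Real.cos_lt_cos_of_nonneg_of_le_pi le_rfl (div_le_self Real.pi_pos.le hq') (by positivity)
  rw [Real.cos_zero] at hcos
  unfold lam
  linarith

theorem isAlgebraic_lam (q : ℕ) : IsAlgebraic ℚ (lam q) := by
  have hcos : lam q = 2 * Real.cos (((1 / q : ℚ) : ℝ) * Real.pi) := by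
    rw [lam, Rat.cast_div, Rat.cast_one, Rat.cast_natCast, one_div_mul_eq_div]
  rw [hcos]
  exact (Real.isIntegral_two_mul_cos_rat_mul_pi (1 / q : ℚ)).isAlgebraic.extendScalars
    Int.cast_injective

end Lam

section B

variable {q : ℕ}

theorem sin_pi_div_pos (hq : 2 ≤ q) : 0 < Real.sin (Real.pi / q) := by
  have hq' : (1 : ℝ) < q := by exact_mod_cast hq
  exact Real.sin_pos_of_pos_of_lt_pi (by positivity) (div_lt_self Real.pi_pos hq')

theorem B_neg (q : ℕ) (n : ℤ) : B q (-n) = -B q n := by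
  simp [B, neg_mul, neg_div]

theorem B_neg_one (hq : 2 ≤ q) : B q (-1) = -1 := by
  rw [B_neg, B_one hq]

theorem B_two (hq : 2 ≤ q) : B q 2 = lam q := by
  have h := B_rec q 2
  norm_num [B_zero, B_one hq] at h
  exact h

theorem lam_mul_B (q : ℕ) (n : ℤ) : lam q * B q n = B q (n + 1) + B q (n - 1) := by
  have h := B_rec q (n + 1)
  rw [show n + 1 - 1 = n by ring, show n + 1 - 2 = n - 1 by ring] at h
  linarith

theorem B_pos {k : ℤ} (hk : 0 < k) (hkq : k < q) : 0 < B q k := by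
  have hk' : (0 : ℝ) < k := by exact_mod_cast hk
  have hkq' : (k : ℝ) < q := by exact_mod_cast hkq
  refine div_pos (Real.sin_pos_of_pos_of_lt_pi ?_ ?_) (sin_pi_div_pos (by omega))
  · have := hk'.trans hkq'
    positivity
  · rw [div_lt_iff₀ (hk'.trans hkq'), mul_comm]
    gcongr

theorem B_nonneg {k : ℤ} (hk : 0 ≤ k) (hkq : k < q) : 0 ≤ B q k := by
  rcases hk.eq_or_lt with rfl | hk
  · rw [B_zero]
  · exact (B_pos hk hkq).le

theorem B_lt_B (hq : 2 ≤ q) {a b : ℤ} (ha : -(q : ℤ) ≤ 2 * a) (hab : a < b) (hb : 2 * b ≤ q) :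
    B q a < B q b := by
  have ha' : -(q : ℝ) ≤ 2 * a := by exact_mod_cast ha
  have hb' : 2 * (b : ℝ) ≤ q := by exact_mod_cast hb
  have hq0 : (0 : ℝ) < q := by exact_mod_cast (by omega : 0 < q)
  have hpi := Real.pi_pos
  refine div_lt_div_of_pos_right ?_ (sin_pi_div_pos hq)
  refine Real.sin_lt_sin_of_lt_of_le_pi_div_two ?_ ?_ ?_
  · rw [le_div_iff₀ hq0]
    nlinarith
  · rw [div_le_iff₀ hq0]
    nlinarith
  · gcongr

theorem B_half_add_one (hq : 2 ≤ q) (hqe : Even q) :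
    B q ((q / 2 : ℕ) + 1) = B q ((q / 2 : ℕ) - 1) := by
  obtain ⟨p, rfl⟩ := hqe
  have hp0 : (p : ℝ) ≠ 0 := by exact_mod_cast (by omega : p ≠ 0)
  rw [show (p + p) / 2 = p by omega, B, B, ← Real.sin_pi_sub]
  congr 2
  push_cast
  field_simp
  ring

theorem B_half_sub_one (hq : 2 ≤ q) (hqe : Even q) :
    B q ((q / 2 : ℕ) - 1) = lam q / 2 * B q (q / 2 : ℕ) := by
  have h := lam_mul_B q (q / 2 : ℕ)
  rw [B_half_add_one hq hqe] at h
  linarith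

theorem B_half_sub_two (hq : 2 ≤ q) (hqe : Even q) :
    B q ((q / 2 : ℕ) - 2) = (lam q ^ 2 / 2 - 1) * B q (q / 2 : ℕ) := by
  have h := lam_mul_B q ((q / 2 : ℕ) - 1)
  rw [sub_add_cancel, B_half_sub_one hq hqe,
    show ((q / 2 : ℕ) : ℤ) - 1 - 1 = (q / 2 : ℕ) - 2 by ring] at h
  linarith

end B

/-- The map `z ↦ 1 / (l - z)` moves the ratio of consecutive terms of a solution of
`l w_n = w_{n-1} + w_{n+1}` to the next ratio. -/
theorem one_div_sub_div_of_mul_eq_add {l u v w : ℝ} (hv : v ≠ 0) (h : l * v = u + w) :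
    1 / (l - u / v) = v / w := by
  rw [sub_div' hv, h, add_sub_cancel_left, one_div_div]

/-- The orbits of the two points `-a` and `a / (1 + l a)` under `z ↦ 1 / (l - z)`, interlaced.
Their negatives are the division points of the horizontal axis for the planar domain. -/
noncomputable def chain (l a : ℝ) : ℕ → ℝ
  | 0 => -a
  | 1 => a / (1 + l * a)
  | n + 2 => 1 / (l - chain l a n)

/-- The heights of the planar domain, in increasing order: `height l (2 n) = H_{2n}` and
`height l (2 n - 1) = H_{2n-1}`, with an additional first height `0`. -/
noncomputable def height (l : ℝ) : ℕ → ℝ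
  | 0 => 0
  | 1 => 1 / (l + 1)
  | n + 2 => 1 / (l - height l n)

section Chain

variable {q : ℕ} {a : ℝ}

theorem chain_even_den_pos (ha : 0 ≤ a) {k : ℕ} (hk : k + 2 ≤ q) :
    0 < B q (k + 1) + a * B q k :=
  add_pos_of_pos_of_nonneg (B_pos (by omega) (by omega))
    (mul_nonneg ha (B_nonneg (by omega) (by omega)))

theorem chain_odd_den_pos (ha : 0 ≤ a) {k : ℕ} (hk : k + 3 ≤ q) :
    0 < B q (k + 1) + a * B q (k + 2) :=
  add_pos_of_pos_of_nonneg (B_pos (by omega) (by omega))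
    (mul_nonneg ha (B_nonneg (by omega) (by omega)))

theorem chain_even (ha : 0 ≤ a) {k : ℕ} (hk : k + 2 ≤ q) :
    chain (lam q) a (2 * k) = (B q k + a * B q (k - 1)) / (B q (k + 1) + a * B q k) := by
  induction k with
  | zero => simp [chain, B_zero, B_one hk, B_neg_one hk]
  | succ k ih =>
    have hden := chain_even_den_pos ha (by omega : k + 2 ≤ q)
    have h₁ := lam_mul_B q (k + 1)
    have h₀ := lam_mul_B q k
    rw [show 2 * (k + 1) = 2 * k + 2 by ring, chain, ih (by omega)]
    push_cast
    rw [show (k : ℤ) + 1 - 1 = k by ring] at h₁ ⊢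
    exact one_div_sub_div_of_mul_eq_add hden.ne' (by linear_combination h₁ + a * h₀)

theorem chain_odd (ha : 0 ≤ a) {k : ℕ} (hk : k + 3 ≤ q) :
    chain (lam q) a (2 * k + 1) = (B q k + a * B q (k + 1)) / (B q (k + 1) + a * B q (k + 2)) := by
  induction k with
  | zero => simp [chain, B_zero, B_one (by omega : 2 ≤ q), B_two (by omega : 2 ≤ q), mul_comm]
  | succ k ih =>
    have hden := chain_odd_den_pos ha (by omega : k + 3 ≤ q)
    have h₁ := lam_mul_B q (k + 1)
    have h₂ := lam_mul_B q (k + 2)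
    rw [show 2 * (k + 1) + 1 = 2 * k + 1 + 2 by ring, chain, ih (by omega)]
    push_cast
    rw [show (k : ℤ) + 1 - 1 = k by ring, show (k : ℤ) + 1 + 1 = k + 2 by ring] at *
    rw [show (k : ℤ) + 2 - 1 = k + 1 by ring, show (k : ℤ) + 2 + 1 = k + 1 + 2 by ring] at h₂
    exact one_div_sub_div_of_mul_eq_add hden.ne' (by linear_combination h₁ + a * h₂)

theorem chain_succ_nonneg (ha : 0 ≤ a) {j : ℕ} (hj : j + 3 ≤ q) :
    0 ≤ chain (lam q) a (j + 1) := by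
  obtain ⟨k, rfl | rfl⟩ := Nat.even_or_odd' j
  · rw [chain_odd ha (by omega)]
    exact div_nonneg (add_nonneg (B_nonneg (by omega) (by omega))
      (mul_nonneg ha (B_nonneg (by omega) (by omega)))) (chain_odd_den_pos ha (by omega)).le
  · rw [show 2 * k + 1 + 1 = 2 * (k + 1) by ring, chain_even ha (by omega)]
    exact div_nonneg (add_nonneg (B_nonneg (by omega) (by omega))
      (mul_nonneg ha (B_nonneg (by omega) (by omega)))) (chain_even_den_pos ha (by omega)).le

theorem chain_lt_lam (ha : 0 ≤ a) {j : ℕ} (hj : j + 4 ≤ q) : chain (lam q) a j < lam q := by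
  obtain ⟨k, rfl | rfl⟩ := Nat.even_or_odd' j
  · have hden := chain_even_den_pos ha (by omega : (k + 1) + 2 ≤ q)
    have h₁ := lam_mul_B q (k + 1)
    have h₀ := lam_mul_B q k
    rw [chain_even ha (by omega), div_lt_iff₀ (chain_even_den_pos ha (by omega))]
    push_cast at hden
    rw [show (k : ℤ) + 1 - 1 = k by ring] at h₁
    linear_combination hden - h₁ - a * h₀
  · have hden := chain_odd_den_pos ha (by omega : (k + 1) + 3 ≤ q)
    have h₁ := lam_mul_B q (k + 1)
    have h₂ := lam_mul_B q (k + 2)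
    rw [chain_odd ha (by omega), div_lt_iff₀ (chain_odd_den_pos ha (by omega))]
    push_cast at hden
    rw [show (k : ℤ) + 1 - 1 = k by ring, show (k : ℤ) + 1 + 1 = k + 2 by ring] at *
    rw [show (k : ℤ) + 2 - 1 = k + 1 by ring, show (k : ℤ) + 2 + 1 = k + 1 + 2 by ring] at h₂
    linear_combination hden - h₁ - a * h₂

theorem chain_add_two_pos (ha : 0 ≤ a) {j : ℕ} (hj : j + 4 ≤ q) :
    0 < chain (lam q) a (j + 2) :=
  one_div_pos.2 (sub_pos.2 (chain_lt_lam ha hj))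

theorem chain_le_add_two (ha : 0 ≤ a) {j : ℕ} (hj : j + 4 ≤ q) :
    chain (lam q) a j ≤ chain (lam q) a (j + 2) := by
  have hl := one_lt_lam (by omega : 4 ≤ q)
  induction j using Nat.twoStepInduction with
  | zero =>
    have := chain_add_two_pos ha hj
    simp only [chain] at this ⊢
    linarith
  | one =>
    have hlt := chain_lt_lam ha hj
    have hden : 0 < 1 + lam q * a := by positivity
    simp only [chain] at hlt ⊢
    rw [div_le_div_iff₀ hden (by linarith), mul_sub, mul_div_assoc', sub_le_iff_le_add,
      ← sub_le_iff_le_add', le_div_iff₀ hden]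
    nlinarith [mul_nonneg ha ha, mul_nonneg ha (by linarith : 0 ≤ lam q)]
  | more j ih _ =>
    have hlt := chain_lt_lam ha hj
    have hle := ih (by omega)
    simp only [chain] at *
    exact one_div_le_one_div_of_le (by linarith) (by linarith)

theorem chain_le_succ (ha : 0 ≤ a) (ha1 : a ≤ 1) {j : ℕ} (hq : 4 ≤ q) (hj : j + 3 ≤ q) :
    chain (lam q) a j ≤ chain (lam q) a (j + 1) := by
  have hl := one_lt_lam hq
  induction j using Nat.twoStepInduction with
  | zero =>
    have := chain_succ_nonneg ha hj
    simp only [chain] at this ⊢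
    linarith
  | one =>
    simp only [chain]
    rw [div_le_div_iff₀ (by positivity) (by linarith)]
    nlinarith
  | more j ih _ =>
    have hlt := chain_lt_lam ha (by omega : (j + 1) + 4 ≤ q)
    have hle := ih (by omega)
    simp only [chain] at *
    exact one_div_le_one_div_of_le (by linarith) (by linarith)

/-- The parameter `a` for which the chain of `a` ends in `l - x`, see `chain_sub_two`. -/
noncomputable def chainParam (l x : ℝ) : ℝ := (2 * x - l) / (2 - l * x)

theorem chainParam_nonneg {l x : ℝ} (hx : l / 2 ≤ x) (hx' : l * x < 2) : 0 ≤ chainParam l x :=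
  div_nonneg (by linarith) (by linarith)

theorem chainParam_le_self {l x : ℝ} (hl : 0 ≤ l) (hx0 : 0 ≤ x) (hx : x ≤ 1) (hx' : l * x < 2) :
    chainParam l x ≤ x := by
  rw [chainParam, div_le_iff₀ (by linarith)]
  nlinarith [mul_nonneg hl (by nlinarith : 0 ≤ 1 - x ^ 2)]

variable {x : ℝ}

theorem chain_sub_two (hq : 3 ≤ q) (hqe : Even q) (hx : lam q / 2 ≤ x) (hx' : lam q * x < 2) :
    chain (lam q) (chainParam (lam q) x) (q - 2) = lam q - x := by
  have ha := chainParam_nonneg hx hx'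
  have hqe' := hqe
  obtain ⟨p, hp⟩ := hqe'
  have hden := chain_even_den_pos ha (by omega : (p - 1) + 2 ≤ q)
  rw [show q - 2 = 2 * (p - 1) by omega, chain_even ha (by omega), div_eq_iff hden.ne']
  rw [show ((p - 1 : ℕ) : ℤ) = (q / 2 : ℕ) - 1 by omega, sub_add_cancel,
    show ((q / 2 : ℕ) : ℤ) - 1 - 1 = (q / 2 : ℕ) - 2 by ring,
    B_half_sub_one (by omega) hqe, B_half_sub_two (by omega) hqe, chainParam]
  have : 2 - lam q * x ≠ 0 := by linarith
  field_simp
  ring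

theorem chain_sub_three (hq : 4 ≤ q) (hqe : Even q) (hx : lam q / 2 ≤ x) (hx' : lam q * x < 2) :
    chain (lam q) (chainParam (lam q) x) (q - 3) = lam q - 1 / x := by
  have ha := chainParam_nonneg hx hx'
  have hqe' := hqe
  obtain ⟨p, hp⟩ := hqe'
  have hden := chain_odd_den_pos ha (by omega : (p - 2) + 3 ≤ q)
  rw [show q - 3 = 2 * (p - 2) + 1 by omega, chain_odd ha (by omega), div_eq_iff hden.ne']
  rw [show ((p - 2 : ℕ) : ℤ) = (q / 2 : ℕ) - 2 by omega, sub_add_cancel,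
    show ((q / 2 : ℕ) : ℤ) - 2 + 1 = (q / 2 : ℕ) - 1 by ring,
    B_half_sub_one (by omega) hqe, B_half_sub_two (by omega) hqe, chainParam]
  have : 2 - lam q * x ≠ 0 := by linarith
  have : x ≠ 0 := by linarith [lam_pos (by omega : 3 ≤ q)]
  field_simp
  ring

end Chain

section Height

variable {q : ℕ}

theorem height_even {k : ℕ} (hk : k + 2 ≤ q) : height (lam q) (2 * k) = Heven q k := by
  induction k with
  | zero => simp [height, Heven, B_zero]
  | succ k ih =>
    have hrec := lam_mul_B q (k + 1)
    rw [add_sub_cancel_right, add_comm (B q _)] at hrec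
    rw [show 2 * (k + 1) = 2 * k + 2 by ring, height, ih (by omega), Heven, Heven]
    exact_mod_cast one_div_sub_div_of_mul_eq_add (B_pos (by omega) (by omega)).ne' hrec

theorem Hodd_one (hq : 4 ≤ q) (hqe : Even q) : Hodd q 1 = 1 / (lam q + 1) := by
  have hB := B_pos (q := q) (k := (q / 2 : ℕ)) (by omega) (by omega)
  have hl := one_lt_lam hq
  have hl2 : lam q - 2 ≠ 0 := (sub_neg.2 (lam_lt_two (by omega))).ne
  rw [Hodd, add_sub_cancel_right, show ((q / 2 : ℕ) : ℤ) - 1 - 1 = (q / 2 : ℕ) - 2 by ring,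
    B_half_sub_two (by omega) hqe, B_half_sub_one (by omega) hqe]
  have hden : (lam q ^ 2 / 2 - 1) * B q (q / 2 : ℕ) - lam q / 2 * B q (q / 2 : ℕ) =
      (lam q - 2) * (lam q + 1) * B q (q / 2 : ℕ) / 2 := by ring
  rw [hden]
  field_simp

theorem Hodd_add_one {n : ℕ} (hn : n + 1 ≤ q / 2) :
    Hodd q (n + 1) = 1 / (lam q - Hodd q n) := by
  rw [Hodd, Hodd]
  set p := ((q / 2 : ℕ) : ℤ) with _hp
  rw [show p - 1 - (n + 1) = p - n - 2 by ring, show p - (n + 1) = p - n - 1 by ring,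
    show p + 1 - (n + 1) = p - n by ring, show p + 1 - n = p - n + 1 by ring,
    show p - 1 - n = p - n - 1 by ring]
  have hlt := B_lt_B (q := q) (a := p - n - 1) (b := p - n) (by omega) (by omega) (by omega)
    (by omega)
  have h₀ := lam_mul_B q (p - n)
  have h₁ := lam_mul_B q (p - n - 1)
  rw [sub_add_cancel, show p - n - 1 - 1 = p - n - 2 by ring] at h₁
  exact (one_div_sub_div_of_mul_eq_add (sub_neg.2 hlt).ne (by linear_combination h₁ - h₀)).symm

theorem height_odd (hq : 4 ≤ q) (hqe : Even q) {k : ℕ} (hk : k + 1 ≤ q / 2) :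
    height (lam q) (2 * k + 1) = Hodd q (k + 1) := by
  induction k with
  | zero => simpa [height] using (Hodd_one hq hqe).symm
  | succ k ih =>
    rw [show 2 * (k + 1) + 1 = 2 * k + 1 + 2 by ring, height, ih (by omega)]
    exact_mod_cast (Hodd_add_one hk).symm

theorem height_le_one (hq : 4 ≤ q) (hqe : Even q) {j : ℕ} (hj : j + 1 ≤ q) :
    height (lam q) j ≤ 1 := by
  have hqe' := hqe
  obtain ⟨p, hp⟩ := hqe'
  obtain ⟨k, rfl | rfl⟩ := Nat.even_or_odd' j
  · rw [height_even (by omega), Heven, div_le_one (B_pos (by omega) (by omega))]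
    exact (B_lt_B (by omega) (by omega) (by omega) (by omega)).le
  · rw [height_odd hq hqe (by omega), Hodd]
    set m : ℤ := (q / 2 : ℕ) - (k + 1) with _hm
    rw [show ((q / 2 : ℕ) : ℤ) + 1 - (k + 1) = m + 1 by omega,
      show ((q / 2 : ℕ) : ℤ) - 1 - (k + 1) = m - 1 by omega]
    have hlt := B_lt_B (q := q) (a := m - 1) (b := m) (by omega) (by omega) (by omega) (by omega)
    have hnonneg := B_nonneg (q := q) (k := m) (by omega) (by omega)
    rw [div_le_one_of_neg (by linarith)]
    nlinarith [lam_lt_two (by omega : q ≠ 0), lam_mul_B q m]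

theorem height_lt_lam (hq : 4 ≤ q) (hqe : Even q) {j : ℕ} (hj : j + 1 ≤ q) :
    height (lam q) j < lam q :=
  (height_le_one hq hqe hj).trans_lt (one_lt_lam hq)

theorem height_le_succ (hq : 4 ≤ q) (hqe : Even q) {j : ℕ} (hj : j + 2 ≤ q) :
    height (lam q) j ≤ height (lam q) (j + 1) := by
  have hl := one_lt_lam hq
  induction j using Nat.twoStepInduction with
  | zero => simp only [height]; positivity
  | one =>
    simp only [height, sub_zero]
    exact one_div_le_one_div_of_le (by linarith) (by linarith)
  | more j ih _ =>
    have hlt := height_lt_lam hq hqe (by omega : (j + 1) + 1 ≤ q)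
    have hle := ih (by omega)
    simp only [height] at *
    exact one_div_le_one_div_of_le (by linarith) (by linarith)

theorem height_sub_one (hq : 4 ≤ q) (hqe : Even q) : height (lam q) (q - 1) = 1 := by
  have hqe' := hqe
  obtain ⟨p, hp⟩ := hqe'
  rw [show q - 1 = 2 * (p - 1) + 1 by omega, height_odd hq hqe (by omega), Hodd,
    show ((p - 1 : ℕ) : ℤ) + 1 = ((q / 2 : ℕ) : ℤ) by omega]
  simp [B_zero, B_one (by omega : 2 ≤ q), B_neg_one (by omega : 2 ≤ q)]

theorem height_sub_two (hq : 2 ≤ q) (hqe : Even q) : height (lam q) (q - 2) = lam q / 2 := by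
  have hqe' := hqe
  obtain ⟨p, hp⟩ := hqe'
  have hB := B_pos (q := q) (k := (q / 2 : ℕ)) (by omega) (by omega)
  rw [show q - 2 = 2 * (p - 1) by omega, height_even (by omega), Heven,
    show ((p - 1 : ℕ) : ℤ) = ((q / 2 : ℕ) : ℤ) - 1 by omega, B_half_sub_one hq hqe, sub_add_cancel,
    mul_div_cancel_right₀ _ hB.ne']

theorem height_sub_three (hq : 4 ≤ q) (hqe : Even q) : height (lam q) (q - 3) = lam q - 1 := by
  have h := height_sub_one hq hqe
  obtain ⟨j, rfl⟩ := Nat.exists_eq_add_of_le' hq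
  rw [show j + 4 - 1 = (j + 1) + 2 by omega, height, div_eq_one_iff_eq] at h
  · rw [show j + 4 - 3 = j + 1 by omega]
    linarith
  · exact (sub_pos.2 (height_lt_lam hq hqe (by omega))).ne'

theorem height_sub_four (hq : 4 ≤ q) (hqe : Even q) :
    height (lam q) (q - 4) = lam q - 2 / lam q := by
  have h := height_sub_two (by omega) hqe
  have hl := lam_pos (by omega : 3 ≤ q)
  obtain ⟨j, rfl⟩ := Nat.exists_eq_add_of_le' hq
  rw [show j + 4 - 2 = j + 2 by omega, height, div_eq_iff
    (sub_pos.2 (height_lt_lam hq hqe (by omega))).ne'] at h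
  rw [show j + 4 - 4 = j by omega]
  field_simp
  linarith

end Height

/-! ### The natural extension -/

/-- The standing assumptions `q ≥ 4` even and `1/2 ≤ α ≤ 1/λ` on the parameters. -/
structure Admissible (q : ℕ) (α : ℝ) : Prop where
  four_le : 4 ≤ q
  even : Even q
  half_le : 1 / 2 ≤ α
  le_inv : α ≤ 1 / lam q

/-- The left endpoints of the steps of the planar domain, in increasing order. -/
noncomputable def threshold (q : ℕ) (α : ℝ) (j : ℕ) : ℝ :=
  -chain (lam q) (chainParam (lam q) (lam q * α)) (q - 2 - j)

/-- The planar domain as the region under a staircase: to the left of the threshold `j` the height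
is at most `height (lam q) j`. Steps of width zero, which occur for `α = 1/2` and `α = 1/λ`, need
no special treatment in this form. -/
def stair (q : ℕ) (α : ℝ) : Set (ℝ × ℝ) :=
  {z | z.1 ∈ Set.Ico (lam q * (α - 1)) (lam q * α) ∧ 0 ≤ z.2 ∧ z.2 ≤ 1 ∧
    ∀ j, j + 2 ≤ q → z.1 < threshold q α j → z.2 ≤ height (lam q) j}

/-- The planar natural extension `(t, v) ↦ (T t, 1 / (d(t) λ + sgn(t) v))` of the map `T`. -/
noncomputable def natExt (q : ℕ) (α : ℝ) (z : ℝ × ℝ) : ℝ × ℝ :=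
  (T q α z.1, 1 / (digit q α z.1 * lam q + Real.sign z.1 * z.2))

section Map

variable {q : ℕ} {α : ℝ}

theorem digit_eq_floor (hl : 0 < lam q) (t : ℝ) :
    digit q α t = ⌊1 / |t| / lam q + 1 - α⌋ := by
  rw [digit, abs_div, abs_mul, abs_one, abs_of_pos hl, div_div]

theorem digit_eq_of_add (hl : 0 < lam q) {t s : ℝ} {d : ℤ} (h : 1 / |t| = lam q * d + s)
    (hs : s ∈ Set.Ico (lam q * (α - 1)) (lam q * α)) : digit q α t = d := by
  have hlower : α - 1 ≤ s / lam q := by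
    rw [le_div_iff₀ hl]
    linarith [hs.1]
  have hupper : s / lam q < α := by
    rw [div_lt_iff₀ hl]
    linarith [hs.2]
  rw [digit_eq_floor hl, h, Int.floor_eq_iff, add_div, mul_div_cancel_left₀ _ hl.ne']
  constructor <;> linarith

theorem one_div_abs_eq {t : ℝ} (ht : t ≠ 0) : 1 / |t| = lam q * digit q α t + T q α t := by
  rw [T, if_neg ht, abs_div, abs_one, add_sub_cancel]

theorem T_mem (hl : 0 < lam q) {t : ℝ} (ht : t ≠ 0) :
    T q α t ∈ Set.Ico (lam q * (α - 1)) (lam q * α) := by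
  have hfloor := Int.floor_eq_iff.1 (digit_eq_floor (α := α) hl t).symm
  have hw : 1 / |t| / lam q * lam q = lam q * digit q α t + T q α t := by
    rw [div_mul_cancel₀ _ hl.ne', one_div_abs_eq ht]
  constructor <;> nlinarith

theorem T_eq_of_add (hl : 0 < lam q) {t s : ℝ} {d : ℤ} (ht : t ≠ 0) (h : 1 / |t| = lam q * d + s)
    (hs : s ∈ Set.Ico (lam q * (α - 1)) (lam q * α)) : T q α t = s := by
  have h' := one_div_abs_eq (q := q) (α := α) ht
  rw [digit_eq_of_add hl h hs] at h'
  linarith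

theorem threshold_add_two {j : ℕ} (hj : j + 4 ≤ q) :
    threshold q α (j + 2) = -1 / threshold q α j - lam q := by
  rw [threshold, threshold, show q - 2 - j = (q - 4 - j) + 2 by omega, chain,
    show q - 2 - (j + 2) = q - 4 - j by omega, neg_div_neg_eq, one_div_one_div]
  ring

theorem threshold_sub_two (q : ℕ) (α : ℝ) :
    threshold q α (q - 2) = chainParam (lam q) (lam q * α) := by
  simp [threshold, chain]

theorem threshold_sub_three (hq : 3 ≤ q) (α : ℝ) :
    threshold q α (q - 3) =
      -(threshold q α (q - 2) / (1 + lam q * threshold q α (q - 2))) := by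
  rw [threshold_sub_two, threshold, show q - 2 - (q - 3) = 1 by omega, chain]

end Map

namespace Admissible

variable {q : ℕ} {α : ℝ}

theorem lam_pos (h : Admissible q α) : 0 < lam q :=
  AlphaRosen.lam_pos (by have := h.four_le; omega)

theorem one_lt_lam (h : Admissible q α) : 1 < lam q := AlphaRosen.one_lt_lam h.four_le

theorem lam_lt_two (h : Admissible q α) : lam q < 2 :=
  AlphaRosen.lam_lt_two (by have := h.four_le; omega)

theorem half_lam_le (h : Admissible q α) : lam q / 2 ≤ lam q * α := by
  nlinarith [h.lam_pos, h.half_le]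

theorem right_le_one (h : Admissible q α) : lam q * α ≤ 1 := by
  rw [mul_comm, ← le_div_iff₀ h.lam_pos]
  exact h.le_inv

theorem lam_mul_right_lt_two (h : Admissible q α) : lam q * (lam q * α) < 2 := by
  nlinarith [h.lam_pos, h.right_le_one, h.lam_lt_two]

theorem right_pos (h : Admissible q α) : 0 < lam q * α := by
  linarith [h.half_lam_le, h.lam_pos]

theorem chainParam_nonneg (h : Admissible q α) : 0 ≤ chainParam (lam q) (lam q * α) :=
  AlphaRosen.chainParam_nonneg h.half_lam_le h.lam_mul_right_lt_two

theorem chainParam_le (h : Admissible q α) : chainParam (lam q) (lam q * α) ≤ lam q * α :=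
  chainParam_le_self h.lam_pos.le h.right_pos.le h.right_le_one h.lam_mul_right_lt_two

theorem threshold_zero (h : Admissible q α) : threshold q α 0 = lam q * (α - 1) := by
  have hq := h.four_le
  rw [threshold, Nat.sub_zero,
    chain_sub_two (by omega) h.even h.half_lam_le h.lam_mul_right_lt_two]
  ring

theorem threshold_one (h : Admissible q α) : threshold q α 1 = 1 / (lam q * α) - lam q := by
  rw [threshold, show q - 2 - 1 = q - 3 by omega,
    chain_sub_three h.four_le h.even h.half_lam_le h.lam_mul_right_lt_two]
  ring

theorem threshold_neg (h : Admissible q α) {j : ℕ} (hj : j + 4 ≤ q) : threshold q α j < 0 := by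
  rw [threshold, show q - 2 - j = (q - 4 - j) + 2 by omega, neg_lt_zero]
  exact chain_add_two_pos h.chainParam_nonneg (by omega)

theorem threshold_le_succ (h : Admissible q α) {j : ℕ} (hj : j + 3 ≤ q) :
    threshold q α j ≤ threshold q α (j + 1) := by
  rw [threshold, threshold, show q - 2 - j = (q - 3 - j) + 1 by omega,
    show q - 2 - (j + 1) = q - 3 - j by omega, neg_le_neg_iff]
  exact chain_le_succ h.chainParam_nonneg (h.chainParam_le.trans h.right_le_one) h.four_le
    (by omega)

theorem threshold_mono (h : Admissible q α) {i j : ℕ} (hij : i ≤ j) (hj : j + 2 ≤ q) :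
    threshold q α i ≤ threshold q α j := by
  induction j, hij using Nat.le_induction with
  | base => exact le_rfl
  | succ j _ ih => exact (ih (by omega)).trans (h.threshold_le_succ (by omega))

theorem height_mono (h : Admissible q α) {i j : ℕ} (hij : i ≤ j) (hj : j + 1 ≤ q) :
    height (lam q) i ≤ height (lam q) j := by
  induction j, hij using Nat.le_induction with
  | base => exact le_rfl
  | succ j _ ih => exact (ih (by omega)).trans (height_le_succ h.four_le h.even (by omega))

theorem threshold_sub_two_nonneg (h : Admissible q α) : 0 ≤ threshold q α (q - 2) := by
  rw [threshold_sub_two]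
  exact h.chainParam_nonneg

theorem threshold_sub_two_le (h : Admissible q α) : threshold q α (q - 2) ≤ lam q * α := by
  rw [threshold_sub_two]
  exact h.chainParam_le

theorem threshold_sub_three_nonpos (h : Admissible q α) : threshold q α (q - 3) ≤ 0 := by
  have hq := h.four_le
  have hthreshold := h.threshold_sub_two_nonneg
  have hl := h.lam_pos
  rw [threshold_sub_three (by omega), neg_nonpos]
  positivity

theorem threshold_sub_two_pos (h : Admissible q α) (hneg : threshold q α (q - 3) < 0) :
    0 < threshold q α (q - 2) := by
  have hq := h.four_le
  refine h.threshold_sub_two_nonneg.lt_of_ne fun hzero => ?_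
  simp [threshold_sub_three (by omega : 3 ≤ q), ← hzero] at hneg

theorem one_div_neg_threshold_sub_three (h : Admissible q α) (hneg : threshold q α (q - 3) < 0) :
    1 / -threshold q α (q - 3) = lam q + 1 / threshold q α (q - 2) := by
  have hq := h.four_le
  have hpos := h.threshold_sub_two_pos hneg
  rw [threshold_sub_three (by omega), neg_neg, one_div_div]
  field_simp
  ring

theorem abs_le_right (h : Admissible q α) {t : ℝ}
    (ht : t ∈ Set.Icc (lam q * (α - 1)) (lam q * α)) : |t| ≤ lam q * α :=
  abs_le.2 ⟨by linarith [ht.1, h.half_lam_le], ht.2⟩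

theorem one_le_digit (h : Admissible q α) {t : ℝ} (ht0 : t ≠ 0)
    (ht : t ∈ Set.Icc (lam q * (α - 1)) (lam q * α)) : 1 ≤ digit q α t := by
  have hrec := one_div_abs_eq (q := q) (α := α) ht0
  have hT := (T_mem (α := α) h.lam_pos ht0).2
  have hone : 1 ≤ 1 / |t| :=
    (one_le_div (abs_pos.2 ht0)).2 ((h.abs_le_right ht).trans h.right_le_one)
  have hpos : (0 : ℝ) < digit q α t := by
    refine pos_of_mul_pos_right (a := lam q) ?_ h.lam_pos.le
    linarith [h.right_le_one]
  exact_mod_cast hpos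

theorem one_le_cast_digit (h : Admissible q α) {t : ℝ} (ht0 : t ≠ 0)
    (ht : t ∈ Set.Icc (lam q * (α - 1)) (lam q * α)) : (1 : ℝ) ≤ digit q α t := by
  exact_mod_cast h.one_le_digit ht0 ht

end Admissible

section NatExt

variable {q : ℕ} {α : ℝ}

namespace Admissible

theorem one_div_mem_stair (h : Admissible q α) {s D : ℝ} {k : ℕ} (hk : k + 2 ≤ q)
    (hs : s ∈ Set.Ico (lam q * (α - 1)) (lam q * α)) (hks : threshold q α k ≤ s) (hD : 1 ≤ D)
    (hheight : 1 / D ≤ height (lam q) (k + 1)) : (s, 1 / D) ∈ stair q α := by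
  refine ⟨hs, by positivity, (div_le_one (by positivity)).2 hD, fun j hj hlt => ?_⟩
  have hkj : k < j := by
    by_contra! hjk
    exact absurd hlt (not_lt.2 ((h.threshold_mono hjk hk).trans hks))
  exact hheight.trans (h.height_mono hkj (by omega))

theorem one_div_mem_stair_of_lam_add_one_le (h : Admissible q α) {s D : ℝ}
    (hs : s ∈ Set.Ico (lam q * (α - 1)) (lam q * α)) (hD : lam q + 1 ≤ D) :
    (s, 1 / D) ∈ stair q α := by
  have hl := h.lam_pos
  have hq := h.four_le
  refine h.one_div_mem_stair (k := 0) (by omega) hs (h.threshold_zero.trans_le hs.1)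
    (by linarith) ?_
  exact one_div_le_one_div_of_le (by positivity) hD

theorem one_div_mem_stair_of_lam_le (h : Admissible q α) {s D : ℝ}
    (hs : s ∈ Set.Ico (lam q * (α - 1)) (lam q * α)) (hks : threshold q α 1 ≤ s) (hD : lam q ≤ D) :
    (s, 1 / D) ∈ stair q α := by
  have hq := h.four_le
  refine h.one_div_mem_stair (by omega) hs hks (h.one_lt_lam.le.trans hD) ?_
  rw [height, height, sub_zero]
  exact one_div_le_one_div_of_le h.lam_pos hD

theorem snd_le_half_lam (h : Admissible q α) {z : ℝ × ℝ} (hz : z ∈ stair q α) (hneg : z.1 < 0) :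
    z.2 ≤ lam q / 2 := by
  have hq := h.four_le
  rw [← height_sub_two (by omega) h.even]
  exact hz.2.2.2 (q - 2) (by omega) (hneg.trans_le h.threshold_sub_two_nonneg)

theorem snd_le_lam_sub_one (h : Admissible q α) {z : ℝ × ℝ} (hz : z ∈ stair q α)
    (hlt : z.1 < threshold q α (q - 3)) : z.2 ≤ lam q - 1 := by
  have hq := h.four_le
  rw [← height_sub_three hq h.even]
  exact hz.2.2.2 (q - 3) (by omega) hlt

theorem lam_add_one_div_le_one_div_neg (h : Admissible q α) {t : ℝ} (hneg : t < 0)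
    (ht : threshold q α (q - 3) ≤ t) : lam q + 1 / (lam q * α) ≤ 1 / -t := by
  have hthreshold := ht.trans_lt hneg
  calc lam q + 1 / (lam q * α) ≤ lam q + 1 / threshold q α (q - 2) := by
        gcongr
        · exact h.threshold_sub_two_pos hthreshold
        · exact h.threshold_sub_two_le
    _ = 1 / -threshold q α (q - 3) := (h.one_div_neg_threshold_sub_three hthreshold).symm
    _ ≤ 1 / -t := one_div_le_one_div_of_le (neg_pos.2 hneg) (neg_le_neg ht)

theorem lt_threshold_of_digit_eq_one (h : Admissible q α) {t : ℝ} (hneg : t < 0)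
    (hd : digit q α t = 1) : t < threshold q α (q - 3) := by
  by_contra! hle
  have hT := (T_mem (α := α) h.lam_pos hneg.ne).2
  have hrec := one_div_abs_eq (q := q) (α := α) hneg.ne
  rw [hd, abs_of_neg hneg, Int.cast_one, mul_one] at hrec
  have hone := (one_le_div h.right_pos).2 h.right_le_one
  linarith [h.lam_add_one_div_le_one_div_neg hneg hle, h.right_le_one]

theorem lt_threshold_of_lt_threshold_add_two (h : Admissible q α) {t : ℝ} (hneg : t < 0) {j : ℕ}
    (hj : j + 4 ≤ q) (hlt : 1 / -t - lam q < threshold q α (j + 2)) : t < threshold q α j := by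
  have hthreshold := h.threshold_neg hj
  rw [threshold_add_two hj, neg_div, ← div_neg, sub_lt_sub_iff_right,
    one_div_lt_one_div (neg_pos.2 hneg) (neg_pos.2 hthreshold)] at hlt
  exact neg_lt_neg_iff.1 hlt

theorem natExt_mem_of_neg_of_digit_eq_one (h : Admissible q α) {z : ℝ × ℝ} (hz : z ∈ stair q α)
    (hneg : z.1 < 0) (hd : digit q α z.1 = 1) : natExt q α z ∈ stair q α := by
  have hq := h.four_le
  have hT : T q α z.1 = 1 / -z.1 - lam q := by
    rw [eq_sub_iff_add_eq', ← abs_of_neg hneg, one_div_abs_eq hneg.ne, hd, Int.cast_one, mul_one]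
  have hv := h.snd_le_lam_sub_one hz (h.lt_threshold_of_digit_eq_one hneg hd)
  have hden : 1 ≤ lam q - z.2 := by linarith
  rw [natExt, hd, Real.sign_of_neg hneg, Int.cast_one, one_mul, neg_one_mul, ← sub_eq_add_neg]
  refine ⟨T_mem h.lam_pos hneg.ne, by positivity, (div_le_one (by positivity)).2 hden,
    fun j hj hlt => ?_⟩
  rw [hT] at hlt
  have hj2 : 2 ≤ j := by
    by_contra! hj2
    have hz0 := h.lt_threshold_of_lt_threshold_add_two (j := 0) hneg (by omega)
      (hlt.trans_le (h.threshold_mono (by omega) (by omega)))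
    rw [h.threshold_zero] at hz0
    exact absurd hz0 (not_lt.2 hz.1.1)
  obtain ⟨i, rfl⟩ := Nat.exists_eq_add_of_le' hj2
  have hv' := hz.2.2.2 i (by omega) (h.lt_threshold_of_lt_threshold_add_two hneg (by omega) hlt)
  have hheight := height_lt_lam hq h.even (by omega : i + 1 ≤ q)
  exact one_div_le_one_div_of_le (sub_pos.2 hheight) (by linarith)

theorem natExt_mem_of_neg (h : Admissible q α) {z : ℝ × ℝ} (hz : z ∈ stair q α)
    (hneg : z.1 < 0) : natExt q α z ∈ stair q α := by
  have hl := h.one_lt_lam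
  have hl2 := h.lam_lt_two
  have hT := T_mem (α := α) h.lam_pos hneg.ne
  have hv := h.snd_le_half_lam hz hneg
  rcases (h.one_le_digit hneg.ne (Set.Ico_subset_Icc_self hz.1)).eq_or_lt' with hd | hd
  · exact h.natExt_mem_of_neg_of_digit_eq_one hz hneg hd
  have hd2 : (2 : ℝ) ≤ digit q α z.1 := by exact_mod_cast hd
  rw [natExt, Real.sign_of_neg hneg]
  rcases lt_or_ge z.1 (threshold q α (q - 3)) with hlt | hge
  · have hv' := h.snd_le_lam_sub_one hz hlt
    exact h.one_div_mem_stair_of_lam_add_one_le hT (by nlinarith)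
  rcases (show 2 ≤ digit q α z.1 by omega).eq_or_lt' with hd | hd
  · have hrec := one_div_abs_eq (q := q) (α := α) hneg.ne
    have hle := h.lam_add_one_div_le_one_div_neg hneg hge
    rw [hd, abs_of_neg hneg, Int.cast_ofNat] at hrec
    refine h.one_div_mem_stair_of_lam_le hT ?_ (by nlinarith)
    rw [h.threshold_one]
    linarith
  · have hd3 : (3 : ℝ) ≤ digit q α z.1 := by exact_mod_cast hd
    exact h.one_div_mem_stair_of_lam_add_one_le hT (by nlinarith)

theorem natExt_mem_of_pos (h : Admissible q α) {z : ℝ × ℝ} (hz : z ∈ stair q α)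
    (hpos : 0 < z.1) : natExt q α z ∈ stair q α := by
  have hl := h.one_lt_lam
  have hT := T_mem (α := α) h.lam_pos hpos.ne'
  have hv := hz.2.1
  rw [natExt, Real.sign_of_pos hpos]
  rcases (h.one_le_digit hpos.ne' (Set.Ico_subset_Icc_self hz.1)).eq_or_lt' with hd | hd
  · have hrec := one_div_abs_eq (q := q) (α := α) hpos.ne'
    have hle := one_div_le_one_div_of_le hpos hz.1.2.le
    rw [hd, abs_of_pos hpos, Int.cast_one] at hrec
    refine h.one_div_mem_stair_of_lam_le hT ?_ (by rw [hd]; push_cast; linarith)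
    rw [h.threshold_one]
    linarith
  · have hd2 : (2 : ℝ) ≤ digit q α z.1 := by exact_mod_cast hd
    exact h.one_div_mem_stair_of_lam_add_one_le hT (by nlinarith)

theorem natExt_mem (h : Admissible q α) {z : ℝ × ℝ} (hz : z ∈ stair q α) (hz0 : z.1 ≠ 0) :
    natExt q α z ∈ stair q α :=
  hz0.lt_or_gt.elim (h.natExt_mem_of_neg hz) (h.natExt_mem_of_pos hz)

theorem one_le_natExt_den (h : Admissible q α) {z : ℝ × ℝ} (hz : z ∈ stair q α) (hz0 : z.1 ≠ 0) :
    1 ≤ digit q α z.1 * lam q + Real.sign z.1 * z.2 := by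
  have hle := (h.natExt_mem hz hz0).2.2.1
  have hd := h.one_le_cast_digit hz0 (Set.Ico_subset_Icc_self hz.1)
  have hl := h.one_lt_lam
  have hsign : -1 ≤ Real.sign z.1 * z.2 := by
    rcases Real.sign_apply_eq z.1 with hs | hs | hs <;> rw [hs] <;> linarith [hz.2.1, hz.2.2.1]
  exact (div_le_one (by nlinarith)).1 hle

end Admissible

end NatExt

/-- The contraction rate of two steps of the natural extension in the vertical direction, see
`Admissible.mul_natExt_snd_le`. -/
noncomputable def rate (q : ℕ) : ℝ := max (lam q / 2) (1 / lam q)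

section Rate

variable {q : ℕ} {α : ℝ}

theorem rate_lt_one (hq : 4 ≤ q) : rate q < 1 := by
  have hl := one_lt_lam hq
  exact max_lt (by linarith [lam_lt_two (by omega : q ≠ 0)])
    ((div_lt_one (by linarith)).2 hl)

theorem rate_pos (hq : 3 ≤ q) : 0 < rate q :=
  lt_max_of_lt_left (half_pos (lam_pos hq))

theorem Admissible.mul_natExt_snd_le (h : Admissible q α) {z : ℝ × ℝ} (hz : z ∈ stair q α)
    (hz0 : z.1 ≠ 0) : z.2 * (natExt q α z).2 ≤ rate q := by
  obtain ⟨-, hw0, hw1, -⟩ := h.natExt_mem hz hz0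
  rcases hz0.lt_or_gt with hneg | hpos
  · exact (mul_le_of_le_one_right hz.2.1 hw1).trans
      ((h.snd_le_half_lam hz hneg).trans (le_max_left _ _))
  · have hd := h.one_le_cast_digit hz0 (Set.Ico_subset_Icc_self hz.1)
    have hw : (natExt q α z).2 ≤ 1 / lam q := by
      rw [natExt, Real.sign_of_pos hpos, one_mul]
      refine one_div_le_one_div_of_le h.lam_pos ?_
      nlinarith [h.lam_pos, hz.2.1]
    exact (mul_le_of_le_one_left hw0 hz.2.2.1).trans (hw.trans (le_max_right _ _))

end Rate

/-! ### The invariant measure of the natural extension -/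

/-- The points at which the map is locally a Möbius transformation and that are not thresholds. -/
def regularPoints (q : ℕ) (α : ℝ) : Set ℝ :=
  {t | t ≠ 0 ∧ (∀ n : ℤ, |1 / (t * lam q)| + 1 - α ≠ n) ∧ ∀ j, t ≠ threshold q α j}

/-- The planar domain without its horizontal boundary and without the fibres over irregular
points. On this set, which is conull in the domain, the natural extension is injective and
differentiable. -/
def openStair (q : ℕ) (α : ℝ) : Set (ℝ × ℝ) :=
  {z | z.1 ∈ Set.Ico (lam q * (α - 1)) (lam q * α) ∧ z.1 ∈ regularPoints q α ∧ 0 < z.2 ∧ z.2 < 1 ∧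
    ∀ j, j + 2 ≤ q → z.1 < threshold q α j → z.2 < height (lam q) j}

/-- The density `1 / (1 + t v)²`. -/
noncomputable def invDensity (z : ℝ × ℝ) : ENNReal := ENNReal.ofReal (1 / (1 + z.1 * z.2) ^ 2)

/-- The invariant measure of the natural extension, not normalized. -/
noncomputable def stairMeasure (q : ℕ) (α : ℝ) : Measure (ℝ × ℝ) :=
  (volume.restrict (stair q α)).withDensity invDensity

theorem sign_mul_abs (t : ℝ) : Real.sign t * |t| = t := by
  rcases lt_trichotomy t 0 with h | rfl | h
  · rw [Real.sign_of_neg h, abs_of_neg h, neg_mul_neg, one_mul]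
  · simp
  · rw [Real.sign_of_pos h, abs_of_pos h, one_mul]

theorem sign_mul_self {t : ℝ} (ht : t ≠ 0) : Real.sign t * Real.sign t = 1 := by
  rcases Real.sign_apply_eq_of_ne_zero t ht with h | h <;> rw [h] <;> norm_num

theorem abs_sign {t : ℝ} (ht : t ≠ 0) : |Real.sign t| = 1 := by
  rcases Real.sign_apply_eq_of_ne_zero t ht with h | h <;> rw [h] <;> norm_num

section Measurability

variable {q : ℕ} {α : ℝ}

theorem measurable_digit : Measurable (digit q α) :=
  Int.measurable_floor.comp
    ((((measurable_id.mul_const _).const_div 1).abs.add_const 1).sub_const α)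

theorem measurable_T : Measurable (T q α) :=
  Measurable.ite (measurableSet_singleton 0) measurable_const
    ((measurable_id.const_div 1).abs.sub
      (measurable_const.mul (measurable_from_top.comp measurable_digit)))

theorem measurable_sign : Measurable Real.sign :=
  Measurable.ite measurableSet_Iio measurable_const
    (Measurable.ite measurableSet_Ioi measurable_const measurable_const)

theorem measurable_natExt : Measurable (natExt q α) := by
  have hdigit : Measurable fun z : ℝ × ℝ => (digit q α z.1 : ℝ) :=
    measurable_from_top.comp (measurable_digit.comp measurable_fst)
  exact (measurable_T.comp measurable_fst).prodMk
    (((hdigit.mul_const _).add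
      ((measurable_sign.comp measurable_fst).mul measurable_snd)).const_div 1)

theorem measurable_invDensity : Measurable invDensity := by
  unfold invDensity
  fun_prop

theorem measurableSet_stair : MeasurableSet (stair q α) := by
  refine (measurable_fst measurableSet_Ico).inter
    ((measurableSet_le measurable_const measurable_snd).inter
      ((measurableSet_le measurable_snd measurable_const).inter
        (measurableSet_setOfPred.2 (Measurable.forall fun j => ?_))))
  exact measurableSet_setOfPred.1 ((MeasurableSet.const _).imp
    ((measurableSet_lt measurable_fst measurable_const).imp
      (measurableSet_le measurable_snd measurable_const)))

theorem countable_compl_regularPoints (hl : lam q ≠ 0) : (regularPoints q α)ᶜ.Countable := by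
  have hsub : (regularPoints q α)ᶜ ⊆ {0} ∪ (⋃ n : ℤ, {1 / ((n : ℝ) - (1 - α)) / lam q,
      1 / -((n : ℝ) - (1 - α)) / lam q}) ∪ Set.range (threshold q α) := by
    intro t ht
    simp only [regularPoints, Set.mem_compl_iff, Set.mem_ofPred_eq, not_and_or, not_not,
      not_forall] at ht
    rcases ht with ht | ⟨n, hn⟩ | ⟨j, hj⟩
    · exact Or.inl (Or.inl ht)
    · refine Or.inl (Or.inr (Set.mem_iUnion.2 ⟨n, ?_⟩))
      have ht : t = 1 / (1 / (t * lam q)) / lam q := by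
        rw [one_div_one_div, mul_div_cancel_right₀ _ hl]
      rw [add_sub_assoc, ← eq_sub_iff_add_eq] at hn
      rcases eq_or_eq_neg_of_abs_eq hn with h | h <;> rw [h] at ht
      · exact Or.inl ht
      · exact Or.inr ht
    · exact Or.inr ⟨j, hj.symm⟩
  exact (((Set.countable_singleton _).union (Set.countable_iUnion fun n =>
    (Set.toFinite _).countable)).union (Set.countable_range _)).mono hsub

theorem measurableSet_openStair (hl : lam q ≠ 0) : MeasurableSet (openStair q α) := by
  have hregular : MeasurableSet (regularPoints q α) :=
    (countable_compl_regularPoints hl).measurableSet.of_compl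
  refine (measurable_fst measurableSet_Ico).inter ((measurable_fst hregular).inter
    ((measurableSet_lt measurable_const measurable_snd).inter
      ((measurableSet_lt measurable_snd measurable_const).inter
        (measurableSet_setOfPred.2 (Measurable.forall fun j => ?_)))))
  exact measurableSet_setOfPred.1 ((MeasurableSet.const _).imp
    ((measurableSet_lt measurable_fst measurable_const).imp
      (measurableSet_lt measurable_snd measurable_const)))

theorem openStair_subset : openStair q α ⊆ stair q α := fun _ hz =>
  ⟨hz.1, hz.2.2.1.le, hz.2.2.2.1.le, fun j hj h => (hz.2.2.2.2 j hj h).le⟩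

theorem volume_stair_diff_openStair (hl : lam q ≠ 0) :
    volume (stair q α \ openStair q α) = 0 := by
  have hsub : stair q α \ openStair q α ⊆ ((regularPoints q α)ᶜ ×ˢ Set.univ) ∪
      (Set.univ ×ˢ ({0, 1} ∪ Set.range (height (lam q)))) := by
    rintro ⟨t, v⟩ ⟨⟨ht, hv0, hv1, hheight⟩, hz⟩
    by_contra hcon
    simp only [Set.mem_union, Set.mem_prod, Set.mem_compl_iff, Set.mem_univ, and_true, true_and,
      Set.mem_insert_iff, Set.mem_singleton_iff, Set.mem_range, not_or, not_not, not_exists] at hcon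
    obtain ⟨hregular, ⟨hv0', hv1'⟩, hheight'⟩ := hcon
    exact hz ⟨ht, hregular, hv0.lt_of_ne' hv0', hv1.lt_of_ne hv1',
      fun j hj hlt => (hheight j hj hlt).lt_of_ne' (hheight' j)⟩
  refine measure_mono_null hsub (measure_union_null ?_ ?_)
  · rw [Measure.volume_eq_prod, Measure.prod_prod,
      (countable_compl_regularPoints hl).measure_zero, zero_mul]
  · rw [Measure.volume_eq_prod, Measure.prod_prod,
      ((Set.toFinite _).countable.union (Set.countable_range _)).measure_zero volume, mul_zero]

theorem stairMeasure_apply {E : Set (ℝ × ℝ)} (hE : MeasurableSet E) :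
    stairMeasure q α E = ∫⁻ z in E ∩ stair q α, invDensity z := by
  rw [stairMeasure, withDensity_apply _ hE, Measure.restrict_restrict hE]

theorem stairMeasure_absolutelyContinuous :
    stairMeasure q α ≪ volume.restrict (stair q α) :=
  withDensity_absolutelyContinuous _ _

theorem stairMeasure_compl_openStair (hl : lam q ≠ 0) :
    stairMeasure q α (openStair q α)ᶜ = 0 := by
  apply stairMeasure_absolutelyContinuous
  rw [Measure.restrict_apply (measurableSet_openStair hl).compl, Set.inter_comm, ← Set.sdiff_eq]
  exact volume_stair_diff_openStair hl

theorem volume_stair_lt_top : volume (stair q α) < ⊤ := by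
  refine (measure_mono (t := Set.Icc (lam q * (α - 1)) (lam q * α) ×ˢ Set.Icc 0 1)
    fun z hz => ⟨⟨hz.1.1, hz.1.2.le⟩, hz.2.1, hz.2.2.1⟩).trans_lt ?_
  rw [Measure.volume_eq_prod, Measure.prod_prod, Real.volume_Icc, Real.volume_Icc]
  exact ENNReal.mul_lt_top ENNReal.ofReal_lt_top ENNReal.ofReal_lt_top

end Measurability

namespace Admissible

variable {q : ℕ} {α : ℝ}

theorem le_one_add_mul (h : Admissible q α) {t v : ℝ} (ht : lam q * (α - 1) ≤ t) (hv0 : 0 ≤ v)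
    (hv1 : v ≤ 1) : 1 - lam q / 2 ≤ 1 + t * v := by
  nlinarith [h.half_lam_le, h.lam_pos]

theorem one_add_mul_pos (h : Admissible q α) {t v : ℝ} (ht : lam q * (α - 1) ≤ t) (hv0 : 0 ≤ v)
    (hv1 : v ≤ 1) : 0 < 1 + t * v := by
  linarith [h.le_one_add_mul ht hv0 hv1, h.lam_lt_two]

theorem invDensity_le (h : Admissible q α) {z : ℝ × ℝ} (hz : z ∈ stair q α) :
    invDensity z ≤ ENNReal.ofReal (1 / (1 - lam q / 2) ^ 2) := by
  have hle := h.le_one_add_mul hz.1.1 hz.2.1 hz.2.2.1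
  have hpos : 0 < 1 - lam q / 2 := by linarith [h.lam_lt_two]
  unfold invDensity
  gcongr

theorem stairMeasure_univ_lt_top (h : Admissible q α) : stairMeasure q α Set.univ < ⊤ := by
  rw [stairMeasure_apply MeasurableSet.univ, Set.univ_inter]
  refine (setLIntegral_mono measurable_const fun z hz => h.invDensity_le hz).trans_lt ?_
  rw [setLIntegral_const]
  exact ENNReal.mul_lt_top ENNReal.ofReal_lt_top volume_stair_lt_top

theorem isFiniteMeasure_stairMeasure (h : Admissible q α) : IsFiniteMeasure (stairMeasure q α) :=
  ⟨h.stairMeasure_univ_lt_top⟩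

end Admissible

section Injectivity

variable {q : ℕ} {α : ℝ} {x y : ℝ × ℝ}

theorem digit_sub_mul_lam (hxy : natExt q α x = natExt q α y) :
    ((digit q α x.1 - digit q α y.1 : ℤ) : ℝ) * lam q =
      Real.sign y.1 * y.2 - Real.sign x.1 * x.2 := by
  have hden := congrArg Prod.snd hxy
  simp only [natExt, one_div, inv_inj] at hden
  push_cast
  linarith

theorem one_div_abs_sub (hx : x.1 ≠ 0) (hy : y.1 ≠ 0) (hxy : natExt q α x = natExt q α y) :
    1 / |x.1| - 1 / |y.1| = ((digit q α x.1 - digit q α y.1 : ℤ) : ℝ) * lam q := by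
  have hT : T q α x.1 = T q α y.1 := congrArg Prod.fst hxy
  rw [one_div_abs_eq (q := q) (α := α) hx, one_div_abs_eq (q := q) (α := α) hy, hT]
  push_cast
  ring

namespace Admissible

theorem digit_sub_eq_one (h : Admissible q α) (hx : x ∈ openStair q α) (hy : y ∈ openStair q α)
    (hxneg : x.1 < 0) (hypos : 0 < y.1) (hxy : natExt q α x = natExt q α y) :
    digit q α x.1 - digit q α y.1 = 1 := by
  obtain ⟨-, -, hv0, hv1, -⟩ := hx
  obtain ⟨-, -, hw0, hw1, -⟩ := hy
  have hl := h.one_lt_lam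
  have hdiff := digit_sub_mul_lam hxy
  rw [Real.sign_of_neg hxneg, Real.sign_of_pos hypos] at hdiff
  set k := digit q α x.1 - digit q α y.1
  have hk0 : 0 < k := by
    by_contra! hk
    have hk' : (k : ℝ) ≤ 0 := by exact_mod_cast hk
    nlinarith
  have hk2 : k < 2 := by
    by_contra! hk
    have hk' : (2 : ℝ) ≤ k := by exact_mod_cast hk
    nlinarith
  omega

theorem natExt_ne_of_neg_of_pos (h : Admissible q α) (hx : x ∈ openStair q α)
    (hy : y ∈ openStair q α) (hxneg : x.1 < 0) (hypos : 0 < y.1) : natExt q α x ≠ natExt q α y := by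
  intro hxy
  have hq := h.four_le
  have hdiff := digit_sub_mul_lam hxy
  have hinv := one_div_abs_sub hxneg.ne hypos.ne' hxy
  rw [h.digit_sub_eq_one hx hy hxneg hypos hxy, Int.cast_one, one_mul] at hdiff hinv
  rw [Real.sign_of_neg hxneg, Real.sign_of_pos hypos] at hdiff
  rw [abs_of_neg hxneg, abs_of_pos hypos] at hinv
  rcases lt_or_ge x.1 (threshold q α (q - 3)) with hlt | hge
  · linarith [h.snd_le_lam_sub_one (openStair_subset hx) hlt, hy.2.2.2.1]
  · have hthreshold := hge.trans_lt hxneg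
    have hle : y.1 ≤ threshold q α (q - 2) := by
      have hanti := one_div_le_one_div_of_le (neg_pos.2 hxneg) (neg_le_neg hge)
      rw [h.one_div_neg_threshold_sub_three hthreshold] at hanti
      rw [← one_div_le_one_div (h.threshold_sub_two_pos hthreshold) hypos]
      linarith
    have hw := hy.2.2.2.2 (q - 2) (by omega) (hle.lt_of_ne (hy.2.1.2.2 _))
    rw [height_sub_two (by omega) h.even] at hw
    linarith [h.snd_le_half_lam (openStair_subset hx) hxneg]

theorem eq_of_natExt_eq_of_sign_eq (h : Admissible q α) (hx : x ∈ openStair q α)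
    (hy : y ∈ openStair q α) (hsign : Real.sign x.1 = Real.sign y.1)
    (hxy : natExt q α x = natExt q α y) : x = y := by
  obtain ⟨-, hx0, hv0, hv1, -⟩ := hx
  obtain ⟨-, hy0, hw0, hw1, -⟩ := hy
  have hσ := sign_mul_self hy0.1
  have hdiff := digit_sub_mul_lam hxy
  have hinv := one_div_abs_sub hx0.1 hy0.1 hxy
  rw [hsign, ← mul_sub] at hdiff
  have hdigit : digit q α x.1 - digit q α y.1 = 0 := by
    refine Int.abs_lt_one_iff.1 ?_
    have hlt : |((digit q α x.1 - digit q α y.1 : ℤ) : ℝ)| * lam q < 1 := by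
      calc |((digit q α x.1 - digit q α y.1 : ℤ) : ℝ)| * lam q
          = |((digit q α x.1 - digit q α y.1 : ℤ) : ℝ) * lam q| := by
            rw [abs_mul, abs_of_pos h.lam_pos]
        _ = |y.2 - x.2| := by rw [hdiff, abs_mul, abs_sign hy0.1, one_mul]
        _ < 1 := abs_lt.2 ⟨by linarith, by linarith⟩
    have hlt' : |((digit q α x.1 - digit q α y.1 : ℤ) : ℝ)| < 1 := by
      nlinarith [h.one_lt_lam, abs_nonneg ((digit q α x.1 - digit q α y.1 : ℤ) : ℝ)]
    exact_mod_cast hlt'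
  rw [hdigit, Int.cast_zero, zero_mul] at hdiff hinv
  refine Prod.ext ?_ ?_
  · have habs : |x.1| = |y.1| := by simpa [sub_eq_zero] using hinv
    rw [← sign_mul_abs x.1, hsign, habs, sign_mul_abs]
  · linear_combination Real.sign y.1 * hdiff + (y.2 - x.2) * hσ

theorem injOn_natExt (h : Admissible q α) : Set.InjOn (natExt q α) (openStair q α) := by
  intro x hx y hy hxy
  rcases hx.2.1.1.lt_or_gt with hx0 | hx0 <;> rcases hy.2.1.1.lt_or_gt with hy0 | hy0
  · refine h.eq_of_natExt_eq_of_sign_eq hx hy ?_ hxy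
    rw [Real.sign_of_neg hx0, Real.sign_of_neg hy0]
  · exact absurd hxy (h.natExt_ne_of_neg_of_pos hx hy hx0 hy0)
  · exact absurd hxy.symm (h.natExt_ne_of_neg_of_pos hy hx hy0 hx0)
  · refine h.eq_of_natExt_eq_of_sign_eq hx hy ?_ hxy
    rw [Real.sign_of_pos hx0, Real.sign_of_pos hy0]

end Admissible

end Injectivity

section Derivative

variable {q : ℕ} {α : ℝ}

theorem eventually_digit_eq {t : ℝ} (ht : t ∈ regularPoints q α) :
    ∀ᶠ s in 𝓝 t, digit q α s = digit q α t := by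
  have hcont : ContinuousAt (fun s : ℝ => |1 / (s * lam q)| + 1 - α) t := by
    have ht0 := ht.1
    simp only [one_div, mul_inv]
    fun_prop (disch := assumption)
  have hfloor : (⌊|1 / (t * lam q)| + 1 - α⌋ : ℝ) < |1 / (t * lam q)| + 1 - α :=
    (Int.floor_le _).lt_of_ne (ht.2.1 _).symm
  filter_upwards [hcont.eventually (Ioo_mem_nhds hfloor (Int.lt_floor_add_one _))] with s hs
  exact Int.floor_eq_iff.2 ⟨hs.1.le, hs.2⟩

theorem eventually_sign_eq {t : ℝ} (ht : t ≠ 0) : ∀ᶠ s in 𝓝 t, Real.sign s = Real.sign t := by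
  rcases ht.lt_or_gt with h | h
  · filter_upwards [Iio_mem_nhds h] with s hs
    rw [Real.sign_of_neg h, Real.sign_of_neg hs]
  · filter_upwards [Ioi_mem_nhds h] with s hs
    rw [Real.sign_of_pos h, Real.sign_of_pos hs]

theorem T_eq_sign_div {t : ℝ} (ht : t ≠ 0) :
    T q α t = Real.sign t / t - lam q * digit q α t := by
  have hsign : Real.sign t / t = 1 / |t| := by
    rw [div_eq_div_iff ht (abs_ne_zero.2 ht), sign_mul_abs, one_mul]
  rw [hsign, one_div_abs_eq ht, add_sub_cancel_left]

/-- The derivative of the natural extension over the regular points. -/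
noncomputable def natExtDeriv (q : ℕ) (α : ℝ) (z : ℝ × ℝ) : ℝ × ℝ →L[ℝ] ℝ × ℝ :=
  (ContinuousLinearMap.toSpanSingleton ℝ (-Real.sign z.1 / z.1 ^ 2)).prodMap
    (ContinuousLinearMap.toSpanSingleton ℝ
      (-Real.sign z.1 / (digit q α z.1 * lam q + Real.sign z.1 * z.2) ^ 2))

theorem det_natExtDeriv {z : ℝ × ℝ} (hz : z.1 ≠ 0) : (natExtDeriv q α z).det =
    1 / (z.1 ^ 2 * (digit q α z.1 * lam q + Real.sign z.1 * z.2) ^ 2) := by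
  rw [← sign_mul_self hz, ← neg_mul_neg, ← div_mul_div_comm, natExtDeriv, ContinuousLinearMap.det,
    ContinuousLinearMap.coe_prodMap, LinearMap.det_prodMap]
  congr 1 <;> exact ContinuousLinearMap.det_toSpanSingleton _

theorem hasFDerivAt_natExt {z : ℝ × ℝ} (hz : z.1 ∈ regularPoints q α)
    (hden : digit q α z.1 * lam q + Real.sign z.1 * z.2 ≠ 0) :
    HasFDerivAt (natExt q α) (natExtDeriv q α z) z := by
  set σ := Real.sign z.1
  set d := digit q α z.1
  have hfst : HasDerivAt (fun t : ℝ => σ / t - lam q * d) (-σ / z.1 ^ 2) z.1 := by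
    have hinv := ((hasDerivAt_inv hz.1).const_mul σ).sub_const (lam q * d)
    rw [mul_neg, ← div_eq_mul_inv, ← neg_div] at hinv
    simpa only [div_eq_mul_inv] using hinv
  have hsnd : HasDerivAt (fun v : ℝ => 1 / (d * lam q + σ * v))
      (-σ / (d * lam q + σ * z.2) ^ 2) z.2 := by
    have haffine : HasDerivAt (fun v : ℝ => d * lam q + σ * v) σ z.2 := by
      simpa using ((hasDerivAt_id z.2).const_mul σ).const_add (d * lam q)
    simpa only [one_div] using haffine.fun_inv hden
  refine (hfst.hasFDerivAt.prodMap z hsnd.hasFDerivAt).congr_of_eventuallyEq ?_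
  filter_upwards [(continuous_fst.tendsto z).eventually (eventually_digit_eq hz),
    (continuous_fst.tendsto z).eventually (eventually_sign_eq hz.1),
    (continuous_fst.tendsto z).eventually (isOpen_ne.mem_nhds hz.1)] with w hdigit hsign hw0
  simp only [natExt, Prod.map]
  rw [T_eq_sign_div hw0, hdigit, hsign]

theorem one_add_natExt_mul {z : ℝ × ℝ} (hz : z.1 ≠ 0)
    (hden : digit q α z.1 * lam q + Real.sign z.1 * z.2 ≠ 0) :
    1 + (natExt q α z).1 * (natExt q α z).2 = Real.sign z.1 * (1 + z.1 * z.2) /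
      (z.1 * (digit q α z.1 * lam q + Real.sign z.1 * z.2)) := by
  simp only [natExt]
  rw [T_eq_sign_div hz, mul_one_div, one_add_div hden, div_eq_div_iff hden (mul_ne_zero hz hden)]
  field_simp
  ring

end Derivative

namespace Admissible

variable {q : ℕ} {α : ℝ}

theorem det_mul_invDensity (h : Admissible q α) {z : ℝ × ℝ} (hz : z ∈ openStair q α) :
    ENNReal.ofReal |(natExtDeriv q α z).det| * invDensity (natExt q α z) = invDensity z := by
  have hz0 := hz.2.1.1
  have hden := h.one_le_natExt_den (openStair_subset hz) hz0
  have hpos := h.one_add_mul_pos hz.1.1 hz.2.2.1.le hz.2.2.2.1.le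
  have hσ : Real.sign z.1 ^ 2 = 1 := by rw [sq, sign_mul_self hz0]
  rw [invDensity, ← ENNReal.ofReal_mul (abs_nonneg _), invDensity, det_natExtDeriv hz0,
    one_add_natExt_mul hz0 (by linarith), abs_of_nonneg (by positivity), div_pow, mul_pow, hσ]
  congr 1
  field_simp

theorem hasFDerivWithinAt_natExt (h : Admissible q α) {E : Set (ℝ × ℝ)} {z : ℝ × ℝ}
    (hz : z ∈ openStair q α) : HasFDerivWithinAt (natExt q α) (natExtDeriv q α z) E z := by
  have hden := h.one_le_natExt_den (openStair_subset hz) hz.2.1.1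
  exact (hasFDerivAt_natExt hz.2.1 (by linarith)).hasFDerivWithinAt

theorem measurableSet_natExt_image (h : Admissible q α) {E : Set (ℝ × ℝ)} (hE : MeasurableSet E)
    (hsub : E ⊆ openStair q α) : MeasurableSet (natExt q α '' E) :=
  measurable_image_of_fderivWithin hE (fun _ hz => h.hasFDerivWithinAt_natExt (hsub hz))
    (h.injOn_natExt.mono hsub)

theorem stairMeasure_image (h : Admissible q α) {E : Set (ℝ × ℝ)} (hE : MeasurableSet E)
    (hsub : E ⊆ openStair q α) :
    stairMeasure q α (natExt q α '' E) = stairMeasure q α E := by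
  have himage : natExt q α '' E ⊆ stair q α :=
    Set.image_subset_iff.2 fun z hz => h.natExt_mem (openStair_subset (hsub hz)) (hsub hz).2.1.1
  rw [stairMeasure_apply (h.measurableSet_natExt_image hE hsub), stairMeasure_apply hE,
    Set.inter_eq_left.2 himage, Set.inter_eq_left.2 (hsub.trans openStair_subset),
    lintegral_image_eq_lintegral_abs_det_fderiv_mul volume hE
      (fun z hz => h.hasFDerivWithinAt_natExt (hsub hz)) (h.injOn_natExt.mono hsub)]
  exact setLIntegral_congr_fun hE fun z hz => h.det_mul_invDensity (hsub hz)

/- Surjectivity of the natural extension up to null sets is not proved directly: an injective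
map that preserves a finite measure on images has conull range. -/
theorem stairMeasure_compl_image (h : Admissible q α) :
    stairMeasure q α (natExt q α '' openStair q α)ᶜ = 0 := by
  have := h.isFiniteMeasure_stairMeasure
  have hopen := measurableSet_openStair (α := α) h.lam_pos.ne'
  rw [measure_compl (h.measurableSet_natExt_image hopen subset_rfl) (measure_ne_top _ _),
    h.stairMeasure_image hopen subset_rfl, ← measure_compl hopen (measure_ne_top _ _),
    stairMeasure_compl_openStair h.lam_pos.ne']

theorem measurePreserving_natExt (h : Admissible q α) :
    MeasurePreserving (natExt q α) (stairMeasure q α) (stairMeasure q α) := by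
  refine ⟨measurable_natExt, Measure.ext fun E hE => ?_⟩
  have hopen := measurableSet_openStair (α := α) h.lam_pos.ne'
  rw [Measure.map_apply measurable_natExt hE]
  calc stairMeasure q α (natExt q α ⁻¹' E)
      = stairMeasure q α (natExt q α ⁻¹' E ∩ openStair q α) :=
        (measure_inter_conull (stairMeasure_compl_openStair h.lam_pos.ne')).symm
    _ = stairMeasure q α (natExt q α '' (natExt q α ⁻¹' E ∩ openStair q α)) :=
        (h.stairMeasure_image ((measurable_natExt hE).inter hopen) Set.inter_subset_right).symm
    _ = stairMeasure q α (E ∩ natExt q α '' openStair q α) := by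
        rw [Set.image_preimage_inter]
    _ = stairMeasure q α E := measure_inter_conull h.stairMeasure_compl_image

end Admissible

/-! ### The planar domain as a staircase -/

/-- The `j`-th rectangle of the staircase `stair q α`, for `j + 3 ≤ q`; a last one, of height `1`,
lies over `[threshold q α (q - 2), lam q * α)`. -/
def stairStep (q : ℕ) (α : ℝ) (j : ℕ) : Set (ℝ × ℝ) :=
  Set.Ico (threshold q α j) (threshold q α (j + 1)) ×ˢ Set.Icc 0 (height (lam q) (j + 1))

theorem biUnion_range_two_mul {X : Type*} (s : ℕ → Set X) (m : ℕ) :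
    ⋃ j ∈ Finset.range (2 * m), s j =
      ⋃ n ∈ Finset.Icc 1 m, (s (2 * (n - 1)) ∪ s (2 * (n - 1) + 1)) := by
  ext x
  simp only [Set.mem_iUnion, Finset.mem_range, Finset.mem_Icc, Set.mem_union, exists_prop]
  constructor
  · rintro ⟨j, hj, hx⟩
    obtain ⟨k, rfl | rfl⟩ := Nat.even_or_odd' j
    · exact ⟨k + 1, by omega, Or.inl hx⟩
    · exact ⟨k + 1, by omega, Or.inr hx⟩
  · rintro ⟨n, hn, hx | hx⟩
    · exact ⟨_, by omega, hx⟩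
    · exact ⟨_, by omega, hx⟩

namespace Admissible

variable {q : ℕ} {α : ℝ}

theorem exists_mem_stair_interval (h : Admissible q α) {t : ℝ}
    (ht : t ∈ Set.Ico (lam q * (α - 1)) (lam q * α)) :
    (∃ j < q - 2, t ∈ Set.Ico (threshold q α j) (threshold q α (j + 1))) ∨
      t ∈ Set.Ico (threshold q α (q - 2)) (lam q * α) := by
  classical
  have hzero : threshold q α 0 ≤ t := h.threshold_zero.trans_le ht.1
  set P : ℕ → Prop := fun j => threshold q α j ≤ t
  have hspec := Nat.findGreatest_spec (P := P) (Nat.zero_le (q - 2)) hzero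
  rcases (Nat.findGreatest_le (P := P) (q - 2)).eq_or_lt with heq | hlt
  · rw [heq] at hspec
    exact Or.inr ⟨hspec, ht.2⟩
  · exact Or.inl ⟨_, hlt, hspec,
      not_le.1 (Nat.findGreatest_is_greatest (Nat.lt_succ_self _) hlt)⟩

theorem stairStep_subset_stair (h : Admissible q α) {j : ℕ} (hj : j < q - 2) :
    stairStep q α j ⊆ stair q α := by
  rintro z ⟨ht, hv⟩
  refine ⟨⟨?_, ?_⟩, hv.1, hv.2.trans (height_le_one h.four_le h.even (by omega)),
    fun i hi hlt => ?_⟩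
  · rw [← h.threshold_zero]
    exact (h.threshold_mono (Nat.zero_le j) (by omega)).trans ht.1
  · exact ht.2.trans_le
      ((h.threshold_mono (by omega : j + 1 ≤ q - 2) (by omega)).trans h.threshold_sub_two_le)
  · have hji : j + 1 ≤ i := by
      by_contra hcon
      exact hlt.not_ge ((h.threshold_mono (by omega : i ≤ j) (by omega)).trans ht.1)
    exact hv.2.trans (h.height_mono hji (by omega))

theorem lastStep_subset_stair (h : Admissible q α) :
    Set.Ico (threshold q α (q - 2)) (lam q * α) ×ˢ Set.Icc 0 1 ⊆ stair q α := by
  have hq := h.four_le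
  rintro z ⟨ht, hv⟩
  refine ⟨⟨?_, ht.2⟩, hv.1, hv.2, fun i hi hlt => ?_⟩
  · rw [← h.threshold_zero]
    exact (h.threshold_mono (Nat.zero_le (q - 2)) (by omega)).trans ht.1
  · exact absurd hlt
      ((h.threshold_mono (by omega : i ≤ q - 2) (by omega)).trans ht.1).not_gt

theorem stair_eq_iUnion_stairStep (h : Admissible q α) :
    stair q α = (⋃ j ∈ Finset.range (q - 2), stairStep q α j) ∪
      Set.Ico (threshold q α (q - 2)) (lam q * α) ×ˢ Set.Icc 0 1 := by
  refine Set.Subset.antisymm ?_ (Set.union_subset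
    (Set.iUnion₂_subset fun j hj => h.stairStep_subset_stair (Finset.mem_range.1 hj))
    h.lastStep_subset_stair)
  rintro z ⟨ht, hv0, hv1, hv⟩
  obtain ⟨j, hj, htj⟩ | hlast := h.exists_mem_stair_interval ht
  · exact Or.inl (Set.mem_iUnion₂.2
      ⟨j, Finset.mem_range.2 hj, htj, hv0, hv (j + 1) (by omega) htj.2⟩)
  · exact Or.inr ⟨hlast, hv0, hv1⟩

theorem threshold_lt_right_of_lt (h : Admissible q α) (hα : α < 1 / lam q) {j : ℕ}
    (hj : j + 2 ≤ q) :
    threshold q α j < lam q * α := by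
  refine (h.threshold_mono (by omega : j ≤ q - 2) (by omega)).trans_lt ?_
  have hright : lam q * α < 1 := by rwa [mul_comm, ← lt_div_iff₀ h.lam_pos]
  have hsq : 0 < 1 - (lam q * α) ^ 2 := by nlinarith [h.right_pos]
  have hden : 0 < 2 - lam q * (lam q * α) := sub_pos.2 h.lam_mul_right_lt_two
  rw [threshold_sub_two, chainParam, div_lt_iff₀ hden]
  nlinarith [mul_pos h.lam_pos hsq]

theorem T_threshold (h : Admissible q α) (hα : α < 1 / lam q) {j : ℕ} (hj : j + 4 ≤ q) :
    T q α (threshold q α j) = threshold q α (j + 2) := by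
  have hneg := h.threshold_neg hj
  refine T_eq_of_add (d := 1) h.lam_pos hneg.ne ?_
    ⟨?_, h.threshold_lt_right_of_lt hα (by omega)⟩
  · rw [threshold_add_two hj, abs_of_neg hneg, div_neg, neg_div]
    push_cast
    ring
  · rw [← h.threshold_zero]
    exact h.threshold_mono (Nat.zero_le _) (by omega)

theorem T_right (h : Admissible q α) : T q α (lam q * α) = threshold q α 1 := by
  have hq := h.four_le
  refine T_eq_of_add (d := 1) h.lam_pos h.right_pos.ne' ?_ ⟨?_, ?_⟩
  · rw [h.threshold_one, abs_of_pos h.right_pos]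
    push_cast
    ring
  · rw [← h.threshold_zero]
    exact h.threshold_mono (Nat.zero_le _) (by omega)
  · exact ((h.threshold_mono (by omega : 1 ≤ q - 3) (by omega)).trans
      h.threshold_sub_three_nonpos).trans_lt h.right_pos

theorem ell_eq_threshold (h : Admissible q α) (hα : α < 1 / lam q) {n : ℕ} (hn : 2 * n + 2 ≤ q) :
    ell q α n = threshold q α (2 * n) := by
  induction n with
  | zero => rw [ell, Function.iterate_zero, id, Nat.mul_zero, h.threshold_zero]; ring
  | succ n ih =>
    rw [ell, Function.iterate_succ_apply', ← ell, ih (by omega), h.T_threshold hα (by omega)]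
    rfl

theorem r_succ_eq_threshold (h : Admissible q α) (hα : α < 1 / lam q) {n : ℕ}
    (hn : 2 * n + 3 ≤ q) : r q α (n + 1) = threshold q α (2 * n + 1) := by
  induction n with
  | zero => rw [r, Function.iterate_one, mul_comm, h.T_right]
  | succ n ih =>
    rw [r, Function.iterate_succ_apply', ← r, ih (by omega), h.T_threshold hα (by omega)]
    rfl

theorem stairStep_two_mul (h : Admissible q α) (hα : α < 1 / lam q) {n : ℕ}
    (hn : 2 * n + 3 ≤ q) :
    stairStep q α (2 * n) =
      Set.Ico (ell q α n) (r q α (n + 1)) ×ˢ Set.Icc 0 (Hodd q (n + 1)) := by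
  rw [stairStep, h.ell_eq_threshold hα (by omega), h.r_succ_eq_threshold hα hn,
    height_odd h.four_le h.even (by omega)]

theorem stairStep_two_mul_add_one (h : Admissible q α) (hα : α < 1 / lam q) {n : ℕ}
    (hn : 2 * n + 4 ≤ q) :
    stairStep q α (2 * n + 1) =
      Set.Ico (r q α (n + 1)) (ell q α (n + 1)) ×ˢ Set.Icc 0 (Heven q (n + 1)) := by
  rw [stairStep, h.ell_eq_threshold hα (by omega), h.r_succ_eq_threshold hα (by omega),
    show 2 * n + 1 + 1 = 2 * (n + 1) by ring, height_even (by omega)]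
  push_cast
  rfl

theorem OmegaGeneric_eq_stair (h : Admissible q α) (hα : α < 1 / lam q) :
    OmegaGeneric q α = stair q α := by
  have hq := h.four_le
  obtain ⟨p, rfl⟩ := h.even.two_dvd
  have hlast : Hodd (2 * p) (p : ℤ) = 1 := by
    rw [← height_sub_one hq h.even, show 2 * p - 1 = 2 * (p - 1) + 1 by omega,
      height_odd hq h.even (by omega)]
    congr 1
    omega
  rw [h.stair_eq_iUnion_stairStep, OmegaGeneric, show 2 * p - 2 = 2 * (p - 1) by omega,
    biUnion_range_two_mul, Nat.mul_div_cancel_left p two_pos, hlast,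
    h.ell_eq_threshold hα (by omega), r, Function.iterate_zero, id, mul_comm α]
  congr 1
  refine Set.iUnion₂_congr fun n hn => ?_
  have hn' := Finset.mem_Icc.1 hn
  obtain ⟨k, rfl⟩ : ∃ k, n = k + 1 := ⟨n - 1, by omega⟩
  rw [Nat.add_sub_cancel, h.stairStep_two_mul hα (by omega),
    h.stairStep_two_mul_add_one hα (by omega), Nat.cast_add_one]

theorem lam_mul_eq_one (h : Admissible q α) (hα : α = 1 / lam q) : lam q * α = 1 := by
  rw [hα, mul_one_div_cancel h.lam_pos.ne']

theorem threshold_two_mul_add_one_of_eq (h : Admissible q α) (hα : α = 1 / lam q) {n : ℕ}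
    (hn : 2 * n + 3 ≤ q) :
    threshold q α (2 * n + 1) =
      (B q (n + 1) - B q (n + 1 + 1)) / (B q (n + 1) - B q (n + 1 - 1)) := by
  have hq := h.four_le
  have hq2 : 2 ≤ q := by omega
  induction n with
  | zero =>
    rw [h.threshold_one, h.lam_mul_eq_one hα]
    norm_num [B_zero, B_one hq2, B_two hq2]
  | succ n ih =>
    have hlt : B q (n + 1) < B q (n + 1 + 1) :=
      B_lt_B hq2 (by omega) (by omega) (by omega)
    have hrec := lam_mul_B q (n + 1)
    have hrec' := lam_mul_B q (n + 1 + 1)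
    have hne : B q (n + 1) - B q (n + 1 + 1) ≠ 0 := by linarith
    have hne' : B q (n + 1 + 1) - B q (n + 1) ≠ 0 := by linarith
    push_cast
    rw [show (n : ℤ) + 1 + 1 - 1 = n + 1 by ring] at *
    rw [show 2 * (n + 1) + 1 = 2 * n + 1 + 2 by ring, threshold_add_two (by omega), ih (by omega),
      div_div_eq_mul_div, div_sub' hne, div_eq_div_iff hne hne']
    linear_combination (B q (n + 1) - B q (n + 1 + 1)) * (hrec - hrec')

theorem threshold_two_mul_of_eq (h : Admissible q α) (hα : α = 1 / lam q) {n : ℕ}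
    (hn : 2 * n + 3 ≤ q) : threshold q α (2 * n) = threshold q α (2 * n + 1) := by
  obtain ⟨p, hp⟩ := h.even
  induction n with
  | zero =>
    rw [Nat.mul_zero, h.threshold_zero, h.threshold_one, mul_sub, h.lam_mul_eq_one hα]
    ring
  | succ n ih =>
    rw [show 2 * (n + 1) + 1 = 2 * n + 1 + 2 by ring, show 2 * (n + 1) = 2 * n + 2 by ring,
      threshold_add_two (by omega), threshold_add_two (by omega), ih (by omega)]

theorem threshold_sub_two_of_eq (h : Admissible q α) (hα : α = 1 / lam q) :
    threshold q α (q - 2) = 1 := by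
  rw [threshold_sub_two, chainParam, h.lam_mul_eq_one hα,
    div_eq_one_iff_eq (by linarith [h.lam_lt_two])]
  ring

theorem threshold_two_mul_add_two_of_eq (h : Admissible q α) (hα : α = 1 / lam q) {n : ℕ}
    (hn : 2 * n + 4 ≤ q) :
    threshold q α (2 * n + 1 + 1) =
      (B q (n + 1 + 1) - B q (n + 1 + 2)) / (B q (n + 1 + 1) - B q (n + 1)) := by
  obtain ⟨p, rfl⟩ := h.even.two_dvd
  rcases hn.eq_or_lt with heq | hlt
  · have hsymm := B_half_add_one (q := 2 * p) (by omega) h.even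
    have hB : B (2 * p) (n + 1) < B (2 * p) (n + 1 + 1) :=
      B_lt_B (by omega) (by omega) (by omega) (by omega)
    rw [Nat.mul_div_cancel_left p two_pos, show ((p : ℕ) : ℤ) = n + 2 by omega,
      show (n : ℤ) + 2 + 1 = n + 1 + 2 by ring, show (n : ℤ) + 2 - 1 = n + 1 by ring] at hsymm
    rw [hsymm, show 2 * n + 1 + 1 = 2 * p - 2 by omega, h.threshold_sub_two_of_eq hα,
      div_self (sub_pos.2 hB).ne']
  · rw [show 2 * n + 1 + 1 = 2 * (n + 1) by ring, h.threshold_two_mul_of_eq hα (by omega),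
      h.threshold_two_mul_add_one_of_eq hα (by omega)]
    push_cast
    rw [show (n : ℤ) + 1 + 1 + 1 = n + 1 + 2 by ring, show (n : ℤ) + 1 + 1 - 1 = n + 1 by ring]

theorem stairStep_two_mul_of_eq (h : Admissible q α) (hα : α = 1 / lam q) {n : ℕ}
    (hn : 2 * n + 3 ≤ q) : stairStep q α (2 * n) = ∅ := by
  rw [stairStep, h.threshold_two_mul_of_eq hα hn, Set.Ico_self, Set.empty_prod]

theorem stairStep_two_mul_add_one_of_eq (h : Admissible q α) (hα : α = 1 / lam q) {n : ℕ}
    (hn : 2 * n + 4 ≤ q) :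
    stairStep q α (2 * n + 1) =
      Set.Ico ((B q (n + 1) - B q (n + 1 + 1)) / (B q (n + 1) - B q (n + 1 - 1)))
          ((B q (n + 1 + 1) - B q (n + 1 + 2)) / (B q (n + 1 + 1) - B q (n + 1))) ×ˢ
        Set.Icc 0 (B q (n + 1) / B q (n + 1 + 1)) := by
  rw [stairStep, h.threshold_two_mul_add_one_of_eq hα (by omega),
    h.threshold_two_mul_add_two_of_eq hα hn, show 2 * n + 1 + 1 = 2 * (n + 1) by ring,
    height_even (by omega), Heven]
  push_cast
  rfl

theorem OmegaLast_eq_stair (h : Admissible q α) (hα : α = 1 / lam q) :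
    OmegaLast q = stair q α := by
  have hq := h.four_le
  obtain ⟨p, rfl⟩ := h.even.two_dvd
  rw [h.stair_eq_iUnion_stairStep, h.threshold_sub_two_of_eq hα, h.lam_mul_eq_one hα,
    Set.Ico_self, Set.empty_prod, Set.union_empty, show 2 * p - 2 = 2 * (p - 1) by omega,
    biUnion_range_two_mul, OmegaLast, Nat.mul_div_cancel_left p two_pos]
  ext z
  simp only [Set.mem_iUnion, exists_prop, Finset.mem_Icc]
  constructor
  · rintro ⟨n, hn, hz⟩
    obtain ⟨k, rfl⟩ : ∃ k : ℕ, n = k + 1 := ⟨(n - 1).toNat, by omega⟩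
    refine ⟨k + 1, by omega, Or.inr ?_⟩
    rwa [Nat.add_sub_cancel, h.stairStep_two_mul_add_one_of_eq hα (by omega)]
  · rintro ⟨n, hn, hz | hz⟩
    · rw [h.stairStep_two_mul_of_eq hα (by omega)] at hz
      exact hz.elim
    · rw [h.stairStep_two_mul_add_one_of_eq hα (by omega)] at hz
      refine ⟨(n - 1 : ℕ) + 1, by omega, hz⟩

theorem Omega_eq_stair (h : Admissible q α) : Omega q α = stair q α := by
  rw [Omega]
  split_ifs with hα
  · exact h.OmegaLast_eq_stair hα
  · exact h.OmegaGeneric_eq_stair (h.le_inv.lt_of_ne hα)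

end Admissible

/-! ### The mass of the points with a small approximation coefficient -/

/-- The signed approximation coefficient `t / (1 + t v)`. For fixed `v` it is the change of
variable that turns `dt / (1 + t v) ^ 2` into Lebesgue measure. -/
noncomputable def signedCoeff (t v : ℝ) : ℝ := t / (1 + t * v)

/-- The approximation coefficient as a function on the planar domain: `Θ_n(x)` is its value at
the `n`-th point of the orbit of `(x, 0)` under `natExt`. -/
noncomputable def coeff (z : ℝ × ℝ) : ℝ := |z.1| / (1 + z.1 * z.2)

/-- The part of the plane where the approximation coefficient is less than `c`. -/
def smallCoeff (c : ℝ) : Set (ℝ × ℝ) := {z | coeff z < c}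

section SignedCoeff

variable {t u v y : ℝ}

theorem signedCoeff_le_signedCoeff_iff (ht : 0 < 1 + t * v) (hu : 0 < 1 + u * v) :
    signedCoeff t v ≤ signedCoeff u v ↔ t ≤ u := by
  rw [signedCoeff, signedCoeff, div_le_div_iff₀ ht hu]
  constructor <;> intro h <;> linarith

theorem signedCoeff_lt_signedCoeff_iff (ht : 0 < 1 + t * v) (hu : 0 < 1 + u * v) :
    signedCoeff t v < signedCoeff u v ↔ t < u :=
  lt_iff_lt_of_le_iff_le (signedCoeff_le_signedCoeff_iff hu ht)

theorem one_add_signedCoeff_neg_mul (hy : 0 < 1 - y * v) :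
    1 + signedCoeff y (-v) * v = 1 / (1 - y * v) := by
  rw [signedCoeff, mul_neg, ← sub_eq_add_neg]
  field_simp
  ring

theorem signedCoeff_signedCoeff_neg (hy : 0 < 1 - y * v) :
    signedCoeff (signedCoeff y (-v)) v = y := by
  rw [signedCoeff, one_add_signedCoeff_neg_mul hy, signedCoeff, mul_neg, ← sub_eq_add_neg]
  field_simp

theorem signedCoeff_nonneg (ht : 0 ≤ t) (hv : 0 ≤ v) : 0 ≤ signedCoeff t v :=
  div_nonneg ht (by positivity)

theorem hasDerivAt_signedCoeff (ht : 1 + t * v ≠ 0) :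
    HasDerivAt (fun t => signedCoeff t v) (1 / (1 + t * v) ^ 2) t := by
  have hden : HasDerivAt (fun t : ℝ => 1 + t * v) v t := by
    simpa using ((hasDerivAt_id t).mul_const v).const_add 1
  have hnum : (1 * (1 + t * v) - id t * v) / (1 + t * v) ^ 2 = 1 / (1 + t * v) ^ 2 := by
    rw [id]
    ring_nf
  exact hnum ▸ (hasDerivAt_id t).fun_div hden ht

theorem measurable_signedCoeff : Measurable fun z : ℝ × ℝ => signedCoeff z.1 z.2 :=
  measurable_fst.div ((measurable_fst.mul measurable_snd).const_add 1)

theorem setLIntegral_invDensity {s : Set ℝ} (hs : MeasurableSet s)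
    (hpos : ∀ t ∈ s, 0 < 1 + t * v) :
    ∫⁻ t in s, invDensity (t, v) = volume ((fun t => signedCoeff t v) '' s) := by
  have hinj : Set.InjOn (fun t => signedCoeff t v) s := fun t ht u hu heq =>
    le_antisymm ((signedCoeff_le_signedCoeff_iff (hpos t ht) (hpos u hu)).1 heq.le)
      ((signedCoeff_le_signedCoeff_iff (hpos u hu) (hpos t ht)).1 heq.ge)
  rw [← setLIntegral_one, lintegral_image_eq_lintegral_abs_deriv_mul hs
    (fun t ht => (hasDerivAt_signedCoeff (hpos t ht).ne').hasDerivWithinAt) hinj]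
  refine setLIntegral_congr_fun hs fun t _ => ?_
  rw [invDensity, mul_one, abs_of_nonneg (by positivity)]

end SignedCoeff

theorem coeff_eq_abs_signedCoeff {t v : ℝ} (h : 0 < 1 + t * v) :
    coeff (t, v) = |signedCoeff t v| := by
  rw [coeff, signedCoeff, abs_div, abs_of_pos h]

theorem measurable_coeff : Measurable coeff :=
  measurable_fst.abs.div ((measurable_fst.mul measurable_snd).const_add 1)

theorem measurableSet_smallCoeff (c : ℝ) : MeasurableSet (smallCoeff c) :=
  measurableSet_lt measurable_coeff measurable_const

section SmallCoeff

variable {q : ℕ} {α : ℝ}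

/-- The mass that the density of `stairMeasure` gives to the horizontal section of
`smallCoeff c ∩ stair q α` at level `v`. -/
noncomputable def sectionMass (q : ℕ) (α c v : ℝ) : ENNReal :=
  ∫⁻ t in (fun t => (t, v)) ⁻¹' (smallCoeff c ∩ stair q α), invDensity (t, v)

theorem stairMeasure_smallCoeff (c : ℝ) :
    stairMeasure q α (smallCoeff c) = ∫⁻ v in Set.Ioc 0 1, sectionMass q α c v := by
  have hmeas := (measurableSet_smallCoeff c).inter (measurableSet_stair (q := q) (α := α))
  have hsupport : Function.support (sectionMass q α c) ⊆ Set.Icc 0 1 := by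
    refine Function.support_subset_iff'.2 fun v hv => ?_
    have hempty : (fun t => (t, v)) ⁻¹' (smallCoeff c ∩ stair q α) = ∅ :=
      Set.eq_empty_of_forall_notMem fun t ht => hv ⟨ht.2.2.1, ht.2.2.2.1⟩
    rw [sectionMass, hempty, setLIntegral_empty]
  rw [restrict_Ioc_eq_restrict_Icc, setLIntegral_eq_of_support_subset hsupport,
    stairMeasure_apply (measurableSet_smallCoeff c), ← lintegral_indicator hmeas,
    Measure.volume_eq_prod, lintegral_prod_symm _
      (measurable_invDensity.indicator hmeas).aemeasurable]
  exact lintegral_congr fun v => lintegral_indicator (measurable_prodMk_right hmeas) _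

namespace Admissible

section Sections

variable {c v : ℝ} {j : ℕ}

theorem pos_of_height_lt (h : Admissible q α) (hj : j + 2 ≤ q) (hv : height (lam q) j < v) :
    0 < v :=
  (h.height_mono (Nat.zero_le j) (by omega)).trans_lt hv

theorem le_one_of_le_height (h : Admissible q α) (hj : j + 2 ≤ q)
    (hv : v ≤ height (lam q) (j + 1)) : v ≤ 1 :=
  hv.trans (height_le_one h.four_le h.even (by omega))

theorem le_threshold (h : Admissible q α) (hj : j + 2 ≤ q) :
    lam q * (α - 1) ≤ threshold q α j :=
  h.threshold_zero.ge.trans (h.threshold_mono (Nat.zero_le j) hj)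

theorem one_add_threshold_mul_pos (h : Admissible q α) (hj : j + 2 ≤ q)
    (hv : v ∈ Set.Ioc (height (lam q) j) (height (lam q) (j + 1))) :
    0 < 1 + threshold q α j * v :=
  h.one_add_mul_pos (h.le_threshold hj) (h.pos_of_height_lt hj hv.1).le
    (h.le_one_of_le_height hj hv.2)

theorem mem_stair_iff (h : Admissible q α) (hj : j + 2 ≤ q)
    (hv : v ∈ Set.Ioc (height (lam q) j) (height (lam q) (j + 1))) (t : ℝ) :
    (t, v) ∈ stair q α ↔ t ∈ Set.Ico (threshold q α j) (lam q * α) := by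
  refine ⟨fun ⟨ht, _, _, hstep⟩ => ⟨?_, ht.2⟩, fun ht =>
    ⟨⟨(h.le_threshold hj).trans ht.1, ht.2⟩, (h.pos_of_height_lt hj hv.1).le,
      h.le_one_of_le_height hj hv.2, fun i hi hlt => ?_⟩⟩
  · by_contra hcon
    exact (hstep j hj (not_le.1 hcon)).not_gt hv.1
  · refine hv.2.trans (h.height_mono ?_ (by omega))
    by_contra hcon
    exact hlt.not_ge ((h.threshold_mono (by omega : i ≤ j) hj).trans ht.1)

theorem sectionMass_eq_volume (h : Admissible q α) (hj : j + 2 ≤ q)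
    (hv : v ∈ Set.Ioc (height (lam q) j) (height (lam q) (j + 1))) :
    sectionMass q α c v = volume ((fun t => signedCoeff t v) ''
      {t | t ∈ Set.Ico (threshold q α j) (lam q * α) ∧ |signedCoeff t v| < c}) := by
  have hpos : ∀ t, (t, v) ∈ stair q α → 0 < 1 + t * v := fun t ht =>
    h.one_add_mul_pos ht.1.1 ht.2.1 ht.2.2.1
  have hsection : (fun t => (t, v)) ⁻¹' (smallCoeff c ∩ stair q α) =
      {t | t ∈ Set.Ico (threshold q α j) (lam q * α) ∧ |signedCoeff t v| < c} := by
    ext t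
    rw [Set.mem_preimage, Set.mem_inter_iff, and_comm, Set.mem_ofPred_eq,
      ← h.mem_stair_iff hj hv]
    refine and_congr_right fun ht => ?_
    rw [smallCoeff, Set.mem_ofPred_eq, coeff_eq_abs_signedCoeff (hpos t ht)]
  rw [sectionMass, ← hsection]
  exact setLIntegral_invDensity (measurable_prodMk_right
    ((measurableSet_smallCoeff c).inter measurableSet_stair)) fun t ht => hpos t ht.2

theorem sectionMass_le (h : Admissible q α) (hj : j + 2 ≤ q)
    (hv : v ∈ Set.Ioc (height (lam q) j) (height (lam q) (j + 1))) :
    sectionMass q α c v ≤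
      ENNReal.ofReal (c - max (signedCoeff (threshold q α j) v) (-c)) := by
  rw [h.sectionMass_eq_volume hj hv, ← Real.volume_Ico]
  refine measure_mono ?_
  rintro _ ⟨t, ⟨ht, htc⟩, rfl⟩
  obtain ⟨hneg, hlt⟩ := abs_lt.1 htc
  have ht' := (h.mem_stair_iff hj hv t).2 ht
  refine ⟨max_le ?_ hneg.le, hlt⟩
  exact (signedCoeff_le_signedCoeff_iff (h.one_add_threshold_mul_pos hj hv)
    (h.one_add_mul_pos ht'.1.1 ht'.2.1 ht'.2.2.1)).2 ht.1

theorem le_sectionMass (h : Admissible q α) (hj : j + 2 ≤ q)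
    (hv : v ∈ Set.Ioc (height (lam q) j) (height (lam q) (j + 1)))
    (hc : c ≤ signedCoeff (lam q * α) v) :
    ENNReal.ofReal (c - max (signedCoeff (threshold q α j) v) (-c)) ≤ sectionMass q α c v := by
  rw [h.sectionMass_eq_volume hj hv, ← Real.volume_Ioo]
  refine measure_mono ?_
  rintro y ⟨hmax, hyc⟩
  obtain ⟨hthreshold, hneg⟩ := max_lt_iff.1 hmax
  have hvpos := h.pos_of_height_lt hj hv.1
  have hright : 0 < 1 + lam q * α * v := by
    have := h.right_pos
    positivity
  have hyright : y < signedCoeff (lam q * α) v := hyc.trans_le hc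
  have hden : 0 < 1 - y * v := by
    rw [signedCoeff, lt_div_iff₀ hright] at hyright
    by_contra hcon
    nlinarith [h.right_pos, mul_pos h.right_pos hvpos]
  have heq := signedCoeff_signedCoeff_neg hden
  have hpos : 0 < 1 + signedCoeff y (-v) * v := by
    rw [one_add_signedCoeff_neg_mul hden]
    positivity
  refine ⟨signedCoeff y (-v), ⟨⟨?_, ?_⟩, ?_⟩, heq⟩
  · rw [← signedCoeff_le_signedCoeff_iff (h.one_add_threshold_mul_pos hj hv) hpos, heq]
    exact hthreshold.le
  · rwa [← signedCoeff_lt_signedCoeff_iff hpos hright, heq]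
  · rw [heq]
    exact abs_lt.2 ⟨hneg, hyc⟩

end Sections

theorem exists_height_lt_le (h : Admissible q α) {v : ℝ} (hv : v ∈ Set.Ioc 0 (lam q - 1)) :
    ∃ j, j + 4 ≤ q ∧ v ∈ Set.Ioc (height (lam q) j) (height (lam q) (j + 1)) := by
  have hq := h.four_le
  classical
  set P : ℕ → Prop := fun j => height (lam q) j < v
  have hzero : P 0 := hv.1
  have hspec := Nat.findGreatest_spec (P := P) (Nat.zero_le (q - 4)) hzero
  have hle := Nat.findGreatest_le (P := P) (q - 4)
  refine ⟨_, by omega, hspec, ?_⟩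
  rcases hle.eq_or_lt with heq | hlt
  · rw [heq, show q - 4 + 1 = q - 3 by omega, height_sub_three hq h.even]
    exact hv.2
  · exact not_lt.1 (Nat.findGreatest_is_greatest (P := P) (Nat.lt_succ_self _) hlt)

section SmallBound

variable {c v : ℝ}

theorem le_signedCoeff_right (h : Admissible q α) (hc : c ≤ L q α) (hv0 : 0 ≤ v) (hv1 : v ≤ 1) :
    c ≤ signedCoeff (lam q * α) v := by
  have hlam := h.lam_pos
  have hright := h.right_pos
  refine (hc.trans (min_le_left _ _)).trans ?_
  rw [signedCoeff, div_le_div_iff₀ (by positivity) (by positivity)]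
  nlinarith [h.half_lam_le, mul_le_of_le_one_right hright.le hv1]

theorem mul_threshold_sub_two_add_le_one (h : Admissible q α) (hc : c ≤ L q α) :
    c * (threshold q α (q - 2) + 2 / lam q) ≤ 1 := by
  have hlam := h.lam_pos
  have hsq : 0 < 4 - lam q ^ 2 := by nlinarith [h.lam_lt_two]
  have hden : 0 < 2 - lam q * (lam q * α) := sub_pos.2 h.lam_mul_right_lt_two
  have hsum : threshold q α (q - 2) + 2 / lam q =
      (4 - lam q ^ 2) / (lam q * (2 - lam q * (lam q * α))) := by
    rw [threshold_sub_two, chainParam, div_add_div _ _ hden.ne' hlam.ne',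
      div_eq_div_iff (by positivity) (by positivity)]
    ring
  have hL : c ≤ lam q * (2 - α * lam q ^ 2) / (4 - lam q ^ 2) := hc.trans (min_le_right _ _)
  rw [le_div_iff₀ hsq] at hL
  rw [hsum, mul_div_assoc', div_le_one (by positivity)]
  linarith

theorem le_one_div_lam (h : Admissible q α) (hc : c ≤ L q α) : c ≤ 1 / lam q := by
  have hlam := h.lam_pos
  refine (hc.trans (min_le_left _ _)).trans ?_
  rw [div_le_div_iff₀ (by positivity) hlam]
  nlinarith [h.lam_lt_two]

theorem one_div_lam_le_neg_threshold (h : Admissible q α) {j : ℕ} (hj : j + 5 ≤ q) :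
    1 / lam q ≤ -threshold q α j := by
  have hneg := h.threshold_neg (by omega : q - 5 + 4 ≤ q)
  have hle : -1 / threshold q α (q - 5) ≤ lam q := by
    have hadd := threshold_add_two (α := α) (by omega : q - 5 + 4 ≤ q)
    rw [show q - 5 + 2 = q - 3 by omega] at hadd
    linarith [h.threshold_sub_three_nonpos]
  rw [div_le_iff_of_neg hneg] at hle
  refine le_trans ?_ (neg_le_neg (h.threshold_mono (by omega : j ≤ q - 5) (by omega)))
  rw [div_le_iff₀ h.lam_pos]
  linarith

theorem mul_sub_le_one (h : Admissible q α) (hc0 : 0 ≤ c) (hc : c ≤ L q α)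
    (hv : height (lam q) (q - 4) < v) : c * (-1 / threshold q α (q - 4) - v) ≤ 1 := by
  have hq := h.four_le
  have hadd := threshold_add_two (α := α) (by omega : q - 4 + 4 ≤ q)
  rw [show q - 4 + 2 = q - 2 by omega] at hadd
  rw [height_sub_four hq h.even] at hv
  refine le_trans (mul_le_mul_of_nonneg_left ?_ hc0) (h.mul_threshold_sub_two_add_le_one hc)
  linarith

theorem signedCoeff_threshold_le_neg (h : Admissible q α) (hc0 : 0 ≤ c) (hc : c ≤ L q α) {j : ℕ}
    (hj : j + 4 ≤ q) (hv : v ∈ Set.Ioc (height (lam q) j) (height (lam q) (j + 1))) :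
    signedCoeff (threshold q α j) v ≤ -c := by
  have hneg := h.threshold_neg hj
  rw [signedCoeff, div_le_iff₀ (h.one_add_threshold_mul_pos (by omega) hv)]
  rcases (show j ≤ q - 4 by omega).eq_or_lt with rfl | hlt
  · have hle := h.mul_sub_le_one hc0 hc hv.1
    have hprod : -1 / threshold q α (q - 4) * threshold q α (q - 4) = -1 :=
      div_mul_cancel₀ _ hneg.ne
    nlinarith
  · have hle : c ≤ -threshold q α j :=
      (h.le_one_div_lam hc).trans (h.one_div_lam_le_neg_threshold (by omega))
    have hvpos := h.pos_of_height_lt (by omega) hv.1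
    nlinarith [mul_nonneg hc0 (mul_nonneg (neg_nonneg.2 hneg.le) hvpos.le)]

theorem signedCoeff_threshold_sub_three (h : Admissible q α) (hv : v ≤ lam q) :
    signedCoeff (threshold q α (q - 3)) v = -signedCoeff (threshold q α (q - 2)) (lam q - v) := by
  have hq := h.four_le
  have hthreshold := h.threshold_sub_two_nonneg
  have hlam := h.lam_pos
  rw [threshold_sub_three (by omega), signedCoeff, signedCoeff]
  set m := threshold q α (q - 2)
  have hnum : 0 < 1 + m * (lam q - v) := by
    have : 0 ≤ lam q - v := sub_nonneg.2 hv
    positivity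
  have : 0 < 1 + lam q * m := by positivity
  have heq : 1 + -(m / (1 + lam q * m)) * v = (1 + m * (lam q - v)) / (1 + lam q * m) := by
    field_simp
    ring
  rw [heq]
  field_simp

theorem sectionMass_le_two_mul (h : Admissible q α) (hv : v ∈ Set.Ioc 0 (lam q - 1)) :
    sectionMass q α c v ≤ ENNReal.ofReal (2 * c) := by
  obtain ⟨j, hj, hvj⟩ := h.exists_height_lt_le hv
  refine (h.sectionMass_le (by omega) hvj).trans (ENNReal.ofReal_le_ofReal ?_)
  linarith [le_max_right (signedCoeff (threshold q α j) v) (-c)]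

theorem two_mul_le_sectionMass (h : Admissible q α) (hc0 : 0 ≤ c) (hc : c ≤ L q α)
    (hv : v ∈ Set.Ioc 0 (lam q - 1)) : ENNReal.ofReal (2 * c) ≤ sectionMass q α c v := by
  obtain ⟨j, hj, hvj⟩ := h.exists_height_lt_le hv
  have hright := h.le_signedCoeff_right hc hv.1.le (by linarith [hv.2, h.lam_lt_two])
  refine le_trans (ENNReal.ofReal_le_ofReal ?_) (h.le_sectionMass (by omega) hvj hright)
  rw [max_eq_right (h.signedCoeff_threshold_le_neg hc0 hc hj hvj)]
  linarith

theorem mem_Ioc_height_sub_three (h : Admissible q α)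
    (hv : v ∈ Set.Ioc (lam q - 1) (lam q / 2)) :
    v ∈ Set.Ioc (height (lam q) (q - 3)) (height (lam q) (q - 3 + 1)) := by
  have hq := h.four_le
  rwa [height_sub_three hq h.even, show q - 3 + 1 = q - 2 by omega,
    height_sub_two (by omega) h.even]

theorem mem_Ioc_height_sub_two (h : Admissible q α) (hv : v ∈ Set.Ioc (lam q / 2) 1) :
    v ∈ Set.Ioc (height (lam q) (q - 2)) (height (lam q) (q - 2 + 1)) := by
  have hq := h.four_le
  rwa [height_sub_two (by omega) h.even, show q - 2 + 1 = q - 1 by omega,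
    height_sub_one hq h.even]

theorem sub_max_signedCoeff_sub_three (h : Admissible q α)
    (hv : v ∈ Set.Ioc (lam q - 1) (lam q / 2)) :
    c - max (signedCoeff (threshold q α (q - 3)) v) (-c) =
      c + min c (signedCoeff (threshold q α (q - 2)) (lam q - v)) := by
  rw [h.signedCoeff_threshold_sub_three (by linarith [hv.2, h.lam_pos]), max_neg_neg, min_comm,
    sub_neg_eq_add]

theorem ofReal_sub_max_signedCoeff_sub_two (h : Admissible q α) (hc : 0 ≤ c)
    (hv : v ∈ Set.Ioc (lam q / 2) 1) :
    ENNReal.ofReal (c - max (signedCoeff (threshold q α (q - 2)) v) (-c)) =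
      ENNReal.ofReal (c - min c (signedCoeff (threshold q α (q - 2)) v)) := by
  have hnonneg : 0 ≤ signedCoeff (threshold q α (q - 2)) v :=
    signedCoeff_nonneg h.threshold_sub_two_nonneg (by linarith [hv.1, h.lam_pos])
  rw [max_eq_left (by linarith)]
  rcases le_total c (signedCoeff (threshold q α (q - 2)) v) with hle | hle
  · rw [min_eq_left hle, sub_self, ENNReal.ofReal_zero, ENNReal.ofReal_of_nonpos (by linarith)]
  · rw [min_eq_right hle]

end SmallBound

section HeightIntegral

variable {c m : ℝ}

theorem setLIntegral_add_min_signedCoeff_flip (q : ℕ) (c m : ℝ) :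
    ∫⁻ v in Set.Ioc (lam q - 1) (lam q / 2),
        ENNReal.ofReal (c + min c (signedCoeff m (lam q - v))) =
      ∫⁻ v in Set.Ioc (lam q / 2) 1, ENNReal.ofReal (c + min c (signedCoeff m v)) := by
  have hpre : (fun v => lam q - v) ⁻¹' Set.Icc (lam q / 2) 1 = Set.Icc (lam q - 1) (lam q / 2) := by
    rw [Set.preimage_const_sub_Icc, sub_half]
  rw [restrict_Ioc_eq_restrict_Icc, restrict_Ioc_eq_restrict_Icc, ← hpre]
  exact (Measure.measurePreserving_sub_left volume (lam q)).setLIntegral_comp_preimage_emb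
    (MeasurableEquiv.subLeft (lam q)).measurableEmbedding
    (fun v => ENNReal.ofReal (c + min c (signedCoeff m v))) _

theorem lintegral_add_min_add_lintegral_sub_min (hlam : 0 ≤ lam q) (hc : 0 ≤ c) (hm : 0 ≤ m) :
    (∫⁻ v in Set.Ioc (lam q / 2) 1, ENNReal.ofReal (c + min c (signedCoeff m v))) +
        ∫⁻ v in Set.Ioc (lam q / 2) 1, ENNReal.ofReal (c - min c (signedCoeff m v)) =
      ∫⁻ _ in Set.Ioc (lam q / 2) 1, ENNReal.ofReal (2 * c) := by
  have hmeas : Measurable fun v => ENNReal.ofReal (c + min c (signedCoeff m v)) :=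
    ((measurable_const.min
      (measurable_signedCoeff.comp measurable_prodMk_left)).const_add c).ennreal_ofReal
  rw [← lintegral_add_left hmeas]
  refine setLIntegral_congr_fun measurableSet_Ioc fun v hv => ?_
  have hnonneg : 0 ≤ signedCoeff m v := signedCoeff_nonneg hm (by linarith [hv.1])
  rw [← ENNReal.ofReal_add (add_nonneg hc (le_min hc hnonneg)) (sub_nonneg.2 (min_le_left _ _))]
  congr 1
  ring

theorem lintegral_section_profile (h : Admissible q α) (hc : 0 ≤ c) (hm : 0 ≤ m) :
    (∫⁻ _ in Set.Ioc 0 (lam q - 1), ENNReal.ofReal (2 * c)) +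
        (∫⁻ v in Set.Ioc (lam q - 1) (lam q / 2),
          ENNReal.ofReal (c + min c (signedCoeff m (lam q - v)))) +
        ∫⁻ v in Set.Ioc (lam q / 2) 1, ENNReal.ofReal (c - min c (signedCoeff m v)) =
      ENNReal.ofReal (lam q * c) := by
  have hone := h.one_lt_lam
  have htwo := h.lam_lt_two
  rw [setLIntegral_add_min_signedCoeff_flip, add_assoc,
    lintegral_add_min_add_lintegral_sub_min h.lam_pos.le hc hm, setLIntegral_const,
    setLIntegral_const, Real.volume_Ioc, Real.volume_Ioc, ← mul_add,
    ← ENNReal.ofReal_add (by linarith) (by linarith), ← ENNReal.ofReal_mul (by positivity)]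
  congr 1
  ring

theorem setLIntegral_Ioc_zero_one (h : Admissible q α) (f : ℝ → ENNReal) :
    ∫⁻ v in Set.Ioc 0 1, f v = (∫⁻ v in Set.Ioc 0 (lam q - 1), f v) +
      (∫⁻ v in Set.Ioc (lam q - 1) (lam q / 2), f v) + ∫⁻ v in Set.Ioc (lam q / 2) 1, f v := by
  have hone := h.one_lt_lam
  have htwo := h.lam_lt_two
  rw [← lintegral_union measurableSet_Ioc (Set.Ioc_disjoint_Ioc_of_le le_rfl),
    Set.Ioc_union_Ioc_eq_Ioc (by linarith) (by linarith),
    ← lintegral_union measurableSet_Ioc (Set.Ioc_disjoint_Ioc_of_le le_rfl),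
    Set.Ioc_union_Ioc_eq_Ioc (by linarith) (by linarith)]

theorem stairMeasure_smallCoeff_le (h : Admissible q α) (hc : 0 ≤ c) :
    stairMeasure q α (smallCoeff c) ≤ ENNReal.ofReal (lam q * c) := by
  have hq := h.four_le
  rw [stairMeasure_smallCoeff, ← h.lintegral_section_profile hc h.threshold_sub_two_nonneg,
    h.setLIntegral_Ioc_zero_one]
  refine add_le_add (add_le_add ?_ ?_) ?_ <;>
    refine setLIntegral_mono' measurableSet_Ioc fun v hv => ?_
  · exact h.sectionMass_le_two_mul hv
  · rw [← h.sub_max_signedCoeff_sub_three hv]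
    exact h.sectionMass_le (by omega) (h.mem_Ioc_height_sub_three hv)
  · rw [← h.ofReal_sub_max_signedCoeff_sub_two hc hv]
    exact h.sectionMass_le (by omega) (h.mem_Ioc_height_sub_two hv)

theorem stairMeasure_smallCoeff_of_le (h : Admissible q α) (hc : 0 ≤ c) (hcL : c ≤ L q α) :
    stairMeasure q α (smallCoeff c) = ENNReal.ofReal (lam q * c) := by
  have hq := h.four_le
  have hone := h.one_lt_lam
  have htwo := h.lam_lt_two
  refine le_antisymm (h.stairMeasure_smallCoeff_le hc) ?_
  rw [stairMeasure_smallCoeff, ← h.lintegral_section_profile hc h.threshold_sub_two_nonneg,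
    h.setLIntegral_Ioc_zero_one]
  refine add_le_add (add_le_add ?_ ?_) ?_ <;>
    refine setLIntegral_mono' measurableSet_Ioc fun v hv => ?_
  · exact h.two_mul_le_sectionMass hc hcL hv
  · rw [← h.sub_max_signedCoeff_sub_three hv]
    exact h.le_sectionMass (by omega) (h.mem_Ioc_height_sub_three hv)
      (h.le_signedCoeff_right hcL (by linarith [hv.1]) (by linarith [hv.2]))
  · rw [← h.ofReal_sub_max_signedCoeff_sub_two hc hv]
    exact h.le_sectionMass (by omega) (h.mem_Ioc_height_sub_two hv)
      (h.le_signedCoeff_right hcL (by linarith [hv.1]) hv.2)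

end HeightIntegral

end Admissible

end SmallCoeff

/-! ### Symmetries of invariant sets -/

section Transcendental

variable {K A : Type*} [Field K] [Field A] [Algebra K A] {x y : A}

theorem transcendental_ne_zero (hx : Transcendental K x) : x ≠ 0 := by
  rintro rfl
  exact hx isAlgebraic_zero

theorem transcendental_sub (hx : Transcendental K x) (hy : IsAlgebraic K y) :
    Transcendental K (x - y) := fun h => hx (by simpa using h.add hy)

theorem transcendental_neg (hx : Transcendental K x) : Transcendental K (-x) :=
  fun h => hx (by simpa using h.neg)

theorem transcendental_one_div (hx : Transcendental K x) : Transcendental K (1 / x) :=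
  fun h => hx (by simpa using h.inv)

theorem lam_mul_ne_two {q : ℕ} {x : ℝ} (hx : Transcendental ℚ x) : lam q * x ≠ 2 := by
  intro h
  have hl : lam q ≠ 0 := by
    intro hzero
    simp [hzero] at h
  refine hx ?_
  rw [eq_div_of_mul_eq hl ((mul_comm _ _).trans h), div_eq_mul_inv]
  exact (isAlgebraic_natCast 2).mul (isAlgebraic_lam q).inv

theorem transcendental_chainParam {q : ℕ} (hq : 3 ≤ q) {x : ℝ} (hx : Transcendental ℚ x)
    (hx1 : lam q / 2 ≤ x) (hx2 : lam q * x < 2) : Transcendental ℚ (chainParam (lam q) x) := by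
  intro ha
  have hden : 0 < 2 - lam q * x := sub_pos.2 hx2
  have hden' : 0 < 2 + lam q * chainParam (lam q) x := by
    have := mul_nonneg (lam_pos hq).le (chainParam_nonneg hx1 hx2)
    positivity
  have hparam : chainParam (lam q) x * (2 - lam q * x) = 2 * x - lam q :=
    div_mul_cancel₀ _ hden.ne'
  have hinv : x = (2 * chainParam (lam q) x + lam q) / (2 + lam q * chainParam (lam q) x) := by
    rw [eq_div_iff hden'.ne']
    linarith
  have htwo : IsAlgebraic ℚ (2 : ℝ) := isAlgebraic_natCast 2
  have hl := isAlgebraic_lam q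
  refine hx ?_
  rw [hinv, div_eq_mul_inv]
  exact ((htwo.mul ha).add hl).mul (htwo.add (hl.mul ha)).inv

end Transcendental

section ChainParam

variable {l x : ℝ}

theorem chainParam_one_div (hx : x ≠ 0) : chainParam l (1 / x) = 1 / chainParam l x := by
  rw [chainParam, chainParam, one_div_div]
  field_simp

theorem two_mul_sub_one_le_chainParam_sub_one (hl : 1 ≤ l) (hx : 1 ≤ x) (hlx : l * x < 2) :
    2 * (x - 1) ≤ chainParam l x - 1 := by
  rw [chainParam, le_sub_iff_add_le, le_div_iff₀ (sub_pos.2 hlx)]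
  nlinarith [mul_nonneg (sub_nonneg.2 hx) (sub_nonneg.2 hl),
    mul_nonneg (mul_nonneg (sub_nonneg.2 hx) (sub_nonneg.2 hx)) (by linarith : 0 ≤ l)]

end ChainParam

/-- Sets of reals that are invariant under the translation by `lam q` and that contain a point of
`[lam q * (α - 1), lam q * α)` precisely when they contain the reciprocal of its absolute value.
`T q α`-invariant sets pull back to such sets under `reduce q α`. -/
structure TailInvariant (q : ℕ) (α : ℝ) (D : Set ℝ) : Prop where
  add_lam : ∀ x, x + lam q ∈ D ↔ x ∈ D
  inv_of_lt : ∀ x, 0 < x → x < lam q * α → (x ∈ D ↔ 1 / x ∈ D)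
  neg_of_le : ∀ x, 0 < x → x ≤ lam q * (1 - α) → (-x ∈ D ↔ 1 / x ∈ D)

namespace TailInvariant

variable {q : ℕ} {α a x : ℝ} {D : Set ℝ}

theorem lam_sub (hD : TailInvariant q α D) (x : ℝ) : lam q - x ∈ D ↔ -x ∈ D := by
  rw [← hD.add_lam (-x), neg_add_eq_sub]

theorem sub_lam (hD : TailInvariant q α D) (x : ℝ) : x - lam q ∈ D ↔ x ∈ D := by
  rw [← hD.add_lam (x - lam q), sub_add_cancel]

theorem add_int_mul (hD : TailInvariant q α D) (x : ℝ) (n : ℤ) : x + n * lam q ∈ D ↔ x ∈ D := by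
  induction n using Int.induction_on with
  | zero => simp
  | succ n ih =>
    rw [← ih, ← hD.add_lam (x + ((n : ℤ) : ℝ) * lam q)]
    push_cast
    ring_nf
  | pred n ih =>
    rw [← ih, ← hD.sub_lam (x + ((-(n : ℤ) : ℤ) : ℝ) * lam q)]
    push_cast
    ring_nf

theorem neg_chain_even (hD : TailInvariant q α D) (ha : 0 ≤ a) {k : ℕ} (hk : 2 * k + 2 ≤ q)
    (hle : chain (lam q) a (2 * k) ≤ lam q * (1 - α)) :
    -chain (lam q) a (2 * k) ∈ D ↔ a ∈ D := by
  induction k with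
  | zero => simp [chain]
  | succ k ih =>
    have hpos := chain_add_two_pos ha (by omega : 2 * k + 4 ≤ q)
    have hmono := chain_le_add_two ha (by omega : 2 * k + 4 ≤ q)
    rw [show 2 * (k + 1) = 2 * k + 2 by ring] at *
    rw [hD.neg_of_le _ hpos hle, chain, one_div_one_div, hD.lam_sub,
      ih (by omega) (hmono.trans hle)]

theorem neg_chain_odd (hD : TailInvariant q α D) (ha : 0 < a) {k : ℕ} (hk : 2 * k + 3 ≤ q)
    (hle : chain (lam q) a (2 * k + 1) ≤ lam q * (1 - α)) :
    -chain (lam q) a (2 * k + 1) ∈ D ↔ 1 / a ∈ D := by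
  have hl := lam_pos (by omega : 3 ≤ q)
  induction k with
  | zero =>
    have hpos : 0 < chain (lam q) a 1 := by
      simp only [chain]
      positivity
    rw [Nat.mul_zero, zero_add] at *
    rw [hD.neg_of_le _ hpos hle, chain, one_div_div, ← hD.add_lam (1 / a),
      show (1 + lam q * a) / a = 1 / a + lam q by field_simp]
  | succ k ih =>
    have hpos := chain_add_two_pos ha.le (by omega : 2 * k + 1 + 4 ≤ q)
    have hmono := chain_le_add_two ha.le (by omega : 2 * k + 1 + 4 ≤ q)
    rw [show 2 * (k + 1) + 1 = 2 * k + 1 + 2 by ring] at *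
    rw [hD.neg_of_le _ hpos hle, chain, one_div_one_div, hD.lam_sub]
    exact ih (by omega) (hmono.trans hle)

theorem mem_iff_one_div_chainParam_mem (hD : TailInvariant q α D) (h : Admissible q α)
    (hx : Transcendental ℚ x) (hx1 : lam q / 2 ≤ x) (hx2 : x < lam q * α) :
    x ∈ D ↔ 1 / chainParam (lam q) x ∈ D := by
  have hq := h.four_le
  have hxpos : 0 < x := by linarith [h.lam_pos]
  have hlx : lam q * x < 2 := by nlinarith [h.lam_pos, h.lam_lt_two, h.right_le_one]
  have ha : 0 < chainParam (lam q) x := (chainParam_nonneg hx1 hlx).lt_of_ne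
    (transcendental_ne_zero (transcendental_chainParam (by omega) hx hx1 hlx)).symm
  have hinv : lam q * α ≤ 1 / x := by
    rw [le_div_iff₀ hxpos]
    nlinarith [h.right_le_one]
  obtain ⟨p, hp⟩ := h.even
  have hchain := hD.neg_chain_odd ha (k := p - 2) (by omega)
  rw [show 2 * (p - 2) + 1 = q - 3 by omega, chain_sub_three hq h.even hx1 hlx] at hchain
  rw [hD.inv_of_lt x hxpos hx2, ← hchain (by linarith), neg_sub, hD.sub_lam]

theorem lam_sub_mem_iff_chainParam_mem (hD : TailInvariant q α D) (h : Admissible q α)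
    (hx1 : lam q / 2 ≤ x) (hx2 : x < lam q * α) :
    lam q - x ∈ D ↔ chainParam (lam q) x ∈ D := by
  have hq := h.four_le
  have hone := h.one_lt_lam
  have hright := h.right_le_one
  have hlx : lam q * x < 2 := by nlinarith [h.lam_lt_two]
  have hpos : 0 < lam q - x := by linarith
  have hinv : lam q * α ≤ 1 / (lam q - x) := by
    rw [le_div_iff₀ hpos]
    nlinarith [h.right_pos, h.lam_lt_two]
  obtain ⟨p, hp⟩ := h.even
  have hlast : chain (lam q) (chainParam (lam q) x) (q - 4) = lam q - 1 / (lam q - x) := by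
    rw [← chain_sub_two (by omega) h.even hx1 hlx, show q - 2 = q - 4 + 2 by omega, chain,
      one_div_one_div, sub_sub_cancel]
  have hchain := hD.neg_chain_even (chainParam_nonneg hx1 hlx) (k := p - 2) (by omega)
  rw [show 2 * (p - 2) = q - 4 by omega, hlast] at hchain
  rw [hD.inv_of_lt (lam q - x) hpos (by linarith), ← hchain (by linarith), neg_sub, hD.sub_lam]

theorem lam_sub_mem_iff (hD : TailInvariant q α D) (h : Admissible q α)
    (hx : Transcendental ℚ x) (hx1 : lam q / 2 ≤ x) (hx2 : x < lam q * α) :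
    lam q - x ∈ D ↔ x ∈ D := by
  have hq := h.four_le
  have hlx : lam q * x < 2 := by nlinarith [h.lam_pos, h.lam_lt_two, h.right_le_one]
  have ha : 0 < chainParam (lam q) x := (chainParam_nonneg hx1 hlx).lt_of_ne
    (transcendental_ne_zero (transcendental_chainParam (by omega) hx hx1 hlx)).symm
  have hle : chainParam (lam q) x ≤ x :=
    chainParam_le_self h.lam_pos.le (by linarith [h.lam_pos]) (by linarith [h.right_le_one]) hlx
  rw [hD.lam_sub_mem_iff_chainParam_mem h hx1 hx2, hD.mem_iff_one_div_chainParam_mem h hx hx1 hx2,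
    hD.inv_of_lt _ ha (hle.trans_lt hx2)]

theorem neg_mem_iff_of_le (hD : TailInvariant q α D) (hα : 1 / 2 ≤ α) (hl : 0 ≤ lam q)
    (hx0 : 0 < x) (hx : x ≤ lam q * (1 - α)) : -x ∈ D ↔ x ∈ D := by
  have hright : lam q * (1 - α) ≤ lam q * α := by nlinarith
  rcases (hx.trans hright).eq_or_lt with heq | hlt
  · have hsymm : -x + lam q = x := by linarith
    rw [← hD.add_lam (-x), hsymm]
  · rw [hD.neg_of_le x hx0 hx, hD.inv_of_lt x hx0 hlt]

theorem neg_mem_iff_of_mem_Ico (hD : TailInvariant q α D) (h : Admissible q α)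
    (hx : Transcendental ℚ x) (hmem : x ∈ Set.Ico (lam q * (α - 1)) (lam q * α)) :
    -x ∈ D ↔ x ∈ D := by
  rcases lt_or_gt_of_ne (transcendental_ne_zero hx) with hneg | hpos
  · have hiff := hD.neg_mem_iff_of_le h.half_le h.lam_pos.le (neg_pos.2 hneg)
      (by linarith [hmem.1])
    rw [neg_neg] at hiff
    exact hiff.symm
  rcases le_or_gt x (lam q * (1 - α)) with hle | hgt
  · exact hD.neg_mem_iff_of_le h.half_le h.lam_pos.le hpos hle
  rw [← hD.lam_sub]
  rcases le_or_gt (lam q / 2) x with hhalf | hhalf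
  · exact hD.lam_sub_mem_iff h hx hhalf hmem.2
  · have htrans : Transcendental ℚ (lam q - x) := by
      rw [← neg_sub]
      exact transcendental_neg (transcendental_sub hx (isAlgebraic_lam q))
    have hiff := hD.lam_sub_mem_iff h htrans (by linarith) (by linarith)
    rw [sub_sub_cancel] at hiff
    exact hiff.symm

theorem neg_mem_iff (hD : TailInvariant q α D) (h : Admissible q α) (hx : Transcendental ℚ x) :
    -x ∈ D ↔ x ∈ D := by
  obtain ⟨n, hn, -⟩ := existsUnique_sub_zsmul_mem_Ico h.lam_pos x (lam q * (α - 1))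
  simp only [zsmul_eq_mul] at hn
  have htrans : Transcendental ℚ (x - n * lam q) :=
    transcendental_sub hx ((isAlgebraic_intCast n).mul (isAlgebraic_lam q))
  have hmem : x ∈ D ↔ x - n * lam q ∈ D := by
    rw [← hD.add_int_mul (x - n * lam q) n, sub_add_cancel]
  have hneg : -x ∈ D ↔ -(x - n * lam q) ∈ D := by
    rw [← hD.add_int_mul (-x) n, neg_sub, neg_add_eq_sub]
  rw [hmem, hneg]
  exact hD.neg_mem_iff_of_mem_Ico h htrans ⟨hn.1, hn.2.trans_eq (by ring)⟩

theorem mem_iff_chainParam_mem (hD : TailInvariant q α D) (h : Admissible q α)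
    (hx1 : lam q * α ≤ x) (hx2 : lam q * x < 2) : x ∈ D ↔ chainParam (lam q) x ∈ D := by
  have hq := h.four_le
  have hhalf := h.half_lam_le.trans hx1
  obtain ⟨p, hp⟩ := h.even
  have hchain := hD.neg_chain_even (chainParam_nonneg hhalf hx2) (k := p - 1) (by omega)
  rw [show 2 * (p - 1) = q - 2 by omega, chain_sub_two (by omega) h.even hhalf hx2] at hchain
  rw [← hchain (by linarith), neg_sub, hD.sub_lam]

theorem one_div_mem_iff_of_lt (hD : TailInvariant q α D) (hright : 0 < lam q * α)
    (hx : 1 / (lam q * α) < x) : 1 / x ∈ D ↔ x ∈ D := by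
  have hxpos : 0 < x := lt_trans (by positivity) hx
  have hlt : 1 / x < lam q * α := (one_div_lt hright hxpos).1 hx
  have hiff := hD.inv_of_lt (1 / x) (by positivity) hlt
  rwa [one_div_one_div] at hiff

/- `chainParam` pushes the points of `(1, 2 / lam q)` away from the fixed point `1`, at least
doubling the distance, until they are covered by the defining property of `D`. -/
theorem one_div_mem_iff_of_lt_pow (hD : TailInvariant q α D) (h : Admissible q α) (n : ℕ)
    (hx : Transcendental ℚ x) (hx1 : 1 < x) (hn : 1 / (lam q * α) < 1 + 2 ^ n * (x - 1)) :
    1 / x ∈ D ↔ x ∈ D := by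
  have hq := h.four_le
  have hright := h.right_pos
  induction n generalizing x with
  | zero => exact hD.one_div_mem_iff_of_lt hright (by linarith)
  | succ n ih =>
    rcases lt_or_ge (1 / (lam q * α)) x with hlt | hge
    · exact hD.one_div_mem_iff_of_lt hright hlt
    have hxpos : 0 < x := one_pos.trans hx1
    have hxinv : lam q * α ≤ 1 / x := (le_one_div hxpos hright).1 hge
    have hlx : lam q * x < 2 := by
      refine lt_of_le_of_ne ?_ (lam_mul_ne_two hx)
      rw [le_div_iff₀ hright] at hge
      nlinarith [h.half_lam_le]
    have hlx' : lam q * (1 / x) < 2 := by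
      rw [mul_one_div, div_lt_iff₀ hxpos]
      linarith [h.lam_lt_two]
    have hexpand := two_mul_sub_one_le_chainParam_sub_one h.one_lt_lam.le hx1.le hlx
    rw [hD.mem_iff_chainParam_mem h hxinv hlx',
      hD.mem_iff_chainParam_mem h (by linarith [h.right_le_one]) hlx, chainParam_one_div hxpos.ne']
    refine ih (transcendental_chainParam (by omega) hx (by linarith [h.lam_lt_two]) hlx)
      (by linarith) (hn.trans_le ?_)
    rw [pow_succ, mul_assoc]
    gcongr

theorem one_div_mem_iff_of_one_lt (hD : TailInvariant q α D) (h : Admissible q α)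
    (hx : Transcendental ℚ x) (hx1 : 1 < x) : 1 / x ∈ D ↔ x ∈ D := by
  obtain ⟨n, hn⟩ := pow_unbounded_of_one_lt (1 / (lam q * α) / (x - 1)) (one_lt_two (α := ℝ))
  rw [div_lt_iff₀ (by linarith)] at hn
  exact hD.one_div_mem_iff_of_lt_pow h n hx hx1 (by linarith)

theorem one_div_mem_iff_of_pos (hD : TailInvariant q α D) (h : Admissible q α)
    (hx : Transcendental ℚ x) (hx0 : 0 < x) : 1 / x ∈ D ↔ x ∈ D := by
  rcases lt_trichotomy x 1 with hlt | rfl | hgt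
  · have hiff := hD.one_div_mem_iff_of_one_lt h (transcendental_one_div hx)
      (one_lt_one_div hx0 hlt)
    rw [one_div_one_div] at hiff
    exact hiff.symm
  · rw [one_div_one]
  · exact hD.one_div_mem_iff_of_one_lt h hx hgt

theorem one_div_mem_iff (hD : TailInvariant q α D) (h : Admissible q α)
    (hx : Transcendental ℚ x) : 1 / x ∈ D ↔ x ∈ D := by
  rcases lt_or_gt_of_ne (transcendental_ne_zero hx) with hneg | hpos
  · have hiff := hD.one_div_mem_iff_of_pos h (transcendental_neg hx) (neg_pos.2 hneg)
    rwa [div_neg, hD.neg_mem_iff h hx, hD.neg_mem_iff h (transcendental_one_div hx)] at hiff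
  · exact hD.one_div_mem_iff_of_pos h hx hpos

end TailInvariant

/-! ### Convergents -/

/-- The points of `[λ(α - 1), λα)` with an infinite expansion, for which all the convergents are
meaningful. -/
def infiniteExpansion (q : ℕ) (α : ℝ) : Set ℝ :=
  {x | x ∈ Set.Ico (lam q * (α - 1)) (lam q * α) ∧ ∀ n, (T q α)^[n] x ≠ 0}

section InfiniteExpansion

variable {q : ℕ} {α x : ℝ}

theorem transcendental_T (hx : Transcendental ℚ x) : Transcendental ℚ (T q α x) := by
  rw [T, if_neg (transcendental_ne_zero hx)]
  refine transcendental_sub ?_ ((isAlgebraic_lam q).mul (isAlgebraic_intCast _))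
  rcases abs_choice (1 / x) with h | h <;> rw [h]
  · exact transcendental_one_div hx
  · exact transcendental_neg (transcendental_one_div hx)

theorem transcendental_iterate_T (hx : Transcendental ℚ x) (n : ℕ) :
    Transcendental ℚ ((T q α)^[n] x) := by
  induction n with
  | zero => exact hx
  | succ n ih =>
    rw [Function.iterate_succ_apply']
    exact transcendental_T ih

theorem mem_infiniteExpansion_of_transcendental
    (hx : x ∈ Set.Ico (lam q * (α - 1)) (lam q * α)) (htr : Transcendental ℚ x) :
    x ∈ infiniteExpansion q α :=
  ⟨hx, fun n => transcendental_ne_zero (transcendental_iterate_T htr n)⟩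

theorem iterate_T_mem (hl : 0 < lam q) (hx : x ∈ infiniteExpansion q α) (n : ℕ) :
    (T q α)^[n] x ∈ Set.Ico (lam q * (α - 1)) (lam q * α) := by
  cases n with
  | zero => exact hx.1
  | succ n =>
    rw [Function.iterate_succ_apply']
    exact T_mem hl (hx.2 n)

theorem iterate_T_mem_infiniteExpansion (hl : 0 < lam q) (hx : x ∈ infiniteExpansion q α) (n : ℕ) :
    (T q α)^[n] x ∈ infiniteExpansion q α :=
  ⟨iterate_T_mem hl hx n, fun m => by rw [← Function.iterate_add_apply]; exact hx.2 _⟩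

theorem iterate_natExt_fst (z : ℝ × ℝ) (n : ℕ) :
    ((natExt q α)^[n] z).1 = (T q α)^[n] z.1 := by
  induction n with
  | zero => rfl
  | succ n ih =>
    rw [Function.iterate_succ_apply', Function.iterate_succ_apply', ← ih]
    rfl

theorem iterate_natExt_succ_snd (z : ℝ × ℝ) (n : ℕ) :
    ((natExt q α)^[n + 1] z).2 = 1 / (digit q α ((T q α)^[n] z.1) * lam q +
      Real.sign ((T q α)^[n] z.1) * ((natExt q α)^[n] z).2) := by
  rw [Function.iterate_succ_apply', natExt, iterate_natExt_fst]

namespace Admissible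

theorem mk_zero_mem_stair (h : Admissible q α)
    (hx : x ∈ Set.Ico (lam q * (α - 1)) (lam q * α)) : (x, (0 : ℝ)) ∈ stair q α :=
  ⟨hx, le_rfl, zero_le_one, fun j hj _ => h.height_mono (Nat.zero_le j) (by omega)⟩

variable {z : ℝ × ℝ}

theorem iterate_natExt_mem (h : Admissible q α) (hz : z ∈ stair q α)
    (hx : z.1 ∈ infiniteExpansion q α) (n : ℕ) : (natExt q α)^[n] z ∈ stair q α := by
  induction n with
  | zero => exact hz
  | succ n ih =>
    rw [Function.iterate_succ_apply']
    refine h.natExt_mem ih ?_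
    rw [iterate_natExt_fst]
    exact hx.2 n

theorem one_le_iterate_natExt_den (h : Admissible q α) (hz : z ∈ stair q α)
    (hx : z.1 ∈ infiniteExpansion q α) (n : ℕ) :
    1 ≤ digit q α ((T q α)^[n] z.1) * lam q +
      Real.sign ((T q α)^[n] z.1) * ((natExt q α)^[n] z).2 := by
  rw [← iterate_natExt_fst]
  refine h.one_le_natExt_den (h.iterate_natExt_mem hz hx n) ?_
  rw [iterate_natExt_fst]
  exact hx.2 n

theorem iterate_natExt_snd_mul_le (h : Admissible q α) (hz : z ∈ stair q α)
    (hx : z.1 ∈ infiniteExpansion q α) (n : ℕ) :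
    ((natExt q α)^[n] z).2 * ((natExt q α)^[n + 1] z).2 ≤ rate q := by
  rw [Function.iterate_succ_apply']
  refine h.mul_natExt_snd_le (h.iterate_natExt_mem hz hx n) ?_
  rw [iterate_natExt_fst]
  exact hx.2 n

end Admissible

end InfiniteExpansion

section Convergents

variable {q : ℕ} {α x : ℝ}

theorem S_zero (x : ℝ) : S q α x 0 = 1 := rfl

theorem S_one (x : ℝ) : S q α x 1 = digit q α x * lam q := by
  simp [S, dig]

theorem S_add_two (x : ℝ) (n : ℕ) : S q α x (n + 2) =
    digit q α ((T q α)^[n + 1] x) * lam q * S q α x (n + 1) +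
      Real.sign ((T q α)^[n + 1] x) * S q α x n := rfl

theorem R_zero (x : ℝ) : R q α x 0 = 0 := rfl

theorem R_one (x : ℝ) : R q α x 1 = Real.sign x := by
  simp [R, eps]

theorem R_add_two (x : ℝ) (n : ℕ) : R q α x (n + 2) =
    digit q α ((T q α)^[n + 1] x) * lam q * R q α x (n + 1) +
      Real.sign ((T q α)^[n + 1] x) * R q α x n := rfl

theorem abs_R_mul_S_sub (hx : ∀ n, (T q α)^[n] x ≠ 0) (n : ℕ) :
    |R q α x n * S q α x (n + 1) - R q α x (n + 1) * S q α x n| = 1 := by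
  induction n with
  | zero =>
    rw [R_zero, R_one, S_zero, zero_mul, zero_sub, mul_one, abs_neg]
    exact abs_sign (hx 0)
  | succ n ih =>
    have hstep : R q α x (n + 1) * S q α x (n + 2) - R q α x (n + 2) * S q α x (n + 1) =
        -Real.sign ((T q α)^[n + 1] x) *
          (R q α x n * S q α x (n + 1) - R q α x (n + 1) * S q α x n) := by
      rw [R_add_two, S_add_two]
      ring
    rw [hstep, abs_mul, ih, abs_neg, abs_sign (hx (n + 1)), mul_one]

theorem mul_S_add_eq_R_add (hx : ∀ n, (T q α)^[n] x ≠ 0) (n : ℕ) :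
    x * (S q α x (n + 1) + S q α x n * (T q α)^[n + 1] x) =
      R q α x (n + 1) + R q α x n * (T q α)^[n + 1] x := by
  induction n with
  | zero =>
    have hx0 : x ≠ 0 := hx 0
    rw [R_zero, R_one, S_zero, S_one, zero_add, Function.iterate_one, T_eq_sign_div hx0]
    field_simp
    ring
  | succ n ih =>
    have ht := hx (n + 1)
    rw [R_add_two, S_add_two, Function.iterate_succ_apply' _ (n + 1), T_eq_sign_div ht]
    set t := (T q α)^[n + 1] x
    have hscaled := congrArg (fun y => y * (Real.sign t / t)) ih
    field_simp at hscaled ⊢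
    linear_combination hscaled

namespace Admissible

theorem S_succ_mul_iterate_natExt_snd (h : Admissible q α) (hx : x ∈ infiniteExpansion q α)
    (n : ℕ) : S q α x (n + 1) * ((natExt q α)^[n + 1] (x, 0)).2 = S q α x n := by
  have hden := h.one_le_iterate_natExt_den (h.mk_zero_mem_stair hx.1) hx
  induction n with
  | zero =>
    have hden0 := hden 0
    rw [iterate_natExt_succ_snd]
    simp only [Function.iterate_zero, id, mul_zero, add_zero, zero_add] at hden0 ⊢
    rw [S_one, S_zero]
    exact mul_one_div_cancel (by linarith)
  | succ n ih =>
    have hfactor : S q α x (n + 2) = S q α x (n + 1) * (digit q α ((T q α)^[n + 1] x) * lam q +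
        Real.sign ((T q α)^[n + 1] x) * ((natExt q α)^[n + 1] (x, 0)).2) := by
      rw [S_add_two, ← ih]
      ring
    rw [iterate_natExt_succ_snd, hfactor, mul_assoc, mul_one_div_cancel, mul_one]
    exact (zero_lt_one.trans_le (hden (n + 1))).ne'

theorem S_pos (h : Admissible q α) (hx : x ∈ infiniteExpansion q α) (n : ℕ) : 0 < S q α x n := by
  induction n with
  | zero => exact zero_lt_one
  | succ n ih =>
    have hmem := h.iterate_natExt_mem (h.mk_zero_mem_stair hx.1) hx (n + 1)
    rw [← h.S_succ_mul_iterate_natExt_snd hx n] at ih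
    exact pos_of_mul_pos_left ih hmem.2.1

theorem monotone_S (h : Admissible q α) (hx : x ∈ infiniteExpansion q α) :
    Monotone (S q α x) := by
  refine monotone_nat_of_le_succ fun n => ?_
  have hmem := h.iterate_natExt_mem (h.mk_zero_mem_stair hx.1) hx (n + 1)
  rw [← h.S_succ_mul_iterate_natExt_snd hx n]
  exact mul_le_of_le_one_right (h.S_pos hx _).le hmem.2.2.1

theorem S_le_rate_mul (h : Admissible q α) (hx : x ∈ infiniteExpansion q α) (n : ℕ) :
    S q α x n ≤ rate q * S q α x (n + 2) := by
  have hcontract := h.iterate_natExt_snd_mul_le (h.mk_zero_mem_stair hx.1) hx (n + 1)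
  rw [← h.S_succ_mul_iterate_natExt_snd hx n, ← h.S_succ_mul_iterate_natExt_snd hx (n + 1)]
  nlinarith [h.S_pos hx (n + 2)]

theorem tendsto_S (h : Admissible q α) (hx : x ∈ infiniteExpansion q α) :
    Tendsto (S q α x) atTop atTop := by
  have hrate := rate_pos (by linarith [h.four_le] : 3 ≤ q)
  have hpow : ∀ n, (rate q)⁻¹ ^ n ≤ S q α x (2 * n) := by
    intro n
    induction n with
    | zero => simp [S_zero]
    | succ n ih =>
      rw [pow_succ, mul_comm, inv_mul_le_iff₀ hrate]
      exact ih.trans (h.S_le_rate_mul hx (2 * n))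
  refine tendsto_atTop_atTop_of_monotone (h.monotone_S hx) fun b => ?_
  obtain ⟨n, hn⟩ := pow_unbounded_of_one_lt b ((one_lt_inv₀ hrate).2 (rate_lt_one h.four_le))
  exact ⟨2 * n, hn.le.trans (hpow n)⟩

theorem Theta_succ_eq_coeff (h : Admissible q α) (hx : x ∈ infiniteExpansion q α) (n : ℕ) :
    Theta q α x (n + 1) = coeff ((natExt q α)^[n + 1] (x, 0)) := by
  have hquot := h.S_succ_mul_iterate_natExt_snd hx n
  have hS := h.S_pos hx (n + 1)
  have hmobius := mul_S_add_eq_R_add hx.2 n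
  have hmem := h.iterate_natExt_mem (h.mk_zero_mem_stair hx.1) hx (n + 1)
  have hpos := h.one_add_mul_pos hmem.1.1 hmem.2.1 hmem.2.2.1
  rw [coeff]
  rw [iterate_natExt_fst] at hpos ⊢
  set t := (T q α)^[n + 1] x
  set v := ((natExt q α)^[n + 1] (x, 0)).2
  have herror : x - R q α x (n + 1) / S q α x (n + 1) =
      t * (R q α x n * S q α x (n + 1) - R q α x (n + 1) * S q α x n) /
        (S q α x (n + 1) ^ 2 * (1 + t * v)) := by
    rw [← hquot] at hmobius ⊢
    rw [eq_div_iff (by positivity)]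
    field_simp
    linear_combination hmobius
  rw [Theta, herror, abs_div, abs_mul, abs_R_mul_S_sub hx.2,
    abs_of_pos (by positivity : 0 < S q α x (n + 1) ^ 2 * (1 + t * v))]
  field_simp

theorem Theta_eq_coeff (h : Admissible q α) (hx : x ∈ infiniteExpansion q α) :
    ∀ n, Theta q α x n = coeff ((natExt q α)^[n] (x, 0))
  | 0 => by simp [Theta, R_zero, S_zero, coeff]
  | n + 1 => h.Theta_succ_eq_coeff hx n

end Admissible

end Convergents

/-! ### Ergodicity -/

/-- The representative modulo `lam q` in the fundamental interval `[λ(α - 1), λα)`. -/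
noncomputable def reduce (q : ℕ) (α y : ℝ) : ℝ := y - lam q * ⌊y / lam q + 1 - α⌋

section Reduce

variable {q : ℕ} {α : ℝ}

theorem measurable_reduce : Measurable (reduce q α) :=
  measurable_id.sub (measurable_const.mul (measurable_from_top.comp
    (Int.measurable_floor.comp (((measurable_id.div_const _).add_const 1).sub_const α))))

theorem T_eq_reduce (hl : 0 < lam q) {t : ℝ} (ht : t ≠ 0) : T q α t = reduce q α (1 / |t|) := by
  rw [T, if_neg ht, digit_eq_floor hl, abs_div, abs_one, reduce]

theorem reduce_of_mem (hl : 0 < lam q) {t : ℝ}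
    (ht : t ∈ Set.Ico (lam q * (α - 1)) (lam q * α)) : reduce q α t = t := by
  have hlower : α - 1 ≤ t / lam q := (le_div_iff₀ hl).2 (by linarith [ht.1])
  have hupper : t / lam q < α := (div_lt_iff₀ hl).2 (by linarith [ht.2])
  have hfloor : ⌊t / lam q + 1 - α⌋ = 0 :=
    Int.floor_eq_zero_iff.2 ⟨by linarith, by linarith⟩
  rw [reduce, hfloor, Int.cast_zero, mul_zero, sub_zero]

theorem reduce_add_lam (hl : lam q ≠ 0) (x : ℝ) : reduce q α (x + lam q) = reduce q α x := by
  have hshift : (x + lam q) / lam q + 1 - α = x / lam q + 1 - α + 1 := by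
    rw [add_div, div_self hl]
    ring
  rw [reduce, hshift, Int.floor_add_one, reduce]
  push_cast
  ring

theorem Admissible.tailInvariant_preimage_reduce (h : Admissible q α) {A : Set ℝ}
    (hA : T q α ⁻¹' A = A) : TailInvariant q α (reduce q α ⁻¹' A) := by
  have hl := h.lam_pos
  have hleft : lam q * (α - 1) < 0 := by linarith [h.right_le_one, h.one_lt_lam]
  have hiff : ∀ t, t ≠ 0 → t ∈ Set.Ico (lam q * (α - 1)) (lam q * α) →
      (t ∈ reduce q α ⁻¹' A ↔ 1 / |t| ∈ reduce q α ⁻¹' A) := by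
    intro t ht0 ht
    rw [Set.mem_preimage, Set.mem_preimage, reduce_of_mem hl ht, ← T_eq_reduce hl ht0,
      ← Set.mem_preimage, hA]
  refine ⟨fun x => ?_, fun x hx0 hx => ?_, fun x hx0 hx => ?_⟩
  · rw [Set.mem_preimage, Set.mem_preimage, reduce_add_lam hl.ne']
  · rw [hiff x hx0.ne' ⟨by linarith, hx⟩, abs_of_pos hx0]
  · rw [hiff (-x) (by linarith) ⟨by linarith, by linarith [h.right_pos]⟩, abs_neg, abs_of_pos hx0]

end Reduce

theorem transcendental_sign_div {q : ℕ} {s t : ℝ} (hs : s ≠ 0) (ht : Transcendental ℚ t) (d : ℤ) :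
    Transcendental ℚ (Real.sign s / (d * lam q + t)) := by
  have hadd : Transcendental ℚ (d * lam q + t) := by
    rw [add_comm, ← sub_neg_eq_add]
    exact transcendental_sub ht ((isAlgebraic_intCast d).mul (isAlgebraic_lam q)).neg
  have hinv := transcendental_one_div hadd
  rcases Real.sign_apply_eq_of_ne_zero s hs with hsign | hsign <;> rw [hsign]
  · rw [neg_div]
    exact transcendental_neg hinv
  · exact hinv

/-- The Möbius map `t ↦ (R_{n+1} + R_n t) / (S_{n+1} + S_n t)`, the inverse branch of
`T_α^{n+1}` on the points that share their first `n + 1` digits with `x`. -/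
noncomputable def convergentMap (q : ℕ) (α x : ℝ) (n : ℕ) (t : ℝ) : ℝ :=
  (R q α x (n + 1) + R q α x n * t) / (S q α x (n + 1) + S q α x n * t)

/-- A bound for the distance from `x` to the values of `convergentMap q α x n`. -/
noncomputable def convergentRadius (q : ℕ) (α x : ℝ) (n : ℕ) : ℝ :=
  lam q / (1 - lam q / 2) ^ 2 / S q α x (n + 1) ^ 2

namespace TailInvariant

variable {q : ℕ} {α t : ℝ} {D : Set ℝ}

theorem sign_div_mem_iff (hD : TailInvariant q α D) (h : Admissible q α) {s : ℝ} (hs : s ≠ 0)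
    (ht : Transcendental ℚ t) (d : ℤ) : Real.sign s / (d * lam q + t) ∈ D ↔ t ∈ D := by
  have hadd : Transcendental ℚ (t + d * lam q) := by
    rw [← sub_neg_eq_add]
    exact transcendental_sub ht ((isAlgebraic_intCast d).mul (isAlgebraic_lam q)).neg
  have hinv : 1 / (t + d * lam q) ∈ D ↔ t ∈ D := by
    rw [hD.one_div_mem_iff h hadd, hD.add_int_mul]
  rw [add_comm]
  rcases Real.sign_apply_eq_of_ne_zero s hs with hsign | hsign <;> rw [hsign]
  · rw [neg_div, hD.neg_mem_iff h (transcendental_one_div hadd), hinv]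
  · exact hinv

theorem convergentMap_mem_iff (hD : TailInvariant q α D) (h : Admissible q α) {x : ℝ}
    (hx : ∀ n, (T q α)^[n] x ≠ 0) (n : ℕ) (ht : Transcendental ℚ t) :
    convergentMap q α x n t ∈ D ↔ t ∈ D := by
  induction n generalizing t with
  | zero =>
    rw [convergentMap, R_zero, R_one, S_zero, S_one, zero_mul, add_zero, one_mul]
    exact hD.sign_div_mem_iff h (hx 0) ht _
  | succ n ih =>
    have hs := hx (n + 1)
    set s := (T q α)^[n + 1] x with hs_def
    have htr := transcendental_sign_div (q := q) hs ht (digit q α s)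
    have hden : digit q α s * lam q + t ≠ 0 := fun hzero =>
      transcendental_ne_zero htr (by rw [hzero, div_zero])
    rw [← hD.sign_div_mem_iff h hs ht (digit q α s), ← ih htr]
    suffices hstep : convergentMap q α x (n + 1) t =
        convergentMap q α x n (Real.sign s / (digit q α s * lam q + t)) by rw [hstep]
    rw [convergentMap, convergentMap, R_add_two, S_add_two, ← hs_def]
    symm
    rw [← mul_div_mul_left _ _ hden]
    congr 1 <;> · field_simp; ring

end TailInvariant

theorem ae_transcendental : ∀ᵐ x : ℝ, Transcendental ℚ x := by
  have hcompl : {x : ℝ | Transcendental ℚ x}ᶜ = {x : ℝ | IsAlgebraic ℚ x} := by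
    ext x
    simp [Transcendental]
  rw [ae_iff]
  exact (congrArg _ hcompl).trans ((Algebraic.countable ℚ ℝ).measure_zero volume)

namespace Admissible

variable {q : ℕ} {α x s t : ℝ}

theorem mul_S_succ_le_S_add (h : Admissible q α) (hx : x ∈ infiniteExpansion q α) (n : ℕ)
    (ht : lam q * (α - 1) ≤ t) :
    (1 - lam q / 2) * S q α x (n + 1) ≤ S q α x (n + 1) + S q α x n * t := by
  obtain ⟨-, hv0, hv1, -⟩ := h.iterate_natExt_mem (h.mk_zero_mem_stair hx.1) hx (n + 1)
  rw [← h.S_succ_mul_iterate_natExt_snd hx n]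
  nlinarith [h.le_one_add_mul ht hv0 hv1, h.S_pos hx (n + 1)]

theorem S_add_pos (h : Admissible q α) (hx : x ∈ infiniteExpansion q α) (n : ℕ)
    (ht : lam q * (α - 1) ≤ t) : 0 < S q α x (n + 1) + S q α x n * t :=
  (mul_pos (by linarith [h.lam_lt_two]) (h.S_pos hx _)).trans_le (h.mul_S_succ_le_S_add hx n ht)

theorem S_add_le (h : Admissible q α) (hx : x ∈ infiniteExpansion q α) (n : ℕ)
    (ht : t ≤ lam q * α) : S q α x (n + 1) + S q α x n * t ≤ 2 * S q α x (n + 1) := by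
  have hmono := h.monotone_S hx (Nat.le_succ n)
  nlinarith [h.S_pos hx n, ht.trans h.right_le_one]

theorem convergentMap_sub (h : Admissible q α) (hx : x ∈ infiniteExpansion q α) (n : ℕ)
    (hs : lam q * (α - 1) ≤ s) (ht : lam q * (α - 1) ≤ t) :
    convergentMap q α x n s - convergentMap q α x n t =
      (R q α x n * S q α x (n + 1) - R q α x (n + 1) * S q α x n) * (s - t) /
        ((S q α x (n + 1) + S q α x n * s) * (S q α x (n + 1) + S q α x n * t)) := by
  rw [convergentMap, convergentMap,
    div_sub_div _ _ (h.S_add_pos hx n hs).ne' (h.S_add_pos hx n ht).ne']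
  congr 1
  ring

theorem abs_convergentMap_sub (h : Admissible q α) (hx : x ∈ infiniteExpansion q α) (n : ℕ)
    (hs : lam q * (α - 1) ≤ s) (ht : lam q * (α - 1) ≤ t) :
    |convergentMap q α x n s - convergentMap q α x n t| = |s - t| /
      ((S q α x (n + 1) + S q α x n * s) * (S q α x (n + 1) + S q α x n * t)) := by
  rw [h.convergentMap_sub hx n hs ht, abs_div, abs_mul, abs_R_mul_S_sub hx.2, one_mul,
    abs_of_pos (mul_pos (h.S_add_pos hx n hs) (h.S_add_pos hx n ht))]

theorem injOn_convergentMap (h : Admissible q α) (hx : x ∈ infiniteExpansion q α) (n : ℕ) :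
    Set.InjOn (convergentMap q α x n) (Set.Ici (lam q * (α - 1))) := by
  intro s hs t ht hst
  have hpos := mul_pos (h.S_add_pos hx n hs) (h.S_add_pos hx n ht)
  have hsub := h.abs_convergentMap_sub hx n hs ht
  rw [hst, sub_self, abs_zero, eq_comm, div_eq_zero_iff, or_iff_left hpos.ne'] at hsub
  exact sub_eq_zero.1 (abs_eq_zero.1 hsub)

theorem convergentMap_iterate_T (h : Admissible q α) (hx : x ∈ infiniteExpansion q α) (n : ℕ) :
    convergentMap q α x n ((T q α)^[n + 1] x) = x := by
  rw [convergentMap, div_eq_iff (h.S_add_pos hx n (iterate_T_mem h.lam_pos hx _).1).ne']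
  exact (mul_S_add_eq_R_add hx.2 n).symm

theorem convergentRadius_pos (h : Admissible q α) (hx : x ∈ infiniteExpansion q α) (n : ℕ) :
    0 < convergentRadius q α x n :=
  div_pos (div_pos h.lam_pos (pow_pos (by linarith [h.lam_lt_two]) 2)) (pow_pos (h.S_pos hx _) 2)

theorem tendsto_convergentRadius (h : Admissible q α) (hx : x ∈ infiniteExpansion q α) :
    Tendsto (convergentRadius q α x) atTop (𝓝[>] 0) :=
  tendsto_nhdsWithin_iff.2 ⟨tendsto_const_nhds.div_atTop ((tendsto_pow_atTop two_ne_zero).comp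
    ((tendsto_add_atTop_iff_nat 1).2 (h.tendsto_S hx))),
    Eventually.of_forall (h.convergentRadius_pos hx)⟩

theorem convergentMap_mem_closedBall (h : Admissible q α) (hx : x ∈ infiniteExpansion q α) (n : ℕ)
    (ht : t ∈ Set.Ico (lam q * (α - 1)) (lam q * α)) :
    convergentMap q α x n t ∈ Metric.closedBall x (convergentRadius q α x n) := by
  have hy := iterate_T_mem h.lam_pos hx (n + 1)
  have hdist : |t - (T q α)^[n + 1] x| ≤ lam q := by
    rw [abs_sub_le_iff]
    constructor <;> linarith [ht.1, ht.2, hy.1, hy.2]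
  have hsub := h.abs_convergentMap_sub hx n ht.1 hy.1
  rw [h.convergentMap_iterate_T hx] at hsub
  have hS : 0 < (1 - lam q / 2) * S q α x (n + 1) :=
    mul_pos (by linarith [h.lam_lt_two]) (h.S_pos hx _)
  rw [Metric.mem_closedBall, Real.dist_eq, hsub, convergentRadius, div_div, ← mul_pow, sq]
  have hnonneg := hS.le.trans (h.mul_S_succ_le_S_add hx n ht.1)
  have hl := h.lam_pos
  gcongr
  · exact h.mul_S_succ_le_S_add hx n ht.1
  · exact h.mul_S_succ_le_S_add hx n hy.1

theorem hasDerivAt_convergentMap (h : Admissible q α) (hx : x ∈ infiniteExpansion q α) (n : ℕ)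
    (ht : lam q * (α - 1) ≤ t) :
    HasDerivAt (convergentMap q α x n)
      ((R q α x n * S q α x (n + 1) - R q α x (n + 1) * S q α x n) /
        (S q α x (n + 1) + S q α x n * t) ^ 2) t := by
  have hlinear : ∀ a b : ℝ, HasDerivAt (fun t : ℝ => a + b * t) b t := fun a b => by
    simpa using ((hasDerivAt_id t).const_mul b).const_add a
  have hdiv := (hlinear (R q α x (n + 1)) (R q α x n)).fun_div
    (hlinear (S q α x (n + 1)) (S q α x n)) (h.S_add_pos hx n ht).ne'
  rwa [show R q α x n * (S q α x (n + 1) + S q α x n * t) -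
    (R q α x (n + 1) + R q α x n * t) * S q α x n =
    R q α x n * S q α x (n + 1) - R q α x (n + 1) * S q α x n by ring] at hdiv

theorem mul_volume_le_volume_image_convergentMap (h : Admissible q α)
    (hx : x ∈ infiniteExpansion q α) (n : ℕ) {E : Set ℝ} (hE : MeasurableSet E)
    (hsub : E ⊆ Set.Ico (lam q * (α - 1)) (lam q * α)) :
    ENNReal.ofReal (1 / (4 * S q α x (n + 1) ^ 2)) * volume E ≤
      volume (convergentMap q α x n '' E) := by
  have hS := h.S_pos hx (n + 1)
  rw [← setLIntegral_one (convergentMap q α x n '' E),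
    lintegral_image_eq_lintegral_abs_deriv_mul hE
    (fun t ht => (h.hasDerivAt_convergentMap hx n (hsub ht).1).hasDerivWithinAt)
    ((h.injOn_convergentMap hx n).mono fun t ht => (hsub ht).1), ← setLIntegral_const]
  refine setLIntegral_mono' hE fun t ht => ?_
  have hpos := h.S_add_pos hx n (hsub ht).1
  have hle := h.S_add_le hx n (hsub ht).2.le
  rw [mul_one, abs_div, abs_R_mul_S_sub hx.2, abs_of_pos (by positivity)]
  refine ENNReal.ofReal_le_ofReal (one_div_le_one_div_of_le (by positivity) ?_)
  nlinarith

end Admissible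

namespace TailInvariant

variable {q : ℕ} {α : ℝ} {D : Set ℝ}

theorem mul_volume_le_volume_inter_closedBall (hD : TailInvariant q α D) (h : Admissible q α)
    (hDm : MeasurableSet D) {x : ℝ} (hx : x ∈ infiniteExpansion q α) (n : ℕ) :
    ENNReal.ofReal (1 / (4 * S q α x (n + 1) ^ 2)) *
        volume (D ∩ Set.Ico (lam q * (α - 1)) (lam q * α)) ≤
      volume (D ∩ Metric.closedBall x (convergentRadius q α x n)) := by
  obtain ⟨N, hN, hNm, hN0⟩ := exists_measurable_superset_of_null (ae_iff.1 ae_transcendental)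
  have hnull : volume (D ∩ Set.Ico (lam q * (α - 1)) (lam q * α)) =
      volume ((D ∩ Set.Ico (lam q * (α - 1)) (lam q * α)) \ N) :=
    (measure_sdiff_null hN0).symm
  rw [hnull]
  refine (h.mul_volume_le_volume_image_convergentMap hx n
    ((hDm.inter measurableSet_Ico).diff hNm) fun t ht => ht.1.2).trans (measure_mono ?_)
  rintro _ ⟨t, ⟨⟨htD, htI⟩, htN⟩, rfl⟩
  have htr : Transcendental ℚ t := not_not.1 fun ht => htN (hN ht)
  exact ⟨(hD.convergentMap_mem_iff h hx.2 n htr).2 htD, h.convergentMap_mem_closedBall hx n htI⟩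

/- `convergentMap` takes the fundamental interval into a ball around `x` with bounded distortion, so
at every scale `convergentRadius` the density of `D` at `x` is at least a fixed multiple of the
measure of `D` in the interval. -/
theorem mul_volume_le_density (hD : TailInvariant q α D) (h : Admissible q α)
    (hDm : MeasurableSet D) {x : ℝ} (hx : x ∈ infiniteExpansion q α) (n : ℕ) :
    ENNReal.ofReal ((1 - lam q / 2) ^ 2 / (8 * lam q)) *
        volume (D ∩ Set.Ico (lam q * (α - 1)) (lam q * α)) ≤
      volume (D ∩ Metric.closedBall x (convergentRadius q α x n)) /
        volume (Metric.closedBall x (convergentRadius q α x n)) := by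
  have hr := h.convergentRadius_pos hx n
  have hS := (h.S_pos hx (n + 1)).ne'
  have hl := h.lam_pos.ne'
  have hden : 2 - lam q ≠ 0 := by linarith [h.lam_lt_two]
  have hscale : 2 * convergentRadius q α x n * ((1 - lam q / 2) ^ 2 / (8 * lam q)) =
      1 / (4 * S q α x (n + 1) ^ 2) := by
    rw [convergentRadius]
    field_simp
    norm_num
  rw [Real.volume_closedBall, ENNReal.le_div_iff_mul_le
    (Or.inl (ENNReal.ofReal_pos.2 (by positivity)).ne') (Or.inl ENNReal.ofReal_ne_top), mul_comm,
    ← mul_assoc, ← ENNReal.ofReal_mul (by positivity), hscale]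
  exact hD.mul_volume_le_volume_inter_closedBall h hDm hx n

theorem ae_mem (hD : TailInvariant q α D) (h : Admissible q α) (hDm : MeasurableSet D)
    (hpos : volume (D ∩ Set.Ico (lam q * (α - 1)) (lam q * α)) ≠ 0) :
    ∀ᵐ x : ℝ, x ∈ Set.Ico (lam q * (α - 1)) (lam q * α) → x ∈ D := by
  filter_upwards [Besicovitch.ae_tendsto_measure_inter_div_of_measurableSet volume hDm,
    ae_transcendental] with x hdensity htr hxI
  by_contra hxD
  have hx := mem_infiniteExpansion_of_transcendental hxI htr
  rw [Set.indicator_of_notMem hxD] at hdensity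
  have hzero := ge_of_tendsto' (hdensity.comp (h.tendsto_convergentRadius hx))
    (hD.mul_volume_le_density h hDm hx)
  rw [nonpos_iff_eq_zero, mul_eq_zero, or_iff_left hpos, ENNReal.ofReal_eq_zero] at hzero
  have hratio : 0 < (1 - lam q / 2) ^ 2 / (8 * lam q) :=
    div_pos (pow_pos (by linarith [h.lam_lt_two]) 2) (by linarith [h.lam_pos])
  linarith

end TailInvariant

theorem Admissible.volume_inter_eq_zero_or {q : ℕ} {α : ℝ} (h : Admissible q α) {A : Set ℝ}
    (hAm : MeasurableSet A) (hA : T q α ⁻¹' A = A) :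
    volume (A ∩ Set.Ico (lam q * (α - 1)) (lam q * α)) = 0 ∨
      volume (Aᶜ ∩ Set.Ico (lam q * (α - 1)) (lam q * α)) = 0 := by
  refine or_iff_not_imp_left.2 fun hpos => ?_
  have hreduce : ∀ t ∈ Set.Ico (lam q * (α - 1)) (lam q * α), (t ∈ reduce q α ⁻¹' A ↔ t ∈ A) :=
    fun t ht => by rw [Set.mem_preimage, reduce_of_mem h.lam_pos ht]
  have hinter : reduce q α ⁻¹' A ∩ Set.Ico (lam q * (α - 1)) (lam q * α) =
      A ∩ Set.Ico (lam q * (α - 1)) (lam q * α) :=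
    Set.ext fun t => and_congr_left (hreduce t)
  have hae := (h.tailInvariant_preimage_reduce hA).ae_mem h (measurable_reduce hAm)
    (by rwa [hinter])
  refine measure_mono_null (fun t ht => ?_) hae
  exact fun himp => ht.1 ((hreduce t ht.2).1 (himp ht.2))

/-- The projection to the first coordinate of the normalized invariant measure of the natural
extension. -/
noncomputable def invariantMeasure (q : ℕ) (α : ℝ) : Measure ℝ :=
  (stairMeasure q α Set.univ)⁻¹ • (stairMeasure q α).map Prod.fst

section InvariantMeasure

variable {q : ℕ} {α : ℝ} {s : Set ℝ}

theorem invariantMeasure_apply (hs : MeasurableSet s) :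
    invariantMeasure q α s =
      (stairMeasure q α Set.univ)⁻¹ * stairMeasure q α (Prod.fst ⁻¹' s) := by
  rw [invariantMeasure, Measure.smul_apply, Measure.map_apply measurable_fst hs, smul_eq_mul]

theorem invariantMeasure_eq_zero_of_volume_inter_eq_zero (hs : MeasurableSet s)
    (hzero : volume (s ∩ Set.Ico (lam q * (α - 1)) (lam q * α)) = 0) :
    invariantMeasure q α s = 0 := by
  rw [invariantMeasure_apply hs]
  refine mul_eq_zero_of_right _ (stairMeasure_absolutelyContinuous ?_)
  rw [Measure.restrict_apply (measurable_fst hs)]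
  refine measure_mono_null (t := (s ∩ Set.Ico (lam q * (α - 1)) (lam q * α)) ×ˢ Set.univ)
    (fun z hz => ⟨⟨hz.1, hz.2.1⟩, trivial⟩) ?_
  rw [Measure.volume_eq_prod, Measure.prod_prod, hzero, zero_mul]

namespace Admissible

theorem C_eq (h : Admissible q α) : C q α = ((stairMeasure q α).real Set.univ)⁻¹ := by
  have hmeas : Measurable fun z : ℝ × ℝ => 1 / (1 + z.1 * z.2) ^ 2 := by fun_prop
  rw [C, h.Omega_eq_stair, measureReal_def, stairMeasure_apply MeasurableSet.univ, Set.univ_inter,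
    integral_eq_lintegral_of_nonneg_ae (Eventually.of_forall fun z => by positivity)
      hmeas.aestronglyMeasurable]
  rfl

theorem invariantMeasure_real (h : Admissible q α) (hs : MeasurableSet s) :
    (invariantMeasure q α).real s = C q α * (stairMeasure q α).real (Prod.fst ⁻¹' s) := by
  rw [measureReal_def, invariantMeasure_apply hs, ENNReal.toReal_mul, ENNReal.toReal_inv, h.C_eq,
    measureReal_def, measureReal_def]

theorem volume_restrict_absolutelyContinuous (h : Admissible q α) :
    volume.restrict (stair q α) ≪ stairMeasure q α := by
  refine withDensity_absolutelyContinuous' measurable_invDensity.aemeasurable ?_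
  filter_upwards [ae_restrict_mem measurableSet_stair] with z hz
  have hden := h.one_add_mul_pos hz.1.1 hz.2.1 hz.2.2.1
  exact (ENNReal.ofReal_pos.2 (by positivity)).ne'

theorem Ico_prod_Icc_subset_stair (h : Admissible q α) :
    Set.Ico (lam q * (α - 1)) (lam q * α) ×ˢ Set.Icc 0 (height (lam q) 1) ⊆ stair q α := by
  have hq := h.four_le
  rintro ⟨t, v⟩ ⟨ht, hv⟩
  refine ⟨ht, hv.1, hv.2.trans (height_le_one hq h.even (by omega)), fun j hj hlt => ?_⟩
  rcases Nat.eq_zero_or_pos j with rfl | hjpos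
  · rw [h.threshold_zero] at hlt
    exact absurd ht.1 hlt.not_ge
  · exact hv.2.trans (h.height_mono hjpos (by omega))

theorem volume_inter_eq_zero_of_stairMeasure_eq_zero (h : Admissible q α)
    (hzero : stairMeasure q α (Prod.fst ⁻¹' s) = 0) :
    volume (s ∩ Set.Ico (lam q * (α - 1)) (lam q * α)) = 0 := by
  have hl := h.lam_pos
  have hheight : 0 < height (lam q) 1 := by
    simp only [height]
    positivity
  have hprod : volume ((s ∩ Set.Ico (lam q * (α - 1)) (lam q * α)) ×ˢ
      Set.Icc (0 : ℝ) (height (lam q) 1)) = 0 := by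
    refine measure_mono_null (fun z hz => ?_) (le_zero_iff.1 ((Measure.le_restrict_apply _ _).trans
      (h.volume_restrict_absolutelyContinuous hzero).le))
    exact ⟨hz.1.1, h.Ico_prod_Icc_subset_stair ⟨hz.1.2, hz.2⟩⟩
  rw [Measure.volume_eq_prod, Measure.prod_prod, mul_eq_zero, Real.volume_Icc,
    ENNReal.ofReal_eq_zero] at hprod
  exact hprod.resolve_right (by linarith)

theorem stairMeasure_univ_ne_zero (h : Admissible q α) : stairMeasure q α Set.univ ≠ 0 := by
  intro hzero
  have hvol := h.volume_inter_eq_zero_of_stairMeasure_eq_zero (s := Set.univ)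
    (by rwa [Set.preimage_univ])
  rw [Set.univ_inter, Real.volume_Ico, ENNReal.ofReal_eq_zero] at hvol
  linarith [h.lam_pos]

theorem C_pos (h : Admissible q α) : 0 < C q α := by
  rw [h.C_eq]
  exact inv_pos.2 (ENNReal.toReal_pos h.stairMeasure_univ_ne_zero h.stairMeasure_univ_lt_top.ne)

theorem isProbabilityMeasure_invariantMeasure (h : Admissible q α) :
    IsProbabilityMeasure (invariantMeasure q α) := by
  refine ⟨?_⟩
  rw [invariantMeasure_apply MeasurableSet.univ, Set.preimage_univ]
  exact ENNReal.inv_mul_cancel h.stairMeasure_univ_ne_zero h.stairMeasure_univ_lt_top.ne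

theorem measurePreserving_T (h : Admissible q α) :
    MeasurePreserving (T q α) (invariantMeasure q α) (invariantMeasure q α) :=
  (MeasurePreserving.of_semiconj ⟨measurable_fst, rfl⟩ h.measurePreserving_natExt
    (fun _ => rfl) measurable_T).smul_measure _

theorem ergodic_T (h : Admissible q α) : Ergodic (T q α) (invariantMeasure q α) := by
  refine ⟨h.measurePreserving_T, ⟨fun A hA hinv => ?_⟩⟩
  rw [eventuallyConst_set]
  rcases h.volume_inter_eq_zero_or hA hinv with hzero | hzero
  · exact Or.inr (measure_eq_zero_iff_ae_notMem.1
      (invariantMeasure_eq_zero_of_volume_inter_eq_zero hA hzero))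
  · exact Or.inl (invariantMeasure_eq_zero_of_volume_inter_eq_zero hA.compl hzero)

theorem ae_restrict_X_of_ae_invariantMeasure (h : Admissible q α) {P : ℝ → Prop}
    (hP : ∀ᵐ x ∂invariantMeasure q α, P x) : ∀ᵐ x ∂volume.restrict (X q α), P x := by
  obtain ⟨N, hN, hNm, hN0⟩ := exists_measurable_superset_of_null hP
  rw [invariantMeasure_apply hNm, mul_eq_zero, ENNReal.inv_eq_zero] at hN0
  have hvol := h.volume_inter_eq_zero_of_stairMeasure_eq_zero
    (hN0.resolve_left h.stairMeasure_univ_lt_top.ne)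
  rw [X, ← restrict_Ico_eq_restrict_Icc, ae_iff]
  refine measure_mono_null hN ?_
  rw [Measure.restrict_apply hNm, hvol]

end Admissible

theorem ae_mem_infiniteExpansion :
    ∀ᵐ x ∂volume.restrict (X q α), x ∈ infiniteExpansion q α := by
  rw [X, ← restrict_Ico_eq_restrict_Icc]
  filter_upwards [ae_restrict_mem measurableSet_Ico, ae_restrict_of_ae ae_transcendental]
    with x hx htr
  exact mem_infiniteExpansion_of_transcendental hx htr

theorem ae_stairMeasure_mem :
    ∀ᵐ z ∂stairMeasure q α, z ∈ stair q α ∧ z.1 ∈ infiniteExpansion q α := by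
  apply stairMeasure_absolutelyContinuous.ae_le
  have htr : ∀ᵐ z : ℝ × ℝ, Transcendental ℚ z.1 :=
    Measure.quasiMeasurePreserving_fst.ae ae_transcendental
  filter_upwards [ae_restrict_mem (measurableSet_stair (q := q) (α := α)), ae_restrict_of_ae htr]
    with z hz hztr
  exact ⟨hz, mem_infiniteExpansion_of_transcendental hz.1 hztr⟩

end InvariantMeasure

/-! ### Approximation of the coefficients along orbits -/

section Memory

variable {q : ℕ} {α x : ℝ} {a b : ℝ × ℝ}

namespace Admissible

theorem abs_natExt_snd_sub (h : Admissible q α) (ha : a ∈ stair q α) (hb : b ∈ stair q α)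
    (hab : a.1 = b.1) (ha0 : a.1 ≠ 0) :
    |(natExt q α a).2 - (natExt q α b).2| =
      (natExt q α a).2 * (natExt q α b).2 * |a.2 - b.2| := by
  have hb0 : b.1 ≠ 0 := hab ▸ ha0
  have hda := (zero_lt_one.trans_le (h.one_le_natExt_den ha ha0)).ne'
  have hdb := (zero_lt_one.trans_le (h.one_le_natExt_den hb hb0)).ne'
  have hprod := mul_nonneg (h.natExt_mem ha ha0).2.1 (h.natExt_mem hb hb0).2.1
  have hsub : (natExt q α a).2 - (natExt q α b).2 =
      (natExt q α a).2 * (natExt q α b).2 * (Real.sign a.1 * (b.2 - a.2)) := by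
    simp only [natExt]
    rw [← hab] at hdb ⊢
    field_simp
    ring
  rw [hsub, abs_mul, abs_mul _ (b.2 - a.2), abs_sign ha0, one_mul, abs_of_nonneg hprod,
    abs_sub_comm]

theorem abs_iterate_two_natExt_snd_sub_le (h : Admissible q α) (ha : a ∈ stair q α)
    (hb : b ∈ stair q α) (hab : a.1 = b.1) (ha0 : a.1 ≠ 0) (hT : T q α a.1 ≠ 0) :
    |((natExt q α)^[2] a).2 - ((natExt q α)^[2] b).2| ≤ rate q * |a.2 - b.2| := by
  have hb0 : b.1 ≠ 0 := hab ▸ ha0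
  have hab1 : (natExt q α a).1 = (natExt q α b).1 := by rw [natExt, natExt, hab]
  have ha1 : (natExt q α a).1 ≠ 0 := hT
  have hb1 : (natExt q α b).1 ≠ 0 := hab1 ▸ ha1
  have hma := h.natExt_mem ha ha0
  have hmb := h.natExt_mem hb hb0
  have hrate := (rate_lt_one h.four_le).le
  change |(natExt q α (natExt q α a)).2 - (natExt q α (natExt q α b)).2| ≤ _
  rw [h.abs_natExt_snd_sub hma hmb hab1 ha1, h.abs_natExt_snd_sub ha hb hab ha0, ← mul_assoc,
    mul_mul_mul_comm]
  refine mul_le_mul_of_nonneg_right ?_ (abs_nonneg _)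
  rw [mul_comm (natExt q α (natExt q α a)).2, mul_comm (natExt q α (natExt q α b)).2]
  exact (mul_le_of_le_one_right (mul_nonneg hma.2.1 (h.natExt_mem hma ha1).2.1)
    ((h.mul_natExt_snd_le hmb hb1).trans hrate)).trans (h.mul_natExt_snd_le hma ha1)

theorem abs_iterate_natExt_snd_sub_le (h : Admissible q α) (ha : a ∈ stair q α)
    (hb : b ∈ stair q α) (hab : a.1 = b.1) (hax : a.1 ∈ infiniteExpansion q α) (k : ℕ) :
    |((natExt q α)^[2 * k] a).2 - ((natExt q α)^[2 * k] b).2| ≤ rate q ^ k := by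
  induction k with
  | zero =>
    rw [mul_zero, Function.iterate_zero_apply, Function.iterate_zero_apply, pow_zero,
      abs_sub_le_iff]
    constructor <;> linarith [ha.2.1, ha.2.2.1, hb.2.1, hb.2.2.1]
  | succ k ih =>
    have hfst : ((natExt q α)^[2 * k] a).1 = ((natExt q α)^[2 * k] b).1 := by
      rw [iterate_natExt_fst, iterate_natExt_fst, hab]
    have hstep := h.abs_iterate_two_natExt_snd_sub_le (h.iterate_natExt_mem ha hax (2 * k))
      (h.iterate_natExt_mem hb (hab ▸ hax) (2 * k)) hfst
      (by rw [iterate_natExt_fst]; exact hax.2 _)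
      (by rw [iterate_natExt_fst, ← Function.iterate_succ_apply' (T q α)]; exact hax.2 _)
    rw [mul_add, mul_one, add_comm, Function.iterate_add_apply, Function.iterate_add_apply _ _ _ b,
      pow_succ']
    exact hstep.trans (mul_le_mul_of_nonneg_left ih (rate_pos (by linarith [h.four_le])).le)

theorem abs_coeff_sub_le (h : Admissible q α) (ha : a ∈ stair q α) (hb : b ∈ stair q α)
    (hab : a.1 = b.1) : |coeff a - coeff b| ≤ 1 / (1 - lam q / 2) ^ 2 * |a.2 - b.2| := by
  have hlea := h.le_one_add_mul ha.1.1 ha.2.1 ha.2.2.1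
  have hleb := h.le_one_add_mul hb.1.1 hb.2.1 hb.2.2.1
  have hl : 0 < 1 - lam q / 2 := by linarith [h.lam_lt_two]
  have habs := (h.abs_le_right (Set.Ico_subset_Icc_self ha.1)).trans h.right_le_one
  rw [← hab] at hleb
  have hposa : 0 < 1 + a.1 * a.2 := hl.trans_le hlea
  have hposb : 0 < 1 + a.1 * b.2 := hl.trans_le hleb
  have hsub : coeff a - coeff b =
      |a.1| * a.1 * (b.2 - a.2) / ((1 + a.1 * a.2) * (1 + a.1 * b.2)) := by
    rw [coeff, coeff, ← hab, div_sub_div _ _ hposa.ne' hposb.ne']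
    congr 1
    ring
  rw [hsub, abs_div, abs_mul, abs_mul, abs_abs, abs_of_pos (mul_pos hposa hposb),
    abs_sub_comm b.2, one_div_mul_eq_div, sq]
  gcongr
  exact mul_le_of_le_one_left (abs_nonneg _) (mul_le_one₀ habs (abs_nonneg _) habs)

end Admissible

/-- A bound for the change of `coeff` at the end of an orbit of length `2 * k` of the natural
extension when the initial second coordinate is changed. -/
noncomputable def memoryError (q k : ℕ) : ℝ := 1 / (1 - lam q / 2) ^ 2 * rate q ^ k

/-- The value of `coeff` along the natural extension when it is started `2 * k` steps earlier from
second coordinate `0`: a function of the first coordinate at that time, which approximates the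
true value within `memoryError q k`. -/
noncomputable def truncCoeff (q : ℕ) (α : ℝ) (k : ℕ) (y : ℝ) : ℝ :=
  coeff ((natExt q α)^[2 * k] (y, 0))

theorem measurable_truncCoeff (k : ℕ) : Measurable (truncCoeff q α k) :=
  measurable_coeff.comp ((measurable_natExt.iterate _).comp (measurable_id.prodMk measurable_const))

theorem tendsto_memoryError (hq : 4 ≤ q) : Tendsto (memoryError q) atTop (𝓝 0) := by
  have hpow := (tendsto_pow_atTop_nhds_zero_of_lt_one (rate_pos (by omega)).le
    (rate_lt_one hq)).const_mul (1 / (1 - lam q / 2) ^ 2)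
  rwa [mul_zero] at hpow

namespace Admissible

theorem abs_coeff_iterate_sub_truncCoeff_le (h : Admissible q α) (ha : a ∈ stair q α)
    (hax : a.1 ∈ infiniteExpansion q α) (k : ℕ) :
    |coeff ((natExt q α)^[2 * k] a) - truncCoeff q α k a.1| ≤ memoryError q k := by
  have h0 := h.mk_zero_mem_stair hax.1
  refine (h.abs_coeff_sub_le (h.iterate_natExt_mem ha hax _) (h.iterate_natExt_mem h0 hax _)
    ?_).trans (mul_le_mul_of_nonneg_left (h.abs_iterate_natExt_snd_sub_le ha h0 rfl hax k)
      (by positivity))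
  rw [iterate_natExt_fst, iterate_natExt_fst]

theorem abs_Theta_sub_truncCoeff_le (h : Admissible q α) (hx : x ∈ infiniteExpansion q α)
    (k n : ℕ) : |Theta q α x (n + 2 * k) - truncCoeff q α k ((T q α)^[n] x)| ≤ memoryError q k := by
  have hmem := h.iterate_natExt_mem (h.mk_zero_mem_stair hx.1) hx n
  have hle := h.abs_coeff_iterate_sub_truncCoeff_le hmem
    (by rw [iterate_natExt_fst]; exact iterate_T_mem_infiniteExpansion h.lam_pos hx n) k
  rwa [iterate_natExt_fst, ← Function.iterate_add_apply, ← h.Theta_eq_coeff hx,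
    add_comm (2 * k)] at hle

theorem stairMeasure_real_preimage_iterate (h : Admissible q α) {E : Set (ℝ × ℝ)}
    (hE : MeasurableSet E) (n : ℕ) :
    (stairMeasure q α).real ((natExt q α)^[n] ⁻¹' E) = (stairMeasure q α).real E :=
  congrArg ENNReal.toReal
    ((h.measurePreserving_natExt.iterate n).measure_preimage hE.nullMeasurableSet)

theorem invariantMeasure_truncCoeff_lt_le (h : Admissible q α) (k : ℕ) (c : ℝ) :
    (invariantMeasure q α).real {y | truncCoeff q α k y < c} ≤
      C q α * (stairMeasure q α).real (smallCoeff (c + memoryError q k)) := by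
  have := h.isFiniteMeasure_stairMeasure
  rw [h.invariantMeasure_real (measurableSet_lt (measurable_truncCoeff k) measurable_const),
    ← h.stairMeasure_real_preimage_iterate (measurableSet_smallCoeff _) (2 * k)]
  refine mul_le_mul_of_nonneg_left (ENNReal.toReal_mono (measure_ne_top _ _)
    (measure_mono_ae ?_)) h.C_pos.le
  filter_upwards [ae_stairMeasure_mem] with z ⟨hz, hzx⟩ (hlt : truncCoeff q α k z.1 < c)
  change coeff ((natExt q α)^[2 * k] z) < c + memoryError q k
  linarith [(abs_sub_le_iff.1 (h.abs_coeff_iterate_sub_truncCoeff_le hz hzx k)).1]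

theorem le_invariantMeasure_truncCoeff_lt (h : Admissible q α) (k : ℕ) (c : ℝ) :
    C q α * (stairMeasure q α).real (smallCoeff (c - memoryError q k)) ≤
      (invariantMeasure q α).real {y | truncCoeff q α k y < c} := by
  have := h.isFiniteMeasure_stairMeasure
  rw [h.invariantMeasure_real (measurableSet_lt (measurable_truncCoeff k) measurable_const),
    ← h.stairMeasure_real_preimage_iterate (measurableSet_smallCoeff _) (2 * k)]
  refine mul_le_mul_of_nonneg_left (ENNReal.toReal_mono (measure_ne_top _ _)
    (measure_mono_ae ?_)) h.C_pos.le
  filter_upwards [ae_stairMeasure_mem] with z ⟨hz, hzx⟩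
    (hlt : coeff ((natExt q α)^[2 * k] z) < c - memoryError q k)
  change truncCoeff q α k z.1 < c
  linarith [(abs_sub_le_iff.1 (h.abs_coeff_iterate_sub_truncCoeff_le hz hzx k)).2]

end Admissible

end Memory

/-! ### Frequencies -/

section Counting

variable {P Q : ℕ → Prop} [DecidablePred P] [DecidablePred Q] {m : ℕ} {a l : ℝ}

theorem card_filter_Icc_le (hPQ : ∀ n, P (n + m) → Q n) (N : ℕ) :
    ((Finset.Icc 1 N).filter P).card ≤ ((Finset.range N).filter Q).card + (m + 1) := by
  have hsub : (Finset.Icc 1 N).filter P ⊆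
      insert N (((Finset.range N).filter Q).image (· + m) ∪ Finset.range m) := by
    intro n hn
    simp only [Finset.mem_filter, Finset.mem_Icc, Finset.mem_insert, Finset.mem_union,
      Finset.mem_image, Finset.mem_range] at hn ⊢
    rcases lt_or_ge n m with hnm | hmn
    · exact Or.inr (Or.inr hnm)
    · rcases hn.1.2.eq_or_lt with rfl | hnN
      · exact Or.inl rfl
      · refine Or.inr (Or.inl ⟨n - m, ⟨by omega, hPQ _ ?_⟩, Nat.sub_add_cancel hmn⟩)
        rw [Nat.sub_add_cancel hmn]
        exact hn.2
  calc ((Finset.Icc 1 N).filter P).card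
      ≤ (((Finset.range N).filter Q).image (· + m) ∪ Finset.range m).card + 1 :=
        (Finset.card_le_card hsub).trans (Finset.card_insert_le _ _)
    _ ≤ ((Finset.range N).filter Q).card + m + 1 := by
        refine Nat.add_le_add_right ((Finset.card_union_le _ _).trans ?_) 1
        exact add_le_add Finset.card_image_le (Finset.card_range m).le

theorem card_filter_range_le (hQP : ∀ n, Q n → P (n + m)) (N : ℕ) :
    ((Finset.range N).filter Q).card ≤ ((Finset.Icc 1 N).filter P).card + (m + 1) := by
  have hcompl := card_filter_Icc_le (P := fun n => ¬P n) (Q := fun n => ¬Q n)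
    (fun n => mt (hQP n)) N
  have hP := Finset.card_filter_add_card_filter_not (s := Finset.Icc 1 N) P
  have hQ := Finset.card_filter_add_card_filter_not (s := Finset.range N) Q
  rw [Nat.card_Icc] at hP
  rw [Finset.card_range] at hQ
  omega

theorem eventually_card_filter_Icc_div_lt (hPQ : ∀ n, P (n + m) → Q n)
    (hQ : Tendsto (fun N : ℕ => (((Finset.range N).filter Q).card : ℝ) / N) atTop (𝓝 l))
    (hla : l < a) : ∀ᶠ N : ℕ in atTop, (((Finset.Icc 1 N).filter P).card : ℝ) / N < a := by
  have hlim := hQ.add (tendsto_const_div_atTop_nhds_zero_nat ((m : ℝ) + 1))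
  rw [add_zero] at hlim
  filter_upwards [hlim.eventually_lt_const hla] with N hN
  refine lt_of_le_of_lt ?_ hN
  rw [← add_div]
  gcongr
  exact_mod_cast card_filter_Icc_le hPQ N

theorem eventually_lt_card_filter_Icc_div (hQP : ∀ n, Q n → P (n + m))
    (hQ : Tendsto (fun N : ℕ => (((Finset.range N).filter Q).card : ℝ) / N) atTop (𝓝 l))
    (hal : a < l) : ∀ᶠ N : ℕ in atTop, a < (((Finset.Icc 1 N).filter P).card : ℝ) / N := by
  have hlim := hQ.sub (tendsto_const_div_atTop_nhds_zero_nat ((m : ℝ) + 1))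
  rw [sub_zero] at hlim
  filter_upwards [hlim.eventually_const_lt hal] with N hN
  refine hN.trans_le ?_
  rw [← sub_div]
  gcongr
  rw [sub_le_iff_le_add]
  exact_mod_cast card_filter_range_le hQP N

end Counting

section Frequency

variable {q : ℕ} {α c : ℝ}

theorem exists_rat_memoryError_le (hq : 4 ≤ q) {y z : ℝ} (hyz : y < z) :
    ∃ (k : ℕ) (c : ℚ), y ≤ c - memoryError q k ∧ c + memoryError q k ≤ z := by
  obtain ⟨c, hyc, hcz⟩ := exists_rat_btwn hyz
  obtain ⟨k, hk⟩ := ((tendsto_memoryError hq).eventually_lt_const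
    (lt_min (sub_pos.2 hyc) (sub_pos.2 hcz))).exists
  rw [lt_min_iff] at hk
  exact ⟨k, c, by linarith, by linarith⟩

namespace Admissible

theorem ae_tendsto_card_truncCoeff_lt (h : Admissible q α) :
    ∀ᵐ x ∂volume.restrict (X q α), ∀ (k : ℕ) (c : ℚ),
      Tendsto (fun N : ℕ => (((Finset.range N).filter
        fun n => truncCoeff q α k ((T q α)^[n] x) < c).card : ℝ) / N) atTop
        (𝓝 ((invariantMeasure q α).real {y | truncCoeff q α k y < c})) := by
  have := h.isProbabilityMeasure_invariantMeasure
  refine ae_all_iff.2 fun k => ae_all_iff.2 fun c => h.ae_restrict_X_of_ae_invariantMeasure ?_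
  have hmeas : MeasurableSet {y | truncCoeff q α k y < c} :=
    measurableSet_lt (measurable_truncCoeff k) measurable_const
  filter_upwards [ae_tendsto_card_visits_div h.ergodic_T hmeas] with x hx
  simpa only [Set.mem_ofPred_eq] using hx

theorem ae_eventually_lt_card_Theta_lt (h : Admissible q α) :
    ∀ᵐ x ∂volume.restrict (X q α), ∀ y z a : ℝ, y < z →
      a < C q α * (stairMeasure q α).real (smallCoeff y) → ∀ᶠ N : ℕ in atTop,
        a < (((Finset.Icc 1 N).filter fun n => Theta q α x n < z).card : ℝ) / N := by
  have := h.isFiniteMeasure_stairMeasure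
  filter_upwards [h.ae_tendsto_card_truncCoeff_lt, ae_mem_infiniteExpansion]
    with x hfreq hx y z a hyz ha
  obtain ⟨k, c, hyc, hcz⟩ := exists_rat_memoryError_le h.four_le hyz
  refine eventually_lt_card_filter_Icc_div (m := 2 * k) (fun n hn => ?_) (hfreq k c)
    (ha.trans_le ((mul_le_mul_of_nonneg_left (measureReal_mono fun z hz => ?_) h.C_pos.le).trans
      (h.le_invariantMeasure_truncCoeff_lt k c)))
  · linarith [(abs_sub_le_iff.1 (h.abs_Theta_sub_truncCoeff_le hx k n)).1]
  · exact lt_of_lt_of_le hz hyc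

theorem ae_eventually_card_Theta_lt_lt (h : Admissible q α) :
    ∀ᵐ x ∂volume.restrict (X q α), ∀ y z a : ℝ, y < z →
      C q α * (stairMeasure q α).real (smallCoeff z) < a → ∀ᶠ N : ℕ in atTop,
        (((Finset.Icc 1 N).filter fun n => Theta q α x n < y).card : ℝ) / N < a := by
  have := h.isFiniteMeasure_stairMeasure
  filter_upwards [h.ae_tendsto_card_truncCoeff_lt, ae_mem_infiniteExpansion]
    with x hfreq hx y z a hyz ha
  obtain ⟨k, c, hyc, hcz⟩ := exists_rat_memoryError_le h.four_le hyz
  refine eventually_card_filter_Icc_div_lt (m := 2 * k) (fun n hn => ?_) (hfreq k c)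
    (((h.invariantMeasure_truncCoeff_lt_le k c).trans
      (mul_le_mul_of_nonneg_left (measureReal_mono fun z hz => ?_) h.C_pos.le)).trans_lt ha)
  · linarith [(abs_sub_le_iff.1 (h.abs_Theta_sub_truncCoeff_le hx k n)).2]
  · exact lt_of_lt_of_le hz hcz

theorem C_mul_stairMeasure_smallCoeff_le (h : Admissible q α) (hc : 0 ≤ c) :
    C q α * (stairMeasure q α).real (smallCoeff c) ≤ lam q * C q α * c := by
  rw [mul_comm (lam q), mul_assoc]
  exact mul_le_mul_of_nonneg_left (ENNReal.toReal_le_of_le_ofReal (mul_nonneg h.lam_pos.le hc)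
    (h.stairMeasure_smallCoeff_le hc)) h.C_pos.le

theorem C_mul_stairMeasure_smallCoeff_of_le (h : Admissible q α) (hc : 0 ≤ c) (hcL : c ≤ L q α) :
    C q α * (stairMeasure q α).real (smallCoeff c) = lam q * C q α * c := by
  rw [measureReal_def, h.stairMeasure_smallCoeff_of_le hc hcL,
    ENNReal.toReal_ofReal (mul_nonneg h.lam_pos.le hc)]
  ring

theorem ae_tendsto_card_Theta_lt (h : Admissible q α) :
    ∀ᵐ x ∂volume.restrict (X q α), ∀ c : ℝ, 0 < c → c ≤ L q α →
      Tendsto (fun N : ℕ => (((Finset.Icc 1 N).filter fun n => Theta q α x n < c).card : ℝ) / N)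
        atTop (𝓝 (lam q * C q α * c)) := by
  have hpos : 0 < lam q * C q α := mul_pos h.lam_pos h.C_pos
  filter_upwards [h.ae_eventually_lt_card_Theta_lt, h.ae_eventually_card_Theta_lt_lt]
    with x hlower hupper c hc hcL
  refine tendsto_order.2 ⟨fun a ha => ?_, fun a ha => ?_⟩
  · obtain ⟨y, hy, hyc⟩ := exists_between (max_lt hc ((div_lt_iff₀' hpos).2 ha))
    obtain ⟨hy0, hay⟩ := max_lt_iff.1 hy
    refine hlower y c a hyc ?_
    rwa [h.C_mul_stairMeasure_smallCoeff_of_le hy0.le (hyc.le.trans hcL), ← div_lt_iff₀' hpos]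
  · obtain ⟨y, hcy, hya⟩ := exists_between ((lt_div_iff₀' hpos).2 ha)
    exact hupper c y a hcy ((h.C_mul_stairMeasure_smallCoeff_le (hc.trans hcy).le).trans_lt
      ((lt_div_iff₀' hpos).1 hya))

theorem L_pos (h : Admissible q α) : 0 < L q α := by
  have hl := h.one_lt_lam
  have hl2 := h.lam_lt_two
  have hright := h.lam_mul_right_lt_two
  refine lt_min (by positivity) (div_pos (mul_pos h.lam_pos ?_) ?_) <;> nlinarith

end Admissible

end Frequency

end AlphaRosen

theorem mainTheorem12 (q : ℕ) (hq : 4 ≤ q) (hqe : Even q) (α : ℝ) (hα : 1 / 2 ≤ α)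
    (hα' : α ≤ 1 / AlphaRosen.lam q) :
    ∀ᵐ x ∂(volume.restrict (AlphaRosen.X q α)), ∀ c : ℝ, 1 / AlphaRosen.L q α ≤ c →
      Tendsto
        (fun N : ℕ =>
          (((Finset.Icc 1 N).filter (fun n : ℕ => AlphaRosen.Theta q α x n < 1 / c)).card : ℝ) / N)
        atTop (𝓝 (AlphaRosen.lam q * AlphaRosen.C q α / c)) := by
  have h : AlphaRosen.Admissible q α := ⟨hq, hqe, hα, hα'⟩
  filter_upwards [h.ae_tendsto_card_Theta_lt] with x hx c hc
  have hc0 : 0 < c := (one_div_pos.2 h.L_pos).trans_le hc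
  rw [← mul_one_div (_ * _)]
  exact hx (1 / c) (one_div_pos.2 hc0) ((one_div_le hc0 h.L_pos).2 hc)
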